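/- **Setting.** For a measure $c$ on $\mathbb N_0$ let $M_1(c)=\sum_k k\,c(k)\in[0,\infty]$. Let $\omega:\mathbb N_0\to[0,\infty)$ be a weight (for instance a probability measure) such that $Z(\varphi):=\sum_{n\ge0}\varphi^n\omega(n)<\infty$ for some $\varphi>0$. Put $\varphi_c:=\sup\{\varphi: Z(\varphi)<\infty\}\in(0,\infty]$, $\omega^{\varphi}(n):=\varphi^n\omega(n)/Z(\varphi)$ and $\rho_c:=\sup_{\varphi<\varphi_c}M_1(\omega^\varphi)\in[0,\infty]$. For a density $r$ let $\Phi(r)$ be the $\varphi$ with $0<Z(\varphi)<\infty$ and $M_1(\omega^{\varphi})=r$, and set $\Phi(r):=\varphi_c$ if there is none (for the densities below this happens only if $r>\rho_c$, or if $r=\rho_c$ is not attained); write $\omega^{r}:=\omega^{\Phi(r)}$. For $N,L\in\mathbb N_0$, $L\ge1$, let $V^{N,L}=\{\eta\in\mathbb N_0^L:\sum_x\eta_x=N\}$ and $\pi^{N,L}_\omega(\eta)=\frac1{\mathcal Z^{N,L}}\prod_{x=1}^L\omega(\eta_x)$ with normalization $\mathcal Z^{N,L}=\sum_{\eta\in V^{N,L}}\prod_x\omega(\eta_x)$,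 and let $\Pi^{N,L}_\omega$ be the law of $\frac1L\sum_{x=1}^L\delta_{\eta_x}$ under $\pi^{N,L}_\omega$. Let $\rho\in(0,\infty)$ be such that $\omega(j)>0$ for some $j<\rho$ and $\omega(k)>0$ for some $k>\rho$. Let $(N_n,L_n)_n$ satisfy $L_n\ge1$, $L_n\to\infty$, $N_n/L_n\to\rho$ and $\mathcal Z^{N_n,L_n}>0$, and let $\bar\rho<\infty$ satisfy $N_n/L_n\le\bar\rho$ for all $n$ (for instance $\bar\rho=\sup_n N_n/L_n$). Let $\mathcal P_{\le\bar\rho}$ be the set of probability measures on $\mathbb N_0$ with first moment at most $\bar\rho$, with the narrow topology, let $\mathcal P(\mathcal P_{\le\bar\rho})$ be the Borel probability measures on it, again with the narrow topology, and let $\mathrm{Ent}(\cdot|\cdot)\in[0,\infty]$ denote relative entropy. For $c\in\mathcal P_{\le\bar\rho}$ put $$F(c,\rho)=\mathrm{Ent}\bigl(c\,|\,\omega^{\rho\wedge\rho_c}\bigr)+\bigl(\log\Phi(\rho_c)-\log\Phi(\rho)\bigr)_+\bigl(\rho-M_1(c)\bigr)\quad\text{if } M_1(c)\le\rho,\qquad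 F(c,\rho)=+\infty\quad\text{if } M_1(c)>\rho,$$ with the conventions $+\infty\cdot0=0$ and $\log\infty=\infty$. **Theorem ($\Gamma$-convergence of energy).** (i) The functionals $\mathbb C\mapsto\mathrm{Ent}(\mathbb C\,|\,\Pi^{N_n,L_n}_\omega)$, and also the rescaled functionals $\mathbb C\mapsto\frac1{L_n}\mathrm{Ent}(\mathbb C\,|\,\Pi^{N_n,L_n}_\omega)$, are equicoercive on $\mathcal P(\mathcal P_{\le\bar\rho})$: for every $t<\infty$ one compact set contains the sublevel sets $\{\cdot\le t\}$ for all $n$. (ii) On $\mathcal P(\mathcal P_{\le\bar\rho})$ the functionals $\frac1{L_n}\mathrm{Ent}(\cdot\,|\,\Pi^{N_n,L_n}_\omega)$ $\Gamma$-converge to $\mathbb C\mapsto\int F(c,\rho)\,\mathbb C(dc)$: if $\mathbb C_n\to\mathbb C$ narrowly, then $\liminf_n\frac1{L_n}\mathrm{Ent}(\mathbb C_n|\Pi^{N_n,L_n}_\omega)\ge\int F(c,\rho)\,\mathbb C(dc)$, and for every $\mathbb C$ there is a sequence $\mathbb C_n\to\mathbb C$ with $\limsup_n\frac1{L_n}\mathrm{Ent}(\mathbb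 C_n|\Pi^{N_n,L_n}_\omega)\le\int F(c,\rho)\,\mathbb C(dc)$. (iii) On $\mathcal P_{\le\bar\rho}$ the sequence $(\Pi^{N_n,L_n}_\omega)_n$ is exponentially tight at speed $L_n$ and satisfies the large deviation principle at speed $L_n$ with the lower semicontinuous rate function $F(\cdot,\rho)$. -/

import Mathlib

open MeasureTheory Filter Topology InformationTheory
open scoped ENNReal NNReal

noncomputable section

namespace CanonicalEnsemble

/-! ### The state space of cluster distributions -/

/-- The first moment `M₁(μ) = ∑ k, k μ({k})` of a measure on `ℕ`, with values in `[0, ∞]`. -/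
def firstMoment (μ : Measure ℕ) : ℝ≥0∞ := ∫⁻ k, (k : ℝ≥0∞) ∂μ

/-- The space `𝒫_{≤ R}` of probability measures on `ℕ` with first moment at most `R`. -/
def MomentLE (R : ℝ≥0) : Type :=
  {c : ProbabilityMeasure ℕ // firstMoment (c : Measure ℕ) ≤ (R : ℝ≥0∞)}

/-- The narrow topology, inherited from the space of all probability measures on `ℕ`. -/
instance (R : ℝ≥0) : TopologicalSpace (MomentLE R) :=
  inferInstanceAs (TopologicalSpace
    {c : ProbabilityMeasure ℕ // firstMoment (c : Measure ℕ) ≤ (R : ℝ≥0∞)})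

/-- The Borel `σ`-algebra of the narrow topology. -/
instance (R : ℝ≥0) : MeasurableSpace (MomentLE R) := borel (MomentLE R)

instance (R : ℝ≥0) : BorelSpace (MomentLE R) := ⟨rfl⟩

/-- The underlying measure on `ℕ` of an element of `𝒫_{≤ R}`. -/
def MomentLE.toMeasure {R : ℝ≥0} (c : MomentLE R) : Measure ℕ := (c.1 : Measure ℕ)

/-! ### The one-parameter family of equilibrium distributions of a weight `w` -/

/-- The partition sum `Z(φ) = ∑ₙ φⁿ w(n)`. -/
def Z (w : ℕ → ℝ≥0) (φ : ℝ≥0∞) : ℝ≥0∞ := ∑' n, φ ^ n * (w n : ℝ≥0∞)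

/-- The measure `ω^φ(n) = φⁿ w(n) / Z(φ)` on `ℕ`. -/
def tilted (w : ℕ → ℝ≥0) (φ : ℝ≥0∞) : Measure ℕ :=
  Measure.count.withDensity fun n => φ ^ n * (w n : ℝ≥0∞) / Z w φ

/-- The critical fugacity `φ_c = sup {φ : Z(φ) < ∞}`. -/
def criticalFugacity (w : ℕ → ℝ≥0) : ℝ≥0∞ := sSup {φ | Z w φ < ∞}

/-- The critical density `ρ_c = sup_{φ < φ_c} M₁(ω^φ)`. -/
def criticalDensity (w : ℕ → ℝ≥0) : ℝ≥0∞ :=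
  ⨆ φ : ℝ≥0∞, ⨆ _ : φ < criticalFugacity w, firstMoment (tilted w φ)

/-- `ω^φ` is a well defined probability measure and has first moment `r`. -/
def IsFugacity (w : ℕ → ℝ≥0) (r φ : ℝ≥0∞) : Prop :=
  Z w φ ≠ 0 ∧ Z w φ ≠ ∞ ∧ firstMoment (tilted w φ) = r

open scoped Classical in
/-- `Φ(r)` is the `φ` with `M₁(ω^φ) = r` (there is at most one as soon as `w` charges two points).
If there is none, which for densities `r` above the smallest point charged by `w` happens only if
`r > ρ_c`, or if `r = ρ_c` is approached but not attained, then `Φ(r)` is read as `φ_c`. -/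
def fugacity (w : ℕ → ℝ≥0) (r : ℝ≥0∞) : ℝ≥0∞ :=
  if h : ∃ φ, IsFugacity w r φ then h.choose else criticalFugacity w

/-- The equilibrium distribution `ω^r = ω^{Φ(r)}` of density `r`. -/
def equilibrium (w : ℕ → ℝ≥0) (r : ℝ≥0∞) : Measure ℕ := tilted w (fugacity w r)

/-- The rate function: for `M₁(c) ≤ ρ` it is
`Ent(c | ω^{ρ ∧ ρ_c}) + (log Φ(ρ_c) - log Φ(ρ))₊ (ρ - M₁(c))`, with `∞ * 0 = 0`,
and it is `∞` for `M₁(c) > ρ`. (`EReal.toENNReal` is the positive part.) -/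
def rate (w : ℕ → ℝ≥0) (ρ : ℝ≥0) (c : Measure ℕ) : ℝ≥0∞ :=
  open scoped Classical in
  if firstMoment c ≤ (ρ : ℝ≥0∞) then
    klDiv c (equilibrium w (min (ρ : ℝ≥0∞) (criticalDensity w)))
      + (ENNReal.log (fugacity w (criticalDensity w))
          - ENNReal.log (fugacity w (ρ : ℝ≥0∞))).toENNReal * ((ρ : ℝ≥0∞) - firstMoment c)
  else ∞

/-! ### The canonical measures -/

/-- The configurations of `N` particles on `L` sites. -/
abbrev Config (N L : ℕ) : Type := {η : Fin L → ℕ // ∑ x, η x = N}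

/-- The product weight `∏ₓ w(ηₓ)`. -/
def weight (w : ℕ → ℝ≥0) {N L : ℕ} (η : Config N L) : ℝ≥0∞ := ∏ x, (w (η.1 x) : ℝ≥0∞)

/-- The normalization `𝒵^{N,L}` of the canonical measure (a sum over a finite set). -/
def normalization (w : ℕ → ℝ≥0) (N L : ℕ) : ℝ≥0∞ := ∑' η : Config N L, weight w η

/-- The canonical measure `π^{N,L}(η) = (𝒵^{N,L})⁻¹ ∏ₓ w(ηₓ)` on configurations. -/
def canonical (w : ℕ → ℝ≥0) (N L : ℕ) : Measure (Config N L) :=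
  Measure.sum fun η => (weight w η / normalization w N L) • Measure.dirac η

/-- The empirical cluster distribution `L⁻¹ ∑ₓ δ_{ηₓ}`. -/
def empirical {N L : ℕ} (η : Config N L) : Measure ℕ :=
  (L : ℝ≥0∞)⁻¹ • ∑ x, Measure.dirac (η.1 x)

theorem isProbabilityMeasure_empirical {N L : ℕ} (hL : 0 < L) (η : Config N L) :
    IsProbabilityMeasure (empirical η) := by
  constructor
  simp only [empirical, Measure.smul_apply, Measure.finsetSum_apply, measure_univ,
    Finset.sum_const, Finset.card_univ, Fintype.card_fin, smul_eq_mul, nsmul_eq_mul, mul_one]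
  exact ENNReal.inv_mul_cancel (by exact_mod_cast hL.ne') (ENNReal.natCast_ne_top L)

theorem firstMoment_empirical {N L : ℕ} (η : Config N L) :
    firstMoment (empirical η) = (L : ℝ≥0∞)⁻¹ * N := by
  have h : (∑ x, (η.1 x : ℝ≥0∞)) = N := by
    rw [← Nat.cast_sum, η.2]
  simp only [firstMoment, empirical, lintegral_smul_measure, lintegral_finsetSum_measure,
    lintegral_dirac, smul_eq_mul, h]

theorem firstMoment_empirical_le {N L : ℕ} {R : ℝ≥0} (hL : 0 < L)
    (hR : (N : ℝ≥0) / (L : ℝ≥0) ≤ R) (η : Config N L) :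
    firstMoment (empirical η) ≤ (R : ℝ≥0∞) := by
  rw [firstMoment_empirical, mul_comm, ← div_eq_mul_inv]
  have hL' : (L : ℝ≥0) ≠ 0 := by exact_mod_cast hL.ne'
  have h : (((N : ℝ≥0) / (L : ℝ≥0) : ℝ≥0) : ℝ≥0∞) ≤ R := by exact_mod_cast hR
  rwa [ENNReal.coe_div hL', ENNReal.coe_natCast, ENNReal.coe_natCast] at h

/-- The map `C^L : η ↦ L⁻¹ ∑ₓ δ_{ηₓ}` into `𝒫_{≤ R}`, for `N / L ≤ R`. -/
def clusterMap {N L : ℕ} {R : ℝ≥0} (hL : 0 < L) (hR : (N : ℝ≥0) / (L : ℝ≥0) ≤ R)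
    (η : Config N L) : MomentLE R :=
  ⟨⟨empirical η, isProbabilityMeasure_empirical hL η⟩, firstMoment_empirical_le hL hR η⟩

/-- The law `Π^{N,L}_w` of the empirical cluster distribution under the canonical measure. -/
def canonicalLaw (w : ℕ → ℝ≥0) {N L : ℕ} {R : ℝ≥0} (hL : 0 < L)
    (hR : (N : ℝ≥0) / (L : ℝ≥0) ≤ R) : Measure (MomentLE R) :=
  (canonical w N L).map (clusterMap hL hR)

/-! ### Variational convergence and large deviations -/

/-- Equicoercivity: for every level there is one compact set that contains the sublevel sets of
all the functionals. -/
def Equicoercive {X : Type*} [TopologicalSpace X] (F : ℕ → X → ℝ≥0∞) : Prop :=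
  ∀ t : ℝ≥0, ∃ K : Set X, IsCompact K ∧ ∀ n, {x | F n x ≤ (t : ℝ≥0∞)} ⊆ K

/-- Sequential `Γ`-convergence: the liminf inequality along all convergent sequences, and the
existence of a recovery sequence for every point. -/
def GammaTendsto {X : Type*} [TopologicalSpace X] (F : ℕ → X → ℝ≥0∞) (F₀ : X → ℝ≥0∞) : Prop :=
  (∀ (x : X) (u : ℕ → X), Tendsto u atTop (𝓝 x) →
      F₀ x ≤ liminf (fun n => F n (u n)) atTop) ∧
  (∀ x : X, ∃ u : ℕ → X, Tendsto u atTop (𝓝 x) ∧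
      limsup (fun n => F n (u n)) atTop ≤ F₀ x)

/-- Exponential tightness of a sequence of measures at speed `a`. -/
def ExponentiallyTight {X : Type*} [TopologicalSpace X] [MeasurableSpace X]
    (P : ℕ → Measure X) (a : ℕ → ℕ) : Prop :=
  ∀ M : ℝ, ∃ K : Set X, IsCompact K ∧
    limsup (fun n => ENNReal.log (P n Kᶜ) / (a n : EReal)) atTop ≤ ((-M : ℝ) : EReal)

/-- The large deviation principle at speed `a` with rate function `I`. -/
structure LargeDeviationPrinciple {X : Type*} [TopologicalSpace X] [MeasurableSpace X]
    (P : ℕ → Measure X) (a : ℕ → ℕ) (I : X → ℝ≥0∞) : Prop where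
  lowerSemicontinuous : LowerSemicontinuous I
  upper_bound : ∀ A : Set X, IsClosed A →
    limsup (fun n => ENNReal.log (P n A) / (a n : EReal)) atTop ≤ -(⨅ x ∈ A, (I x : EReal))
  lower_bound : ∀ A : Set X, IsOpen A →
    -(⨅ x ∈ A, (I x : EReal)) ≤ liminf (fun n => ENNReal.log (P n A) / (a n : EReal)) atTop

end CanonicalEnsemble

end

noncomputable section

namespace CanonicalEnsemble

/-! ### Topology of the state space -/

/-! Exponential factors in the weight are invisible to the canonical law: replacing `w k` by `b * φ
^ k * w k` multiplies the weight of every configuration by the same constant `b ^ L * φ ^ N`. With φ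
= Φ(ρ) the weight may therefore be taken to be the probability measure ν = ω^{Φ(ρ)}, and the rate
function becomes Ent(c | ν) + lam (ρ - M₁(c)) on M₁(c) ≤ ρ (`rateOf`). Here lam = (log φ_c - log
Φ(ρ))₊ is the exponential decay rate of ν, that is, the price of storing mass on sites so large that
the narrow topology no longer sees it. If ρ ≥ ρ_c then Φ(ρ) = φ_c and lam = 0; if ρ < ρ_c then M₁(ν)
= ρ. In both cases ν has rate zero, so that the normalization is subexponential
(`fugacity_properties`).

Everything then rests on two exponential estimates, collected in `ExponentialBounds`. Upper
estimate: for finitely supported g and a number θ with S = ∑ ν(k) exp(g(k) + θk) finite, the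
functional c(g) + ρθ - log S has a subexponential exponential moment, because forgetting the
constraint on the particle number factorizes the sum over configurations
(`lintegral_exp_dualValue_le`). The rate is at most the supremum of these functionals over rational
g and θ (`rateOf_le_iSup_dualValue`), and equality is forced by the lower estimate. Lower estimate
(`reachable_rateOf`): for finitely supported c of mean ρ the configurations with almost the right
frequencies are counted by a multinomial coefficient; a Bezout relation repairs the particle number,
a few very large sites carry missing mass, and truncation gives general c.

The state space is compact and metrizable by Markov's inequality and Prokhorov's theorem, so
equicoercivity and exponential tightness cost nothing. The estimates give the large deviation
principle by finite covers, the liminf inequality by Donsker–Varadhan duality with finite maxima of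
the functionals, and recovery sequences by mixing the canonical laws conditioned on small balls
(`klDiv_sum_cond_le`). -/

theorem isClosed_setOf_firstMoment_le (R : ℝ≥0) :
    IsClosed {c : ProbabilityMeasure ℕ | firstMoment (c : Measure ℕ) ≤ (R : ℝ≥0∞)} := by
  -- The first moment is only lower semicontinuous; truncating the integrand at K makes it bounded
  -- and continuous, and the sublevel set is the intersection over K of closed sets.
  have hmono : ∀ c : Measure ℕ, firstMoment c
      = ⨆ K : ℕ, ∫⁻ k, ((min k K : ℕ) : ℝ≥0∞) ∂c := by
    intro c
    rw [← lintegral_iSup (fun _ => measurable_of_countable _)]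
    · refine lintegral_congr fun k => le_antisymm ?_ ?_
      · exact le_iSup_of_le k (by simp)
      · exact iSup_le fun K => by exact_mod_cast min_le_left k K
    · intro K K' hK k
      exact Nat.cast_le.2 (min_le_min_left k hK)
  have : {c : ProbabilityMeasure ℕ | firstMoment (c : Measure ℕ) ≤ (R : ℝ≥0∞)}
      = ⋂ K : ℕ, {c : ProbabilityMeasure ℕ |
          ∫⁻ k, ((min k K : ℕ) : ℝ≥0∞) ∂(c : Measure ℕ) ≤ (R : ℝ≥0∞)} := by
    ext c
    simp [hmono]
  rw [this]
  refine isClosed_iInter fun K => ?_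
  let f : BoundedContinuousFunction ℕ ℝ≥0 :=
    BoundedContinuousFunction.mkOfBound ⟨fun k => ((min k K : ℕ) : ℝ≥0), by fun_prop⟩ (2 * K)
      (by
        intro x y
        rw [NNReal.dist_eq, abs_sub_le_iff]
        have hx : ((min x K : ℕ) : ℝ) ≤ K := by exact_mod_cast min_le_right x K
        have hy : ((min y K : ℕ) : ℝ) ≤ K := by exact_mod_cast min_le_right y K
        have hx0 : (0 : ℝ) ≤ ((min x K : ℕ) : ℝ) := Nat.cast_nonneg _
        have hy0 : (0 : ℝ) ≤ ((min y K : ℕ) : ℝ) := Nat.cast_nonneg _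
        simp only [ContinuousMap.coe_mk, NNReal.coe_natCast]
        constructor <;> linarith)
  have hf : Continuous fun c : ProbabilityMeasure ℕ => ∫⁻ k, (f k : ℝ≥0∞) ∂(c : Measure ℕ) := by
    rw [continuous_iff_continuousAt]
    intro c
    exact (ProbabilityMeasure.tendsto_iff_forall_lintegral_tendsto.1 tendsto_id) f
  have : ∀ k, ((f k : ℝ≥0) : ℝ≥0∞) = ((min k K : ℕ) : ℝ≥0∞) := fun k => by
    change ((((min k K : ℕ) : ℝ≥0)) : ℝ≥0∞) = _
    rw [ENNReal.coe_natCast]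
  simp only [this] at hf
  exact isClosed_le hf continuous_const

/-- Markov's inequality bounds the mass of [m, ∞) by R / m uniformly, so the set is tight and
Prokhorov's theorem applies; it is already closed. -/
theorem isCompact_setOf_firstMoment_le (R : ℝ≥0) :
    IsCompact {c : ProbabilityMeasure ℕ | firstMoment (c : Measure ℕ) ≤ (R : ℝ≥0∞)} := by
  rw [← (isClosed_setOf_firstMoment_le R).closure_eq]
  apply isCompact_closure_of_isTightMeasureSet
  rw [isTightMeasureSet_iff_exists_isCompact_measure_compl_le]
  intro ε hε
  obtain ⟨m, hm⟩ : ∃ m : ℕ, (R : ℝ≥0∞) / ε < m := by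
    by_cases hε' : ε = ∞
    · exact ⟨1, by simp [hε']⟩
    · exact ENNReal.exists_nat_gt (ENNReal.div_ne_top ENNReal.coe_ne_top hε.ne')
  refine ⟨Set.Iio m, (Set.finite_Iio m).isCompact, ?_⟩
  rintro _ ⟨c, hc, rfl⟩
  have hm0 : (m : ℝ≥0∞) ≠ 0 := (lt_of_le_of_lt zero_le hm).ne'
  have h1 := mul_meas_ge_le_lintegral (μ := (c : Measure ℕ))
    (f := fun k : ℕ => (k : ℝ≥0∞)) (measurable_of_countable _) m
  have h2 : (Set.Iio m)ᶜ = {k : ℕ | (m : ℝ≥0∞) ≤ k} := by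
    ext k; simp
  rw [h2]
  have h3 : (m : ℝ≥0∞) * (c : Measure ℕ) {k : ℕ | (m : ℝ≥0∞) ≤ k} ≤ R := h1.trans hc
  have h4 : (R : ℝ≥0∞) ≤ m * ε := by
    rcases eq_or_ne ε ∞ with h | h
    · simp [h, hm0]
    · exact (ENNReal.div_le_iff hε.ne' h).1 hm.le
  exact (ENNReal.mul_le_mul_iff_right hm0 (ENNReal.natCast_ne_top m)).1 (h3.trans h4)

instance (R : ℝ≥0) : CompactSpace (MomentLE R) :=
  isCompact_iff_compactSpace.1 (isCompact_setOf_firstMoment_le R)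

theorem MomentLE.isEmbedding_val (R : ℝ≥0) :
    IsEmbedding (fun c : MomentLE R => (c.1 : ProbabilityMeasure ℕ)) :=
  Topology.IsEmbedding.subtypeVal

instance (R : ℝ≥0) : TopologicalSpace.MetrizableSpace (MomentLE R) :=
  (MomentLE.isEmbedding_val R).metrizableSpace

instance {R : ℝ≥0} (c : MomentLE R) : IsProbabilityMeasure c.toMeasure :=
  inferInstanceAs (IsProbabilityMeasure (c.1 : Measure ℕ))

/-- Narrow convergence on `ℕ` is implied by the convergence of all point masses. -/
theorem MomentLE.tendsto_of_forall_singleton {ι : Type*} {l : Filter ι} [l.IsCountablyGenerated]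
    {R : ℝ≥0} {u : ι → MomentLE R} {c : MomentLE R}
    (h : ∀ k, Tendsto (fun i => (u i).toMeasure {k}) l (𝓝 (c.toMeasure {k}))) :
    Tendsto u l (𝓝 c) := by
  rw [(MomentLE.isEmbedding_val R).tendsto_nhds_iff]
  refine tendsto_of_seq_tendsto fun x hx => ?_
  -- By the portmanteau theorem a liminf bound on every set G suffices, and this is Fatou's lemma
  -- for counting measure.
  refine tendsto_of_forall_isOpen_le_liminf_nat' fun G _ => ?_
  have hsum : ∀ μ : ProbabilityMeasure ℕ, (μ : Measure ℕ) G =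
      ∫⁻ k, G.indicator (fun k => (μ : Measure ℕ) {k}) k ∂Measure.count := fun μ => by
    rw [lintegral_count, (μ : Measure ℕ).tsum_indicator_apply_singleton G
      (MeasurableSet.of_discrete)]
  have hk : ∀ k, Tendsto (fun i => G.indicator (fun k => (u (x i)).toMeasure {k}) k) atTop
      (𝓝 (G.indicator (fun k => c.toMeasure {k}) k)) := by
    intro k
    by_cases hkG : k ∈ G
    · simpa only [Set.indicator_of_mem hkG, Function.comp_def] using (h k).comp hx
    · simp [hkG]
  simp only [hsum]
  refine le_trans (le_of_eq ?_) (lintegral_liminf_le (fun i => measurable_of_countable _))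
  exact lintegral_congr fun k => ((hk k).liminf_eq).symm

theorem MomentLE.continuous_real_singleton (R : ℝ≥0) (k : ℕ) :
    Continuous fun c : MomentLE R => c.toMeasure.real {k} := by
  let f : BoundedContinuousFunction ℕ ℝ :=
    BoundedContinuousFunction.mkOfBound ⟨Set.indicator {k} 1, by fun_prop⟩ 1
      (by
        intro x y
        simp only [ContinuousMap.coe_mk, Set.indicator, Real.dist_eq, Pi.one_apply]
        split_ifs <;> simp)
  have hf : ∀ c : MomentLE R, c.toMeasure.real {k} = ∫ j, f j ∂c.toMeasure := by
    intro c
    have : ∫ j, f j ∂c.toMeasure = ∫ j, Set.indicator {k} 1 j ∂c.toMeasure := rfl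
    rw [this, integral_indicator_one (MeasurableSet.singleton k)]
  simp only [hf]
  rw [continuous_iff_continuousAt]
  intro c
  exact (ProbabilityMeasure.tendsto_iff_forall_integral_tendsto.1
    (continuous_subtype_val.tendsto c)) f

end CanonicalEnsemble

end

noncomputable section

namespace CanonicalEnsemble

/-! ### Relative entropy -/

/-- The Donsker–Varadhan inequality. -/
theorem ofReal_integral_sub_log_le_klDiv {X : Type*} [MeasurableSpace X] (μ ν : Measure X)
    [IsProbabilityMeasure μ] [IsProbabilityMeasure ν] {f : X → ℝ} (hf : Integrable f μ)
    (hexp : Integrable (fun x => Real.exp (f x)) ν) :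
    ENNReal.ofReal (∫ x, f x ∂μ - Real.log (∫ x, Real.exp (f x) ∂ν)) ≤ klDiv μ ν := by
  by_cases h : klDiv μ ν = ∞
  · simp [h]
  obtain ⟨hac, hint⟩ := klDiv_ne_top_iff.1 h
  have : IsProbabilityMeasure (ν.tilted f) := isProbabilityMeasure_tilted hexp
  have hac' : μ ≪ ν.tilted f := hac.trans (absolutelyContinuous_tilted hexp)
  -- The inequality is the nonnegativity of the entropy of μ relative to the exponentially tilted ν.
  have h1 := integral_llr_add_sub_measure_univ_nonneg hac'
    (integrable_llr_tilted_right hac hf hint hexp)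
  rw [integral_llr_tilted_right hac hf hexp hint] at h1
  rw [klDiv_of_ac_of_integrable hac hint]
  simp only [probReal_univ] at h1 ⊢
  exact ENNReal.ofReal_le_ofReal (by linarith)

theorem klDiv_withDensity {X : Type*} [MeasurableSpace X] (ν : Measure X) [IsFiniteMeasure ν]
    {D : X → ℝ≥0∞} (hD : Measurable D) (hfin : ∫⁻ x, D x ∂ν ≠ ∞) :
    klDiv (ν.withDensity D) ν = ∫⁻ x, ENNReal.ofReal (klFun (D x).toReal) ∂ν := by
  have : IsFiniteMeasure (ν.withDensity D) := isFiniteMeasure_withDensity hfin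
  rw [klDiv_eq_lintegral_klFun_of_ac (withDensity_absolutelyContinuous ν D)]
  refine lintegral_congr_ae ?_
  filter_upwards [Measure.rnDeriv_withDensity ν hD] with x hx
  rw [hx]

/-- This is the entropy of ν conditioned on B relative to ν. The complement contributes `klFun 0 =
1` per unit of mass, which cancels the affine part of `klFun` on B and leaves the logarithm alone.
-/
theorem lintegral_klFun_indicator {X : Type*} [MeasurableSpace X] (ν : Measure X)
    [IsProbabilityMeasure ν] {B : Set X} (hB : MeasurableSet B) (hB0 : ν B ≠ 0) :
    ∫⁻ x, ENNReal.ofReal (klFun (B.indicator (fun _ => (ν.real B)⁻¹) x)) ∂ν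
      = ENNReal.ofReal (-Real.log (ν.real B)) := by
  have hb : 0 < ν.real B := (measureReal_ne_zero_iff).2 hB0 |>.lt_of_le' measureReal_nonneg
  have hb1 : ν.real B ≤ 1 := measureReal_le_one
  rw [← lintegral_add_compl _ hB]
  have e1 : ∫⁻ x in B, ENNReal.ofReal (klFun (B.indicator (fun _ => (ν.real B)⁻¹) x)) ∂ν
      = ENNReal.ofReal (klFun (ν.real B)⁻¹) * ν B := by
    rw [← setLIntegral_const]
    exact setLIntegral_congr_fun hB fun x hx => by simp [hx]
  have e2 : ∫⁻ x in Bᶜ, ENNReal.ofReal (klFun (B.indicator (fun _ => (ν.real B)⁻¹) x)) ∂ν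
      = ν Bᶜ := by
    have : ν Bᶜ = ∫⁻ x in Bᶜ, 1 ∂ν := by simp
    rw [this]
    exact setLIntegral_congr_fun hB.compl fun x hx => by
      simp [Set.indicator_of_notMem hx, klFun_zero]
  have hk : 0 ≤ klFun (ν.real B)⁻¹ := klFun_nonneg (inv_nonneg.2 hb.le)
  rw [e1, e2, ← ofReal_measureReal (s := B), ← ofReal_measureReal (s := Bᶜ),
    ← ENNReal.ofReal_mul hk, ← ENNReal.ofReal_add (mul_nonneg hk hb.le) measureReal_nonneg,
    probReal_compl_eq_one_sub hB, klFun_apply, Real.log_inv]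
  congr 1
  field_simp
  ring

/-- The entropy of a mixture of conditionings of `ν` relative to `ν`. -/
theorem klDiv_sum_cond_le {X ι : Type*} [MeasurableSpace X] (ν : Measure X)
    [IsProbabilityMeasure ν] (s : Finset ι) (p : ι → ℝ) (hp : ∀ i ∈ s, 0 ≤ p i)
    (hsum : ∑ i ∈ s, p i = 1) (B : ι → Set X) (hB : ∀ i ∈ s, MeasurableSet (B i))
    (hB0 : ∀ i ∈ s, ν (B i) ≠ 0) :
    klDiv (∑ i ∈ s, ENNReal.ofReal (p i) • ProbabilityTheory.cond ν (B i)) ν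
      ≤ ENNReal.ofReal (∑ i ∈ s, p i * (-Real.log (ν.real (B i)))) := by
  set d : ι → X → ℝ := fun i => (B i).indicator (fun _ => (ν.real (B i))⁻¹) with hd
  have hd0 : ∀ i x, 0 ≤ d i x := fun i x =>
    Set.indicator_nonneg (fun _ _ => inv_nonneg.2 measureReal_nonneg) x
  have hdm : ∀ i ∈ s, Measurable (d i) := fun i hi => measurable_const.indicator (hB i hi)
  set D : X → ℝ≥0∞ := fun x => ∑ i ∈ s, ENNReal.ofReal (p i) * ENNReal.ofReal (d i x) with hD
  have hDm : Measurable D := Finset.measurable_sum s fun i hi =>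
    ((hdm i hi).ennreal_ofReal).const_mul _
  have hcond : ∀ i ∈ s, ProbabilityTheory.cond ν (B i)
      = ν.withDensity (fun x => ENNReal.ofReal (d i x)) := by
    intro i hi
    have h1 : (fun x => ENNReal.ofReal (d i x)) = (B i).indicator (fun _ => (ν (B i))⁻¹) := by
      ext x
      by_cases hx : x ∈ B i
      · simp only [hd, Set.indicator_of_mem hx]
        rw [ENNReal.ofReal_inv_of_pos, ofReal_measureReal]
        exact (measureReal_ne_zero_iff).2 (hB0 i hi) |>.lt_of_le' measureReal_nonneg
      · simp [hd, Set.indicator_of_notMem hx]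
    rw [h1, withDensity_indicator (hB i hi), withDensity_const]
    rfl
  have hμ : ∑ i ∈ s, ENNReal.ofReal (p i) • ProbabilityTheory.cond ν (B i)
      = ν.withDensity D := by
    ext A hA
    rw [withDensity_apply _ hA, hD, lintegral_finsetSum' _ fun i hi =>
      (((hdm i hi).ennreal_ofReal).const_mul _).aemeasurable]
    simp only [Measure.finsetSum_apply, Measure.smul_apply, smul_eq_mul]
    refine Finset.sum_congr rfl fun i hi => ?_
    rw [lintegral_const_mul _ ((hdm i hi).ennreal_ofReal), hcond i hi, withDensity_apply _ hA]
  have hfin : ∫⁻ x, D x ∂ν ≠ ∞ := by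
    have hpr : ∀ i ∈ s, IsProbabilityMeasure (ProbabilityTheory.cond ν (B i)) := fun i hi =>
      ProbabilityTheory.cond_isProbabilityMeasure (hB0 i hi)
    rw [← setLIntegral_univ, ← withDensity_apply _ MeasurableSet.univ, ← hμ]
    simp only [Measure.finsetSum_apply, Measure.smul_apply, smul_eq_mul]
    refine ENNReal.sum_ne_top.2 fun i hi => ?_
    have := hpr i hi
    exact ENNReal.mul_ne_top ENNReal.ofReal_ne_top (measure_ne_top _ _)
  rw [hμ, klDiv_withDensity ν hDm hfin]
  -- Jensen's inequality for the convex `klFun`, pointwise in the densities of the conditioned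
  -- measures.
  have hpt : ∀ x, ENNReal.ofReal (klFun (D x).toReal)
      ≤ ∑ i ∈ s, ENNReal.ofReal (p i) * ENNReal.ofReal (klFun (d i x)) := by
    intro x
    have h1 : (D x).toReal = ∑ i ∈ s, p i • d i x := by
      rw [hD, ENNReal.toReal_sum fun i _ => by finiteness]
      refine Finset.sum_congr rfl fun i hi => ?_
      rw [ENNReal.toReal_mul, ENNReal.toReal_ofReal (hp i hi), ENNReal.toReal_ofReal (hd0 i x)]
      rfl
    rw [h1]
    calc ENNReal.ofReal (klFun (∑ i ∈ s, p i • d i x))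
        ≤ ENNReal.ofReal (∑ i ∈ s, p i • klFun (d i x)) :=
          ENNReal.ofReal_le_ofReal (convexOn_klFun.map_sum_le hp hsum fun i _ => hd0 i x)
      _ = _ := by
        rw [ENNReal.ofReal_sum_of_nonneg fun i hi =>
          smul_nonneg (hp i hi) (klFun_nonneg (hd0 i x))]
        exact Finset.sum_congr rfl fun i hi => by
          rw [smul_eq_mul, ENNReal.ofReal_mul (hp i hi)]
  refine (lintegral_mono hpt).trans ?_
  have hmk : ∀ i ∈ s, Measurable fun x => ENNReal.ofReal (klFun (d i x)) := fun i hi =>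
    (measurable_klFun.comp (hdm i hi)).ennreal_ofReal
  rw [lintegral_finsetSum' _ fun i hi => ((hmk i hi).const_mul _).aemeasurable,
    ENNReal.ofReal_sum_of_nonneg fun i hi => mul_nonneg (hp i hi)
      (neg_nonneg.2 (Real.log_nonpos measureReal_nonneg measureReal_le_one))]
  refine Finset.sum_le_sum fun i hi => ?_
  rw [lintegral_const_mul _ (hmk i hi), lintegral_klFun_indicator ν (hB i hi) (hB0 i hi),
    ENNReal.ofReal_mul (hp i hi)]

/-- Relative entropy on `ℕ` as a sum of nonnegative terms. -/
theorem klDiv_nat_eq_tsum (c ν : Measure ℕ) [IsFiniteMeasure c] [IsFiniteMeasure ν]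
    (hac : c ≪ ν) :
    klDiv c ν = ∑' k, ENNReal.ofReal
      (c.real {k} * Real.log (c.real {k} / ν.real {k}) + ν.real {k} - c.real {k}) := by
  rw [klDiv_eq_lintegral_klFun_of_ac hac, lintegral_countable']
  refine tsum_congr fun k => ?_
  have h1 : c {k} = c.rnDeriv ν k * ν {k} := by
    conv_lhs => rw [← Measure.withDensity_rnDeriv_eq c ν hac]
    rw [withDensity_apply _ (MeasurableSet.singleton k), lintegral_singleton]
  have h2 : c.real {k} = (c.rnDeriv ν k).toReal * ν.real {k} := by
    simp only [Measure.real, h1, ENNReal.toReal_mul]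
  rw [← ofReal_measureReal (s := {k}) (μ := ν), ← ENNReal.ofReal_mul (klFun_nonneg (by positivity))]
  by_cases hν : ν.real {k} = 0
  · simp [h2, hν]
  · rw [h2, mul_div_assoc, div_self hν, mul_one, klFun_apply]
    ring_nf

end CanonicalEnsemble

end

noncomputable section

namespace CanonicalEnsemble

/-! ### Large deviations and `Γ`-convergence from exponential bounds -/

theorem log_div_le_iff {a : ℕ} (ha : 0 < a) (p : ℝ≥0∞) (y : ℝ) :
    ENNReal.log p / (a : EReal) ≤ (y : EReal) ↔ p ≤ ENNReal.ofReal (Real.exp (a * y)) := by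
  have ha' : (0 : EReal) < (a : EReal) := by exact_mod_cast ha
  rw [EReal.div_le_iff_le_mul ha' (EReal.natCast_ne_top a), ← ENNReal.log_le_log_iff,
    ENNReal.log_ofReal_of_pos (Real.exp_pos _), Real.log_exp, EReal.coe_mul]
  rfl

theorem le_log_div_iff {a : ℕ} (ha : 0 < a) (p : ℝ≥0∞) (y : ℝ) :
    (y : EReal) ≤ ENNReal.log p / (a : EReal) ↔ ENNReal.ofReal (Real.exp (a * y)) ≤ p := by
  have ha' : (0 : EReal) < (a : EReal) := by exact_mod_cast ha
  rw [EReal.le_div_iff_mul_le ha' (EReal.natCast_ne_top a), ← ENNReal.log_le_log_iff,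
    ENNReal.log_ofReal_of_pos (Real.exp_pos _), Real.log_exp, EReal.coe_mul, mul_comm]
  rfl

theorem eventually_nat_le_exp {a : ℕ → ℕ} (ha : Tendsto a atTop atTop) (m : ℕ) {ε : ℝ}
    (hε : 0 < ε) : ∀ᶠ n in atTop, (m : ℝ) ≤ Real.exp (ε * a n) := by
  have h1 : Tendsto (fun n => ε * (a n : ℝ)) atTop atTop :=
    (tendsto_natCast_atTop_atTop.comp ha).const_mul_atTop hε
  exact (Real.tendsto_exp_atTop.comp h1).eventually_ge_atTop _

/-- The maximum of finitely many of the functions `h i` and of `0`. -/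
def finsetSup {X ι : Type*} (h : ι → X → ℝ) (s : Finset ι) (x : X) : ℝ≥0 := s.sup fun i => (h i x).toNNReal

theorem continuous_finsetSup {X ι : Type*} [TopologicalSpace X] {h : ι → X → ℝ}
    (hc : ∀ i, Continuous (h i)) (s : Finset ι) : Continuous (finsetSup h s) :=
  Continuous.finset_sup_apply fun i _ => continuous_real_toNNReal.comp (hc i)

/-- A finite maximum costs at most the factor `card + 1` in exponential moments, which is negligible
at exponential scale. The summand 1 accounts for the value 0 in the maximum. -/
theorem exp_finsetSup_le {X ι : Type*} (h : ι → X → ℝ) (s : Finset ι) (r : ℝ) (x : X) :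
    Real.exp (r * finsetSup h s x) ≤ 1 + ∑ i ∈ s, Real.exp (r * h i x) := by
  classical
  induction s using Finset.induction_on with
  | empty => simp [finsetSup]
  | insert i s hi ih =>
    rw [Finset.sum_insert hi]
    have hs : finsetSup h (insert i s) x = max (h i x).toNNReal (finsetSup h s x) := by
      simp [finsetSup, Finset.sup_insert]
    have hpos : 0 ≤ ∑ i ∈ s, Real.exp (r * h i x) := Finset.sum_nonneg fun _ _ => (Real.exp_pos _).le
    have hpos' : 0 < Real.exp (r * h i x) := Real.exp_pos _
    rw [hs]
    rcases le_total (h i x).toNNReal (finsetSup h s x) with hle | hle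
    · rw [max_eq_right hle]; linarith
    · rw [max_eq_left hle, Real.coe_toNNReal']
      rcases le_total (h i x) 0 with h0 | h0
      · rw [max_eq_right h0]; simp only [mul_zero, Real.exp_zero]; linarith
      · rw [max_eq_left h0]; linarith

/-- Matching exponential bounds for a sequence of measures at speed `a`: the exponential moments
of the continuous functions `h i`, whose supremum dominates `F`, are subexponential, and
neighbourhoods of `x` have measure at least `exp (- a (F x + o(1)))`. -/
structure ExponentialBounds {X ι : Type*} [TopologicalSpace X] [MeasurableSpace X]
    (P : ℕ → Measure X) (a : ℕ → ℕ) (F : X → ℝ≥0∞) (h : ι → X → ℝ) : Prop where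
  pos : ∀ n, 0 < a n
  tendsto : Tendsto a atTop atTop
  continuous : ∀ i, Continuous (h i)
  le_iSup : ∀ x, F x ≤ ⨆ i, ENNReal.ofReal (h i x)
  lintegral_exp_le : ∀ i, ∀ ε > 0, ∀ᶠ n in atTop,
    ∫⁻ x, ENNReal.ofReal (Real.exp (a n * h i x)) ∂(P n) ≤ ENNReal.ofReal (Real.exp (ε * a n))
  exp_le : ∀ x, F x ≠ ∞ → ∀ U ∈ 𝓝 x, ∀ ε > 0, ∀ᶠ n in atTop,
    ENNReal.ofReal (Real.exp (-(a n * ((F x).toReal + ε)))) ≤ P n U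

namespace ExponentialBounds

variable {X ι : Type*} [TopologicalSpace X] [MeasurableSpace X] [BorelSpace X]
  {P : ℕ → Measure X} {a : ℕ → ℕ} {F : X → ℝ≥0∞} {h : ι → X → ℝ}

/-- The exponential Chebyshev inequality. -/
theorem exp_mul_measure_le (b : ExponentialBounds P a F h) (i : ι) (n : ℕ) (t : ℝ) :
    ENNReal.ofReal (Real.exp (a n * t)) * P n {y | t < h i y}
      ≤ ∫⁻ x, ENNReal.ofReal (Real.exp (a n * h i x)) ∂(P n) := by
  refine le_trans ?_ (mul_meas_ge_le_lintegral
    (((Real.continuous_exp.comp (continuous_const.mul (b.continuous i))).measurable).ennreal_ofReal)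
    (ENNReal.ofReal (Real.exp (a n * t))))
  refine mul_le_mul_right (measure_mono fun y hy => ?_) _
  exact ENNReal.ofReal_le_ofReal (Real.exp_le_exp.2
    (mul_le_mul_of_nonneg_left (le_of_lt hy) (Nat.cast_nonneg _)))

/-- If h were larger than F at x, a neighbourhood on which h stays near h(x) would have mass at
least exp(-a (F(x) + δ)) and would by itself make the exponential moment of h too large. One δ is
lost in the neighbourhood, one in the lower bound and one in the moment bound, hence the division of
the gap by 4. So the two bounds together determine F as the supremum of the functionals. -/
theorem ofReal_le (b : ExponentialBounds P a F h) (i : ι) (x : X) :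
    ENNReal.ofReal (h i x) ≤ F x := by
  by_cases hx : F x = ∞
  · simp [hx]
  by_contra! hlt
  set t := (F x).toReal with ht
  have hlt' : t < h i x := by
    rw [← ENNReal.ofReal_toReal hx, ENNReal.ofReal_lt_ofReal_iff_of_nonneg
      ENNReal.toReal_nonneg] at hlt
    exact hlt
  set δ := (h i x - t) / 4 with hδ
  have hδ0 : 0 < δ := by rw [hδ]; linarith
  have hU : {y | h i x - δ < h i y} ∈ 𝓝 x :=
    (isOpen_lt continuous_const (b.continuous i)).mem_nhds (by simp [hδ0])
  obtain ⟨n, h1, h2⟩ := ((b.exp_le x hx _ hU δ hδ0).and (b.lintegral_exp_le i δ hδ0)).exists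
  have h3 := (b.exp_mul_measure_le i n (h i x - δ)).trans h2
  have h4 := (mul_le_mul_right h1 (ENNReal.ofReal (Real.exp (a n * (h i x - δ))))).trans h3
  rw [← ENNReal.ofReal_mul (Real.exp_pos _).le, ← Real.exp_add,
    ENNReal.ofReal_le_ofReal_iff (Real.exp_pos _).le, Real.exp_le_exp] at h4
  have han : (0 : ℝ) < a n := by exact_mod_cast b.pos n
  have : (a n : ℝ) * (h i x - t - 3 * δ) ≤ 0 := by rw [← ht] at h4; linarith
  have h5 : h i x - t - 3 * δ ≤ 0 := by
    by_contra! h6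
    exact absurd this (not_le.2 (mul_pos han h6))
  linarith

theorem eq_iSup (b : ExponentialBounds P a F h) (x : X) :
    F x = ⨆ i, ENNReal.ofReal (h i x) :=
  le_antisymm (b.le_iSup x) (iSup_le fun i => b.ofReal_le i x)

theorem lowerSemicontinuous (b : ExponentialBounds P a F h) : LowerSemicontinuous F := by
  have : F = fun x => ⨆ i, ENNReal.ofReal (h i x) := funext b.eq_iSup
  rw [this]
  exact lowerSemicontinuous_iSup fun i =>
    (ENNReal.continuous_ofReal.comp (b.continuous i)).lowerSemicontinuous

/-- The open sets where some `h i` exceeds t cover the compact set A. Finitely many suffice, each is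
exponentially small by Chebyshev, and their number is absorbed into the gap between s and t. -/
theorem eventually_measure_le [CompactSpace X] (b : ExponentialBounds P a F h) {A : Set X}
    (hA : IsClosed A) {t : ℝ} (ht : ∀ x ∈ A, ENNReal.ofReal t < F x) {s : ℝ} (hst : s < t) :
    ∀ᶠ n in atTop, P n A ≤ ENNReal.ofReal (Real.exp (a n * (-s))) := by
  have hcov : A ⊆ ⋃ i, {y | t < h i y} := by
    intro x hx
    have := ht x hx
    rw [b.eq_iSup, lt_iSup_iff] at this
    obtain ⟨i, hi⟩ := this
    exact Set.mem_iUnion.2 ⟨i, (ENNReal.ofReal_lt_ofReal_iff').1 hi |>.1⟩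
  obtain ⟨I, hI⟩ := hA.isCompact.elim_finite_subcover _
    (fun i => isOpen_lt continuous_const (b.continuous i)) hcov
  set ε := (t - s) / 2 with hε
  have hε0 : 0 < ε := by rw [hε]; linarith
  have hall : ∀ᶠ n in atTop, ∀ i ∈ I, ∫⁻ x, ENNReal.ofReal (Real.exp (a n * h i x)) ∂(P n)
      ≤ ENNReal.ofReal (Real.exp (ε * a n)) :=
    (Filter.eventually_all_finset I).2 fun i _ => b.lintegral_exp_le i ε hε0
  filter_upwards [hall, eventually_nat_le_exp b.tendsto I.card hε0] with n hn hcard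
  have hi : ∀ i ∈ I, P n {y | t < h i y} ≤ ENNReal.ofReal (Real.exp (a n * (ε - t))) := by
    intro i hi
    have h1 := (b.exp_mul_measure_le i n t).trans (hn i hi)
    have h2 := mul_le_mul_right h1 (ENNReal.ofReal (Real.exp (-(a n * t))))
    rw [← mul_assoc, ← ENNReal.ofReal_mul (Real.exp_pos _).le, ← Real.exp_add, neg_add_cancel,
      Real.exp_zero, ENNReal.ofReal_one, one_mul, ← ENNReal.ofReal_mul (Real.exp_pos _).le,
      ← Real.exp_add] at h2
    refine h2.trans (le_of_eq ?_)
    ring_nf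
  calc P n A ≤ P n (⋃ i ∈ I, {y | t < h i y}) := measure_mono hI
    _ ≤ ∑ i ∈ I, P n {y | t < h i y} := measure_biUnion_finset_le _ _
    _ ≤ ∑ i ∈ I, ENNReal.ofReal (Real.exp (a n * (ε - t))) := Finset.sum_le_sum hi
    _ = ENNReal.ofReal (I.card * Real.exp (a n * (ε - t))) := by
      rw [Finset.sum_const, nsmul_eq_mul, ENNReal.ofReal_mul (Nat.cast_nonneg _),
        ENNReal.ofReal_natCast]
    _ ≤ ENNReal.ofReal (Real.exp (ε * a n) * Real.exp (a n * (ε - t))) := by gcongr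
    _ = ENNReal.ofReal (Real.exp (a n * (-s))) := by
      rw [← Real.exp_add]; congr 2; rw [hε]; ring

theorem largeDeviationPrinciple [CompactSpace X] [∀ n, IsProbabilityMeasure (P n)]
    (b : ExponentialBounds P a F h) : LargeDeviationPrinciple P a F where
  lowerSemicontinuous := b.lowerSemicontinuous
  upper_bound A hA := by
    rw [EReal.le_neg]
    refine EReal.ge_of_forall_gt_iff_ge.1 ?_
    intro y hy
    rw [EReal.le_neg, ← EReal.coe_neg]
    -- A negative level says nothing beyond `P n A ≤ 1`; it is split off because `ENNReal.ofReal`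
    -- would collapse it to 0.
    rcases lt_or_ge y 0 with hy0 | hy0
    · refine limsup_le_of_le (by isBoundedDefault) (Eventually.of_forall fun n => ?_)
      rw [log_div_le_iff (b.pos n)]
      refine prob_le_one.trans ?_
      rw [ENNReal.one_le_ofReal]
      exact Real.one_le_exp (mul_nonneg (Nat.cast_nonneg _) (by linarith))
    · obtain ⟨t, hyt, ht⟩ := EReal.lt_iff_exists_real_btwn.1 hy
      have hyt' : y < t := by exact_mod_cast hyt
      have htA : ∀ x ∈ A, ENNReal.ofReal t < F x := by
        intro x hx
        have h1 : (t : EReal) < (F x : EReal) := lt_of_lt_of_le ht (iInf₂_le x hx)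
        have h2 : ((ENNReal.ofReal t : ℝ≥0∞) : EReal) = (t : EReal) :=
          EReal.coe_ennreal_ofReal.trans (by rw [max_eq_left (by linarith)])
        rw [← h2] at h1
        exact_mod_cast h1
      refine limsup_le_of_le (by isBoundedDefault) ?_
      filter_upwards [b.eventually_measure_le hA htA hyt'] with n hn
      rwa [log_div_le_iff (b.pos n)]
  lower_bound A hA := by
    rw [EReal.neg_le]
    refine le_iInf₂ fun x hx => ?_
    by_cases hFx : F x = ∞
    · simp [hFx]
    rw [EReal.neg_le]
    refine EReal.ge_of_forall_gt_iff_ge.1 ?_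
    intro y hy
    have hF : ((F x : ℝ≥0∞) : EReal) = (((F x).toReal : ℝ) : EReal) :=
      (EReal.coe_ennreal_toReal hFx).symm
    rw [hF, ← EReal.coe_neg, EReal.coe_lt_coe_iff] at hy
    refine le_liminf_of_le (by isBoundedDefault) ?_
    filter_upwards [b.exp_le x hFx A (hA.mem_nhds hx) (-y - (F x).toReal) (by linarith)] with n hn
    rw [le_log_div_iff (b.pos n)]
    refine le_trans (le_of_eq ?_) hn
    congr 2; ring

/-- F is the directed supremum of finite maxima f of the functionals, so by monotone convergence it
is enough to bound the integral of one such continuous f. The Donsker–Varadhan inequality for `a n *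
f` does this, since the logarithm of the exponential moment of f is o(a n). -/
theorem lintegral_le_liminf [Countable ι] [CompactSpace X] [∀ n, IsProbabilityMeasure (P n)]
    (b : ExponentialBounds P a F h) (C : ProbabilityMeasure X) (u : ℕ → ProbabilityMeasure X)
    (hu : Tendsto u atTop (𝓝 C)) :
    ∫⁻ x, F x ∂(C : Measure X)
      ≤ liminf (fun n => (a n : ℝ≥0∞)⁻¹ * klDiv (u n : Measure X) (P n)) atTop := by
  have hF : ∀ x, F x = ⨆ s : Finset ι, (finsetSup h s x : ℝ≥0∞) := by
    intro x
    rw [b.eq_iSup]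
    refine le_antisymm (iSup_le fun i => le_iSup_of_le {i} ?_) (iSup_le fun s => ?_)
    · simp [finsetSup, ENNReal.ofReal]
    · rw [finsetSup, ENNReal.coe_finset_sup]
      exact Finset.sup_le fun i _ => _root_.le_iSup (fun i => ENNReal.ofReal (h i x)) i
  simp only [hF]
  rw [lintegral_iSup_directed
    (f := fun s x => (finsetSup h s x : ℝ≥0∞))
    (fun s => (ENNReal.continuous_coe.comp (continuous_finsetSup b.continuous s)).measurable.aemeasurable)]
  swap
  · classical
    intro s t
    refine ⟨s ∪ t, fun x => ?_, fun x => ?_⟩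
    · exact ENNReal.coe_le_coe.2 (Finset.sup_mono Finset.subset_union_left)
    · exact ENNReal.coe_le_coe.2 (Finset.sup_mono Finset.subset_union_right)
  refine iSup_le fun s => ?_
  let f : BoundedContinuousFunction X ℝ := BoundedContinuousFunction.mkOfCompact
    ⟨fun x => (finsetSup h s x : ℝ), NNReal.continuous_coe.comp (continuous_finsetSup b.continuous s)⟩
  have hfx : ∀ x, f x = finsetSup h s x := fun x => rfl
  have hint : ∀ μ : ProbabilityMeasure X, Integrable (fun x => f x) (μ : Measure X) :=
    fun μ => f.integrable _
  have hlim : Tendsto (fun n => ∫ x, f x ∂(u n : Measure X)) atTop (𝓝 (∫ x, f x ∂(C : Measure X))) :=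
    ProbabilityMeasure.tendsto_iff_forall_integral_tendsto.1 hu f
  have hC : ∫⁻ x, (finsetSup h s x : ℝ≥0∞) ∂(C : Measure X)
      = ENNReal.ofReal (∫ x, f x ∂(C : Measure X)) := by
    rw [ofReal_integral_eq_lintegral_ofReal (hint C)
      (Eventually.of_forall fun x => by simp [hfx])]
    simp [hfx]
  rw [hC]
  have key : ∀ ε > 0, ENNReal.ofReal (∫ x, f x ∂(C : Measure X) - ε)
      ≤ liminf (fun n => (a n : ℝ≥0∞)⁻¹ * klDiv (u n : Measure X) (P n)) atTop := by
    intro ε hε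
    have hall : ∀ᶠ n in atTop, ∀ i ∈ s, ∫⁻ x, ENNReal.ofReal (Real.exp (a n * h i x)) ∂(P n)
        ≤ ENNReal.ofReal (Real.exp (ε / 4 * a n)) :=
      (Filter.eventually_all_finset s).2 fun i _ => b.lintegral_exp_le i _ (by positivity)
    refine le_liminf_of_le (by isBoundedDefault) ?_
    -- The factor `card + 1` and each single moment are both at most exp(ε a / 4), so the moment of
    -- the maximum is at most exp(ε a / 2). The other half of ε pays for the convergence of the
    -- integrals of f.
    filter_upwards [hall, eventually_nat_le_exp b.tendsto (s.card + 1) (ε := ε / 4) (by positivity),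
      hlim.eventually_const_le (show ∫ x, f x ∂(C : Measure X) - ε / 2 < _ by linarith)]
      with n hn hcard hfn
    have han : (0 : ℝ) < a n := by exact_mod_cast b.pos n
    have hcont : Continuous fun x => Real.exp (a n * f x) := by fun_prop
    have hexp : Integrable (fun x => Real.exp (a n * f x)) (P n) :=
      hcont.integrable_of_hasCompactSupport (HasCompactSupport.of_compactSpace _)
    have h1 : ∫ x, Real.exp (a n * f x) ∂(P n) ≤ Real.exp (ε / 2 * a n) := by
      rw [integral_eq_lintegral_of_nonneg_ae (Eventually.of_forall fun x => (Real.exp_pos _).le)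
        hexp.aestronglyMeasurable]
      refine ENNReal.toReal_le_of_le_ofReal (Real.exp_pos _).le ?_
      calc ∫⁻ x, ENNReal.ofReal (Real.exp (a n * f x)) ∂(P n)
          ≤ ∫⁻ x, (1 + ∑ i ∈ s, ENNReal.ofReal (Real.exp (a n * h i x))) ∂(P n) := by
            refine lintegral_mono fun x => ?_
            rw [← ENNReal.ofReal_one, ← ENNReal.ofReal_sum_of_nonneg fun i _ => (Real.exp_pos _).le,
              ← ENNReal.ofReal_add zero_le_one
                (Finset.sum_nonneg fun i _ => (Real.exp_pos _).le)]
            exact ENNReal.ofReal_le_ofReal (exp_finsetSup_le h s _ x)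
        _ = 1 + ∑ i ∈ s, ∫⁻ x, ENNReal.ofReal (Real.exp (a n * h i x)) ∂(P n) := by
            rw [lintegral_add_left measurable_const, lintegral_finsetSum]
            · simp
            · intro i _
              exact ((Real.continuous_exp.comp
                (continuous_const.mul (b.continuous i))).measurable).ennreal_ofReal
        _ ≤ 1 + ∑ i ∈ s, ENNReal.ofReal (Real.exp (ε / 4 * a n)) := by
            gcongr with i hi
            exact hn i hi
        _ = ENNReal.ofReal (1 + s.card * Real.exp (ε / 4 * a n)) := by
            rw [Finset.sum_const, nsmul_eq_mul, ENNReal.ofReal_add zero_le_one (by positivity),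
              ENNReal.ofReal_mul (Nat.cast_nonneg _), ENNReal.ofReal_natCast, ENNReal.ofReal_one]
        _ ≤ ENNReal.ofReal (Real.exp (ε / 2 * a n)) := by
            refine ENNReal.ofReal_le_ofReal ?_
            have h2 : (1 : ℝ) ≤ Real.exp (ε / 4 * a n) := Real.one_le_exp (by positivity)
            have h3 : Real.exp (ε / 2 * a n)
                = Real.exp (ε / 4 * a n) * Real.exp (ε / 4 * a n) := by
              rw [← Real.exp_add]; congr 1; ring
            push_cast at hcard
            rw [h3]
            nlinarith
    have h2 : Real.log (∫ x, Real.exp (a n * f x) ∂(P n)) ≤ ε / 2 * a n := by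
      have hpos : 0 < ∫ x, Real.exp (a n * f x) ∂(P n) := integral_exp_pos hexp
      exact (Real.log_le_iff_le_exp hpos).2 h1
    have hdv := ofReal_integral_sub_log_le_klDiv (u n : Measure X) (P n)
      ((hint (u n)).const_mul (a n : ℝ)) hexp
    rw [integral_const_mul] at hdv
    have han0 : (a n : ℝ≥0∞) ≠ 0 := by exact_mod_cast (b.pos n).ne'
    rw [← ENNReal.div_eq_inv_mul, ENNReal.le_div_iff_mul_le (Or.inl han0)
      (Or.inl (ENNReal.natCast_ne_top _)), ← ENNReal.ofReal_natCast,
      ← ENNReal.ofReal_mul' (Nat.cast_nonneg _)]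
    refine le_trans (ENNReal.ofReal_le_ofReal ?_) hdv
    nlinarith
  refine le_of_tendsto (f := fun ε : ℝ => ENNReal.ofReal (∫ x, f x ∂(C : Measure X) - ε))
    (x := 𝓝[>] 0) ?_ (eventually_mem_nhdsWithin.mono fun ε hε => key ε hε)
  refine Tendsto.mono_left ?_ nhdsWithin_le_nhds
  have : Continuous fun ε : ℝ => ENNReal.ofReal (∫ x, f x ∂(C : Measure X) - ε) :=
    ENNReal.continuous_ofReal.comp (by fun_prop)
  simpa using this.tendsto 0

end ExponentialBounds

end CanonicalEnsemble

end

/-! ### Recovery sequences and Γ-convergence -/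

noncomputable section

namespace CanonicalEnsemble

/-- A compact metric space admits a measurable map with finite range close to the identity. -/
theorem exists_simpleFunc_dist_lt {X : Type*} [MetricSpace X] [CompactSpace X]
    [MeasurableSpace X] [BorelSpace X] [Nonempty X] {ε : ℝ} (hε : 0 < ε) :
    ∃ T : SimpleFunc X X, ∀ x, dist (T x) x < ε := by
  have e := TopologicalSpace.denseRange_denseSeq X
  obtain ⟨I, hI⟩ := isCompact_univ.elim_finite_subcover
    (fun k : ℕ => Metric.ball (TopologicalSpace.denseSeq X k) ε) (fun _ => Metric.isOpen_ball)
    (fun x _ => by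
      obtain ⟨k, hk⟩ := e.exists_dist_lt x hε
      exact Set.mem_iUnion.2 ⟨k, hk⟩)
  obtain ⟨m, hm⟩ := I.exists_le
  refine ⟨SimpleFunc.nearestPt (TopologicalSpace.denseSeq X) m, fun x => ?_⟩
  obtain ⟨k, hk, hxk⟩ := Set.mem_iUnion₂.1 (hI (Set.mem_univ x))
  have h1 := SimpleFunc.edist_nearestPt_le (TopologicalSpace.denseSeq X) x (hm k hk)
  rw [edist_dist, edist_dist, ENNReal.ofReal_le_ofReal_iff dist_nonneg] at h1
  exact h1.trans_lt (by rw [dist_comm]; exact hxk)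

/-- Diagonal selection along a sequence of eventual statements. -/
theorem exists_tendsto_eventually (Q : ℕ → ℕ → Prop) (hQ : ∀ k, ∀ᶠ n in atTop, Q k n) :
    ∃ κ : ℕ → ℕ, Tendsto κ atTop atTop ∧ ∀ᶠ n in atTop, Q (κ n) n := by
  classical
  -- The largest k ≤ n for which `Q k n` holds. The default value 0 of `Nat.findGreatest` is
  -- harmless because `Q 0 n` holds eventually.
  refine ⟨fun n => Nat.findGreatest (fun k => Q k n) n, ?_, ?_⟩
  · rw [tendsto_atTop]
    intro K
    filter_upwards [hQ K, eventually_ge_atTop K] with n hn hKn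
    exact Nat.le_findGreatest hKn hn
  · filter_upwards [hQ 0] with n hn
    exact Nat.findGreatest_spec (P := fun k => Q k n) (Nat.zero_le n) hn

namespace ExponentialBounds

/-- Approximate recovery: a mixture of conditionings of `P n` close to `C`. -/
theorem eventually_exists_klDiv_le {X ι : Type*} [MetricSpace X] [CompactSpace X]
    [MeasurableSpace X] [BorelSpace X] {P : ℕ → Measure X} {a : ℕ → ℕ} {F : X → ℝ≥0∞}
    {h : ι → X → ℝ} [∀ n, IsProbabilityMeasure (P n)] (b : ExponentialBounds P a F h)
    (C : ProbabilityMeasure X) (hC : ∫⁻ x, F x ∂(C : Measure X) ≠ ∞) {ε : ℝ} (hε : 0 < ε) :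
    ∀ᶠ n in atTop, ∃ D : ProbabilityMeasure X,
      (a n : ℝ≥0∞)⁻¹ * klDiv (D : Measure X) (P n)
        ≤ ∫⁻ x, F x ∂(C : Measure X) + ENNReal.ofReal ε ∧
      ∀ f : BoundedContinuousFunction X ℝ, ∀ δ : ℝ,
        (∀ x y, dist x y < 3 * ε → |f x - f y| ≤ δ) →
        |∫ x, f x ∂(D : Measure X) - ∫ x, f x ∂(C : Measure X)| ≤ 2 * δ := by
  classical
  have : Nonempty X := C.nonempty
  obtain ⟨T, hT⟩ := exists_simpleFunc_dist_lt (X := X) hε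
  set A : X → Set X := fun y => T ⁻¹' {y} with hA
  have hAm : ∀ y, MeasurableSet (A y) := fun y => T.measurableSet_fiber y
  set s : Finset X := T.range.filter fun y => (C : Measure X) (A y) ≠ 0 with hs
  set p : X → ℝ := fun y => (C : Measure X).real (A y) with hp
  have hFm : Measurable F := b.lowerSemicontinuous.measurable
  have hdisj : Set.PairwiseDisjoint (↑T.range) A := by
    intro y _ z _ hyz
    rw [Function.onFun, Set.disjoint_left]
    intro x hx hx'
    exact hyz (hx.symm.trans hx')
  have hcover : ⋃ y ∈ T.range, A y = Set.univ := by
    refine Set.eq_univ_of_forall fun x => Set.mem_iUnion₂.2 ⟨T x, T.mem_range_self x, rfl⟩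
  have hpos : ∀ y ∈ s, (C : Measure X) (A y) ≠ 0 := fun y hy => (Finset.mem_filter.1 hy).2
  -- In each cell of positive mass a point is chosen where F does not exceed its average over the
  -- cell. This keeps the discretized energy below the integral of F, although F is only lower
  -- semicontinuous and might jump up at an arbitrary representative.
  have hx : ∀ y, ∃ x, y ∈ s → (x ∈ A y ∧
      F x ≤ ⨍⁻ z in A y, F z ∂(C : Measure X)) := by
    intro y
    by_cases hy : y ∈ s
    · obtain ⟨x, hxA, hx⟩ := exists_le_setLAverage (μ := (C : Measure X)) (hpos y hy)
        (measure_ne_top _ _) hFm.aemeasurable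
      exact ⟨x, fun _ => ⟨hxA, hx⟩⟩
    · exact ⟨y, fun h => absurd h hy⟩
  choose x hx using hx
  have hint_split : ∀ f : BoundedContinuousFunction X ℝ,
      ∫ z, f z ∂(C : Measure X) = ∑ y ∈ s, ∫ z in A y, f z ∂(C : Measure X) := by
    intro f
    rw [← setIntegral_univ, ← hcover, integral_biUnion_finset _ (fun y _ => hAm y) hdisj
      (fun y _ => (f.integrable _).integrableOn)]
    refine (Finset.sum_subset (Finset.filter_subset _ _) fun y hy hys => ?_).symm
    have : (C : Measure X) (A y) = 0 := by
      by_contra hne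
      exact hys (Finset.mem_filter.2 ⟨hy, hne⟩)
    exact setIntegral_measure_zero _ this
  have hpsum : ∑ y ∈ s, p y = 1 := by
    have := hint_split (BoundedContinuousFunction.const X 1)
    simpa [hp] using this.symm
  have hFsum : ∑ y ∈ s, ENNReal.ofReal (p y) * F (x y) ≤ ∫⁻ z, F z ∂(C : Measure X) := by
    calc ∑ y ∈ s, ENNReal.ofReal (p y) * F (x y)
        ≤ ∑ y ∈ s, ∫⁻ z in A y, F z ∂(C : Measure X) := by
          refine Finset.sum_le_sum fun y hy => ?_
          rw [hp, ofReal_measureReal]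
          have h1 := (hx y hy).2
          rw [setLAverage_eq] at h1
          rw [mul_comm]
          exact (ENNReal.le_div_iff_mul_le (Or.inl (hpos y hy))
            (Or.inl (measure_ne_top _ _))).1 h1
      _ ≤ ∑ y ∈ T.range, ∫⁻ z in A y, F z ∂(C : Measure X) :=
          Finset.sum_le_sum_of_subset (Finset.filter_subset _ _)
      _ = ∫⁻ z, F z ∂(C : Measure X) := by
          rw [← lintegral_biUnion_finset hdisj (fun y _ => hAm y), hcover, setLIntegral_univ]
  have hppos : ∀ y ∈ s, 0 < p y := fun y hy =>
    (measureReal_ne_zero_iff).2 (hpos y hy) |>.lt_of_le' measureReal_nonneg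
  have hFfin : ∀ y ∈ s, F (x y) ≠ ∞ := by
    intro y hy htop
    refine hC (top_unique ?_)
    refine le_trans ?_ hFsum
    refine le_trans (le_of_eq ?_) (Finset.single_le_sum (f := fun y =>
      ENNReal.ofReal (p y) * F (x y)) (fun _ _ => zero_le) hy)
    simp [htop, hppos y hy]
  -- The candidate replaces the mass of each cell by `P n` conditioned on the ball around its
  -- representative; by the lower exponential bound this costs at most F + ε per unit of speed.
  set B : X → Set X := fun y => Metric.ball (x y) ε with hB
  have hall : ∀ᶠ n in atTop, ∀ y ∈ s,
      ENNReal.ofReal (Real.exp (-(a n * ((F (x y)).toReal + ε)))) ≤ P n (B y) :=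
    (Filter.eventually_all_finset s).2 fun y hy =>
      b.exp_le (x y) (hFfin y hy) _ (Metric.ball_mem_nhds _ hε) ε hε
  filter_upwards [hall] with n hn
  have hB0 : ∀ y ∈ s, P n (B y) ≠ 0 := fun y hy =>
    ((ENNReal.ofReal_pos.2 (Real.exp_pos _)).trans_le (hn y hy)).ne'
  have hcondprob : ∀ y ∈ s, IsProbabilityMeasure (ProbabilityTheory.cond (P n) (B y)) :=
    fun y hy => ProbabilityTheory.cond_isProbabilityMeasure (hB0 y hy)
  set D : Measure X := ∑ y ∈ s, ENNReal.ofReal (p y) • ProbabilityTheory.cond (P n) (B y) with hD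
  have hDprob : IsProbabilityMeasure D := by
    constructor
    rw [hD]
    simp only [Measure.finsetSum_apply, Measure.smul_apply, smul_eq_mul]
    have : ∀ y ∈ s, ENNReal.ofReal (p y) * ProbabilityTheory.cond (P n) (B y) Set.univ
        = ENNReal.ofReal (p y) := fun y hy => by
      have := hcondprob y hy
      rw [measure_univ, mul_one]
    rw [Finset.sum_congr rfl this, ← ENNReal.ofReal_sum_of_nonneg fun y hy => (hppos y hy).le,
      hpsum, ENNReal.ofReal_one]
  refine ⟨⟨D, hDprob⟩, ?_, ?_⟩
  · have han : (0 : ℝ) < a n := by exact_mod_cast b.pos n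
    have han0 : (a n : ℝ≥0∞) ≠ 0 := by exact_mod_cast (b.pos n).ne'
    rw [← ENNReal.div_eq_inv_mul, ENNReal.div_le_iff han0 (ENNReal.natCast_ne_top _)]
    refine (klDiv_sum_cond_le (P n) s p (fun y hy => (hppos y hy).le) hpsum B
      (fun y _ => Metric.isOpen_ball.measurableSet) hB0).trans ?_
    have hlog : ∀ y ∈ s, -Real.log ((P n).real (B y)) ≤ a n * ((F (x y)).toReal + ε) := by
      intro y hy
      have h1 : Real.exp (-(a n * ((F (x y)).toReal + ε))) ≤ (P n).real (B y) := by
        have := ENNReal.toReal_mono (measure_ne_top _ _) (hn y hy)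
        rwa [ENNReal.toReal_ofReal (Real.exp_pos _).le] at this
      have h2 := Real.log_le_log (Real.exp_pos _) h1
      rw [Real.log_exp] at h2
      linarith
    have hle : ∑ y ∈ s, p y * (-Real.log ((P n).real (B y)))
        ≤ (∑ y ∈ s, p y * (F (x y)).toReal + ε) * a n := by
      calc _ ≤ ∑ y ∈ s, p y * (a n * ((F (x y)).toReal + ε)) :=
            Finset.sum_le_sum fun y hy =>
              mul_le_mul_of_nonneg_left (hlog y hy) (hppos y hy).le
        _ = (∑ y ∈ s, p y * (F (x y)).toReal) * a n + (∑ y ∈ s, p y) * (ε * a n) := by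
            rw [Finset.sum_mul, Finset.sum_mul, ← Finset.sum_add_distrib]
            exact Finset.sum_congr rfl fun y _ => by ring
        _ = _ := by rw [hpsum]; ring
    refine (ENNReal.ofReal_le_ofReal hle).trans ?_
    have hnn : 0 ≤ ∑ y ∈ s, p y * (F (x y)).toReal := Finset.sum_nonneg fun y hy =>
      mul_nonneg (hppos y hy).le ENNReal.toReal_nonneg
    rw [ENNReal.ofReal_mul (by positivity), ENNReal.ofReal_natCast, ENNReal.ofReal_add hnn hε.le]
    gcongr
    refine le_trans (le_of_eq ?_) hFsum
    rw [ENNReal.ofReal_sum_of_nonneg fun y hy => mul_nonneg (hppos y hy).le ENNReal.toReal_nonneg]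
    refine Finset.sum_congr rfl fun y hy => ?_
    rw [ENNReal.ofReal_mul (hppos y hy).le, ENNReal.ofReal_toReal (hFfin y hy)]
  · intro f δ hδ
    have hDint : ∫ z, f z ∂D = ∑ y ∈ s, p y * ∫ z, f z ∂(ProbabilityTheory.cond (P n) (B y)) := by
      rw [hD, integral_finsetSum_measure]
      · refine Finset.sum_congr rfl fun y hy => ?_
        rw [integral_smul_measure, ENNReal.toReal_ofReal (hppos y hy).le, smul_eq_mul]
      · intro y hy
        have := hcondprob y hy
        exact (f.integrable _).smul_measure ENNReal.ofReal_ne_top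
    have h1 : ∀ y ∈ s, |∫ z, f z ∂(ProbabilityTheory.cond (P n) (B y)) - f (x y)| ≤ δ := by
      intro y hy
      have := hcondprob y hy
      have e1 : ∫ z, f z ∂(ProbabilityTheory.cond (P n) (B y)) - f (x y)
          = ∫ z, (f z - f (x y)) ∂(ProbabilityTheory.cond (P n) (B y)) := by
        rw [integral_sub (f.integrable _) (integrable_const _)]
        simp
      rw [e1, ← Real.norm_eq_abs]
      have e2 : ∀ᵐ z ∂(ProbabilityTheory.cond (P n) (B y)), ‖f z - f (x y)‖ ≤ δ := by
        filter_upwards [ProbabilityTheory.ae_cond_mem (μ := P n)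
          (Metric.isOpen_ball.measurableSet : MeasurableSet (B y))] with z hz
        refine hδ z (x y) (lt_trans (Metric.mem_ball.1 hz) (by linarith))
      simpa using norm_integral_le_of_norm_le_const e2
    have h2 : ∀ y ∈ s, |p y * f (x y) - ∫ z in A y, f z ∂(C : Measure X)| ≤ δ * p y := by
      intro y hy
      have e1 : p y * f (x y) - ∫ z in A y, f z ∂(C : Measure X)
          = ∫ z in A y, (f (x y) - f z) ∂(C : Measure X) := by
        rw [integral_sub (integrable_const _) (f.integrable _)]
        simp [hp]
      rw [e1, ← Real.norm_eq_abs]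
      refine norm_setIntegral_le_of_norm_le_const (measure_lt_top _ _) fun z hz => ?_
      -- Both points lie within ε of the common value of T on their cell, hence within 2ε of each
      -- other.
      refine hδ (x y) z ?_
      have hz' : T z = y := hz
      have hxy : T (x y) = y := (hx y hy).1
      have d1 := hT z
      have d2 := hT (x y)
      rw [hz'] at d1
      rw [hxy] at d2
      have := dist_triangle_left (x y) z y
      linarith
    rw [hint_split f]
    change |∫ z, f z ∂D - _| ≤ _
    rw [hDint, ← Finset.sum_sub_distrib]
    calc _ ≤ ∑ y ∈ s, |p y * ∫ z, f z ∂(ProbabilityTheory.cond (P n) (B y))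
            - ∫ z in A y, f z ∂(C : Measure X)| := Finset.abs_sum_le_sum_abs _ _
      _ ≤ ∑ y ∈ s, p y * (2 * δ) := by
          refine Finset.sum_le_sum fun y hy => ?_
          have e : p y * ∫ z, f z ∂(ProbabilityTheory.cond (P n) (B y))
              - ∫ z in A y, f z ∂(C : Measure X)
              = p y * (∫ z, f z ∂(ProbabilityTheory.cond (P n) (B y)) - f (x y))
                + (p y * f (x y) - ∫ z in A y, f z ∂(C : Measure X)) := by ring
          rw [e]
          refine (abs_add_le _ _).trans ?_
          rw [abs_mul, abs_of_pos (hppos y hy)]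
          have := mul_le_mul_of_nonneg_left (h1 y hy) (hppos y hy).le
          have := h2 y hy
          linarith
      _ = 2 * δ := by rw [← Finset.sum_mul, hpsum, one_mul]

/-- Diagonal choice along ε = 1 / (k + 1). Uniform continuity of test functions on the compact space
turns the modulus-of-continuity estimate of `eventually_exists_klDiv_le` into narrow convergence. If
the limit energy is infinite, the constant sequence works. -/
theorem exists_tendsto_limsup_le {X ι : Type*} [TopologicalSpace X]
    [TopologicalSpace.MetrizableSpace X] [CompactSpace X]
    [MeasurableSpace X] [BorelSpace X] {P : ℕ → Measure X} {a : ℕ → ℕ} {F : X → ℝ≥0∞}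
    {h : ι → X → ℝ} [∀ n, IsProbabilityMeasure (P n)] (b : ExponentialBounds P a F h)
    (C : ProbabilityMeasure X) :
    ∃ u : ℕ → ProbabilityMeasure X, Tendsto u atTop (𝓝 C) ∧
      limsup (fun n => (a n : ℝ≥0∞)⁻¹ * klDiv (u n : Measure X) (P n)) atTop
        ≤ ∫⁻ x, F x ∂(C : Measure X) := by
  classical
  by_cases hC : ∫⁻ x, F x ∂(C : Measure X) = ∞
  · exact ⟨fun _ => C, tendsto_const_nhds, by simp [hC]⟩
  let : MetricSpace X := TopologicalSpace.metrizableSpaceMetric X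
  set e : ℕ → ℝ := fun k => 1 / ((k : ℝ) + 1) with he
  have he0 : ∀ k, 0 < e k := fun k => by rw [he]; positivity
  have helim : Tendsto e atTop (𝓝 0) := tendsto_one_div_add_atTop_nhds_zero_nat
  obtain ⟨κ, hκ, hQ⟩ := exists_tendsto_eventually _
    fun k => b.eventually_exists_klDiv_le C hC (he0 k)
  obtain ⟨u, hu'⟩ := hQ.choice
  have heκ : Tendsto (fun n => e (κ n)) atTop (𝓝 0) := helim.comp hκ
  refine ⟨u, ?_, ?_⟩
  · rw [ProbabilityMeasure.tendsto_iff_forall_integral_tendsto]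
    intro f
    rw [Metric.tendsto_atTop']
    intro δ hδ
    have huc : UniformContinuous f := CompactSpace.uniformContinuous_of_continuous f.continuous
    obtain ⟨r, hr, hfr⟩ := Metric.uniformContinuous_iff.1 huc (δ / 3) (by positivity)
    have hsmall : ∀ᶠ n in atTop, e (κ n) < r / 3 := heκ.eventually_lt_const (by positivity)
    obtain ⟨n₀, hn₀⟩ := eventually_atTop.1 (hu'.and hsmall)
    refine ⟨n₀, fun n hn => ?_⟩
    obtain ⟨⟨-, h1⟩, h2⟩ := hn₀ n hn.le
    rw [Real.dist_eq]
    refine lt_of_le_of_lt (h1 f (δ / 3) fun x y hxy => ?_) (by linarith)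
    have := hfr (a := x) (b := y) (by linarith)
    rw [Real.dist_eq] at this
    exact this.le
  · have hlim : Tendsto (fun n => ∫⁻ x, F x ∂(C : Measure X) + ENNReal.ofReal (e (κ n))) atTop
        (𝓝 (∫⁻ x, F x ∂(C : Measure X))) := by
      have := (ENNReal.continuous_ofReal.tendsto 0).comp heκ
      simpa using tendsto_const_nhds.add this
    rw [← hlim.limsup_eq]
    exact limsup_le_limsup (hu'.mono fun n hn => hn.1) (by isBoundedDefault) (by isBoundedDefault)

theorem gammaTendsto {X ι : Type*} [TopologicalSpace X]
    [TopologicalSpace.MetrizableSpace X] [CompactSpace X] [Countable ι]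
    [MeasurableSpace X] [BorelSpace X] {P : ℕ → Measure X} {a : ℕ → ℕ} {F : X → ℝ≥0∞}
    {h : ι → X → ℝ} [∀ n, IsProbabilityMeasure (P n)] (b : ExponentialBounds P a F h) :
    GammaTendsto (fun n (C : ProbabilityMeasure X) =>
        (a n : ℝ≥0∞)⁻¹ * klDiv (C : Measure X) (P n))
      (fun C => ∫⁻ x, F x ∂(C : Measure X)) :=
  ⟨fun C u hu => b.lintegral_le_liminf C u hu, fun C => b.exists_tendsto_limsup_le C⟩

end ExponentialBounds

end CanonicalEnsemble

end

noncomputable section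

namespace CanonicalEnsemble

/-! ### The canonical measures -/

instance (N L : ℕ) : Finite (Config N L) := by
  refine Finite.of_injective (β := Fin L → Fin (N + 1))
    (fun η x => ⟨η.1 x, Nat.lt_succ_of_le ?_⟩) ?_
  · calc η.1 x ≤ ∑ y, η.1 y := Finset.single_le_sum (fun _ _ => Nat.zero_le _) (Finset.mem_univ x)
      _ = N := η.2
  · intro η ζ h
    ext x
    exact congrArg Fin.val (congrFun h x)

theorem weight_ne_top (w : ℕ → ℝ≥0) {N L : ℕ} (η : Config N L) : weight w η ≠ ∞ :=
  ENNReal.prod_ne_top fun _ _ => ENNReal.coe_ne_top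

theorem normalization_ne_top (w : ℕ → ℝ≥0) (N L : ℕ) : normalization w N L ≠ ∞ := by
  have := Fintype.ofFinite (Config N L)
  rw [normalization, tsum_fintype]
  exact ENNReal.sum_ne_top.2 fun η _ => weight_ne_top w η

/-- The law of the empirical cluster distribution before normalization. -/
def unnormalizedLaw (w : ℕ → ℝ≥0) {N L : ℕ} {R : ℝ≥0} (hL : 0 < L)
    (hR : (N : ℝ≥0) / (L : ℝ≥0) ≤ R) : Measure (MomentLE R) :=
  Measure.sum fun η : Config N L => weight w η • Measure.dirac (clusterMap hL hR η)

section

variable {N L : ℕ} {R : ℝ≥0} (hL : 0 < L) (hR : (N : ℝ≥0) / (L : ℝ≥0) ≤ R)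

theorem canonicalLaw_eq_smul (w : ℕ → ℝ≥0) :
    canonicalLaw w hL hR = (normalization w N L)⁻¹ • unnormalizedLaw w hL hR := by
  have hm : Measurable (clusterMap hL hR) := measurable_of_countable _
  ext A hA
  rw [canonicalLaw, Measure.map_apply hm hA, canonical, Measure.sum_apply _ (hm hA),
    Measure.smul_apply, unnormalizedLaw, Measure.sum_apply _ hA, smul_eq_mul, ← ENNReal.tsum_mul_left]
  refine tsum_congr fun η => ?_
  rw [Measure.smul_apply, Measure.smul_apply, Measure.dirac_apply' _ (hm hA),
    Measure.dirac_apply' _ hA, smul_eq_mul, smul_eq_mul, ENNReal.div_eq_inv_mul, mul_assoc]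
  rfl

theorem unnormalizedLaw_univ (w : ℕ → ℝ≥0) :
    unnormalizedLaw w hL hR Set.univ = normalization w N L := by
  rw [unnormalizedLaw, Measure.sum_apply _ MeasurableSet.univ, normalization]
  simp

theorem isProbabilityMeasure_canonicalLaw (w : ℕ → ℝ≥0) (hZ : normalization w N L ≠ 0) :
    IsProbabilityMeasure (canonicalLaw w hL hR) := by
  constructor
  rw [canonicalLaw_eq_smul, Measure.smul_apply, unnormalizedLaw_univ, smul_eq_mul,
    ENNReal.inv_mul_cancel hZ (normalization_ne_top w N L)]

theorem lintegral_unnormalizedLaw (w : ℕ → ℝ≥0) {f : MomentLE R → ℝ≥0∞} (hf : Measurable f) :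
    ∫⁻ c, f c ∂(unnormalizedLaw w hL hR) = ∑' η : Config N L, weight w η * f (clusterMap hL hR η) := by
  rw [unnormalizedLaw, lintegral_sum_measure]
  refine tsum_congr fun η => ?_
  rw [lintegral_smul_measure, lintegral_dirac' _ hf, smul_eq_mul]

/-- The factors φ ^ ηₓ multiply to φ ^ N, which is the same for all configurations. -/
theorem weight_of_eq_mul {w w' : ℕ → ℝ≥0} {b φ : ℝ≥0} (h : ∀ k, w' k = b * φ ^ k * w k)
    (η : Config N L) :
    weight w' η = ((b ^ L * φ ^ N : ℝ≥0) : ℝ≥0∞) * weight w η := by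
  have h1 : ∏ x, φ ^ (η.1 x) = φ ^ N := by rw [Finset.prod_pow_eq_pow_sum, η.2]
  simp only [weight, ← ENNReal.ofNNReal_finsetProd, ← ENNReal.coe_mul]
  congr 1
  simp only [h, Finset.prod_mul_distrib, h1, Finset.prod_const, Finset.card_univ, Fintype.card_fin]

theorem normalization_of_eq_mul {w w' : ℕ → ℝ≥0} {b φ : ℝ≥0} (h : ∀ k, w' k = b * φ ^ k * w k)
    (N L : ℕ) :
    normalization w' N L = ((b ^ L * φ ^ N : ℝ≥0) : ℝ≥0∞) * normalization w N L := by
  simp only [normalization, weight_of_eq_mul h, ENNReal.tsum_mul_left]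

/-- The canonical law depends on the weight only up to an exponential factor. -/
theorem canonicalLaw_of_eq_mul {w w' : ℕ → ℝ≥0} {b φ : ℝ≥0} (hb : b ≠ 0) (hφ : φ ≠ 0)
    (h : ∀ k, w' k = b * φ ^ k * w k) : canonicalLaw w' hL hR = canonicalLaw w hL hR := by
  have h0 : ((b ^ L * φ ^ N : ℝ≥0) : ℝ≥0∞) ≠ 0 := by
    exact_mod_cast mul_ne_zero (pow_ne_zero _ hb) (pow_ne_zero _ hφ)
  have : canonical w' N L = canonical w N L := by
    unfold canonical
    congr 1
    ext1 η
    rw [weight_of_eq_mul h, normalization_of_eq_mul h,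
      ENNReal.mul_div_mul_left _ _ h0 ENNReal.coe_ne_top]
  rw [canonicalLaw, canonicalLaw, this]

end

/-! ### The exponential upper bound -/

theorem tsum_prod_fin_eq_pow (u : ℕ → ℝ≥0∞) (L : ℕ) :
    ∑' η : Fin L → ℕ, ∏ x, u (η x) = (∑' k, u k) ^ L := by
  induction L with
  | zero => simp
  | succ L ih =>
    rw [← (Fin.consEquiv fun _ => ℕ).tsum_eq, ENNReal.tsum_prod', pow_succ', ← ih,
      ← ENNReal.tsum_mul_right]
    refine tsum_congr fun k => ?_
    rw [← ENNReal.tsum_mul_left]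
    refine tsum_congr fun η => ?_
    simp [Fin.consEquiv, Fin.prod_univ_succ]

/-- Dropping the constraint on the particle number makes the sites independent. At the right tilt
this loses nothing on the exponential scale. -/
theorem tsum_config_prod_le_pow (u : ℕ → ℝ≥0∞) (N L : ℕ) :
    ∑' η : Config N L, ∏ x, u (η.1 x) ≤ (∑' k, u k) ^ L := by
  rw [← tsum_prod_fin_eq_pow]
  exact ENNReal.tsum_comp_le_tsum_of_injective Subtype.val_injective
    (fun η : Fin L → ℕ => ∏ x, u (η x))

/-- The affine functional of `c` dual to the entropy relative to the tilted weight. -/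
def dualValue (v : ℕ → ℝ) (ρ : ℝ) (g : ℕ →₀ ℚ) (θ : ℚ) (c : Measure ℕ) : ℝ :=
  ∑ k ∈ g.support, c.real {k} * (g k : ℝ) + ρ * θ
    - Real.log (∑' k : ℕ, v k * Real.exp ((g k : ℝ) + θ * k))

/-- Only finitely many point masses enter. The parameter θ, dual to the first moment, multiplies the
constant ρ because the first moment itself is not narrowly continuous; for empirical measures the
two differ only by N / L - ρ. -/
theorem continuous_dualValue {R : ℝ≥0} (v : ℕ → ℝ) (ρ : ℝ) (g : ℕ →₀ ℚ) (θ : ℚ) :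
    Continuous fun c : MomentLE R => dualValue v ρ g θ c.toMeasure := by
  unfold dualValue
  have := MomentLE.continuous_real_singleton R
  fun_prop

theorem mul_sum_empirical {N L : ℕ} (hL : 0 < L) (η : Config N L) (g : ℕ →₀ ℚ) :
    L * ∑ k ∈ g.support, (empirical η).real {k} * (g k : ℝ) = ∑ x, (g (η.1 x) : ℝ) := by
  have hL' : (L : ℝ) ≠ 0 := by exact_mod_cast hL.ne'
  have h1 : ∀ k, (empirical η).real {k} = (L : ℝ)⁻¹ * ∑ x, (if η.1 x = k then 1 else 0) := by
    intro k
    rw [Measure.real, empirical, Measure.smul_apply, Measure.finsetSum_apply, smul_eq_mul,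
      ENNReal.toReal_mul, ENNReal.toReal_inv, ENNReal.toReal_natCast,
      ENNReal.toReal_sum fun x _ => by finiteness]
    congr 1
    refine Finset.sum_congr rfl fun x _ => ?_
    rw [Measure.dirac_apply' _ (MeasurableSet.singleton k)]
    by_cases hx : η.1 x = k <;> simp [hx]
  simp only [h1, Finset.mul_sum, Finset.sum_mul]
  rw [Finset.sum_comm]
  refine Finset.sum_congr rfl fun x _ => ?_
  by_cases hx : g (η.1 x) = 0
  · rw [hx]
    refine (Finset.sum_eq_zero fun k hk => ?_).trans (by simp)
    have : η.1 x ≠ k := by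
      rintro rfl
      exact (Finsupp.mem_support_iff.1 hk) hx
    simp [this]
  · rw [Finset.sum_eq_single (η.1 x)]
    · simp [hL']
    · intro k _ hk
      simp [Ne.symm hk]
    · intro hk
      exact absurd (Finsupp.notMem_support_iff.1 hk) hx

/-- On configurations the exponent is a sum over sites plus a constant, so after dropping the
constraint the sum is S ^ L. The term -log S cancels it and only the discrepancy θ (Lρ - N)
survives. -/
theorem lintegral_exp_dualValue_le {N L : ℕ} {R : ℝ≥0} (hL : 0 < L)
    (hR : (N : ℝ≥0) / (L : ℝ≥0) ≤ R) (q : ℕ → ℝ≥0) (hq : ∃ k, q k ≠ 0) (ρ : ℝ) (g : ℕ →₀ ℚ)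
    (θ : ℚ) (hsum : Summable fun k : ℕ => (q k : ℝ) * Real.exp ((g k : ℝ) + θ * k)) :
    ∫⁻ c, ENNReal.ofReal (Real.exp (L * dualValue (fun k => q k) ρ g θ c.toMeasure))
        ∂(unnormalizedLaw q hL hR) ≤ ENNReal.ofReal (Real.exp (θ * (L * ρ - N))) := by
  set S : ℝ := ∑' k : ℕ, (q k : ℝ) * Real.exp ((g k : ℝ) + θ * k) with hS
  have hnn : ∀ k : ℕ, 0 ≤ (q k : ℝ) * Real.exp ((g k : ℝ) + θ * k) := fun k => by positivity
  have hSpos : 0 < S := by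
    obtain ⟨k, hk⟩ := hq
    exact hsum.tsum_pos hnn k (mul_pos (by positivity) (Real.exp_pos _))
  set u : ℕ → ℝ≥0∞ := fun k => ENNReal.ofReal ((q k : ℝ) * Real.exp ((g k : ℝ) + θ * k)) with hu
  have hu' : ∑' k, u k = ENNReal.ofReal S := (ENNReal.ofReal_tsum_of_nonneg hnn hsum).symm
  have hmeas : Measurable fun c : MomentLE R =>
      ENNReal.ofReal (Real.exp (L * dualValue (fun k => q k) ρ g θ c.toMeasure)) :=
    ((Real.continuous_exp.comp
      (continuous_const.mul (continuous_dualValue _ ρ g θ))).measurable).ennreal_ofReal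
  rw [lintegral_unnormalizedLaw hL hR q hmeas]
  set K : ℝ := θ * (L * ρ - N) - L * Real.log S with hK
  have hterm : ∀ η : Config N L, weight q η * ENNReal.ofReal (Real.exp
      (L * dualValue (fun k => q k) ρ g θ (clusterMap hL hR η).toMeasure))
      = ENNReal.ofReal (Real.exp K) * ∏ x, u (η.1 x) := by
    intro η
    have e1 : L * dualValue (fun k => q k) ρ g θ (clusterMap hL hR η).toMeasure
        = K + ∑ x, ((g (η.1 x) : ℝ) + θ * η.1 x) := by
      have hN : (∑ x, (η.1 x : ℝ)) = N := by rw [← Nat.cast_sum, η.2]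
      have := mul_sum_empirical hL η g
      rw [Finset.sum_add_distrib, ← Finset.mul_sum, hN, ← this, hK, dualValue, ← hS]
      change L * (∑ k ∈ g.support, (empirical η).real {k} * (g k : ℝ) + _ - _) = _
      ring
    rw [e1, Real.exp_add, Real.exp_sum, ENNReal.ofReal_mul (Real.exp_pos _).le,
      ENNReal.ofReal_prod_of_nonneg fun x _ => (Real.exp_pos _).le, weight, mul_left_comm,
      ← Finset.prod_mul_distrib]
    congr 1
    refine Finset.prod_congr rfl fun x _ => ?_
    rw [hu]
    simp only
    rw [ENNReal.ofReal_mul (NNReal.coe_nonneg _), ENNReal.ofReal_coe_nnreal]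
  simp only [hterm]
  rw [ENNReal.tsum_mul_left]
  calc ENNReal.ofReal (Real.exp K) * ∑' η : Config N L, ∏ x, u (η.1 x)
      ≤ ENNReal.ofReal (Real.exp K) * (ENNReal.ofReal S) ^ L := by
        rw [← hu']
        gcongr
        exact tsum_config_prod_le_pow u N L
    _ = ENNReal.ofReal (Real.exp (θ * (L * ρ - N))) := by
        rw [← ENNReal.ofReal_pow hSpos.le, ← ENNReal.ofReal_mul (Real.exp_pos _).le]
        congr 1
        have : S ^ L = Real.exp (L * Real.log S) := by
          rw [← Real.log_pow, Real.exp_log (pow_pos hSpos L)]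
        rw [this, ← Real.exp_add, hK]
        ring_nf

end CanonicalEnsemble

end

noncomputable section

namespace CanonicalEnsemble

/-! ### Duality for the rate function -/

/-- The rate function in terms of the equilibrium measure `ν` and of the price `lam` of a unit of
mass that escapes to infinity. -/
def rateOf (ν : Measure ℕ) (lam : ℝ≥0∞) (ρ : ℝ≥0) (c : Measure ℕ) : ℝ≥0∞ :=
  open scoped Classical in
  if firstMoment c ≤ (ρ : ℝ≥0∞) then klDiv c ν + lam * ((ρ : ℝ≥0∞) - firstMoment c) else ∞

theorem firstMoment_eq_tsum (c : Measure ℕ) : firstMoment c = ∑' k : ℕ, (k : ℝ≥0∞) * c {k} := by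
  rw [firstMoment, lintegral_countable']

theorem hasSum_real_singleton (c : Measure ℕ) [IsProbabilityMeasure c] :
    HasSum (fun k => c.real {k}) 1 := by
  have h : ∑' k, c {k} = 1 := by
    have := c.tsum_indicator_apply_singleton Set.univ MeasurableSet.univ
    simpa using this
  have h2 : ∀ k, c {k} ≠ ∞ := fun k => measure_ne_top _ _
  have h3 : Summable fun k => (c {k}).toReal := ENNReal.summable_toReal (by simp [h])
  have h4 : ∑' k, (c {k}).toReal = 1 := by rw [← ENNReal.tsum_toReal_eq h2, h]; simp
  exact h4 ▸ h3.hasSum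

theorem sum_real_singleton_le_one (c : Measure ℕ) [IsProbabilityMeasure c] (s : Finset ℕ) :
    ∑ k ∈ s, c.real {k} ≤ 1 :=
  sum_le_hasSum s (fun _ _ => measureReal_nonneg) (hasSum_real_singleton c)

theorem sum_mul_le_firstMoment (c : Measure ℕ) [IsFiniteMeasure c] (hc : firstMoment c ≠ ∞)
    (s : Finset ℕ) : ∑ k ∈ s, (k : ℝ) * c.real {k} ≤ (firstMoment c).toReal := by
  have h1 : ∑ k ∈ s, (k : ℝ≥0∞) * c {k} ≤ firstMoment c := by
    rw [firstMoment_eq_tsum]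
    exact ENNReal.sum_le_tsum s
  have h2 := ENNReal.toReal_mono hc h1
  rw [ENNReal.toReal_sum fun k _ => by finiteness] at h2
  simpa [Measure.real] using h2

/-- Take θ = -m and let g cancel it on a finite set whose partial first moment already exceeds ρ.
The logarithm stays nonpositive while the linear part grows like m times the surplus. -/
theorem exists_rat_dualValue_gt_of_firstMoment_gt (ν c : Measure ℕ) [IsProbabilityMeasure ν]
    [IsProbabilityMeasure c] {ρ : ℝ≥0} (h : (ρ : ℝ≥0∞) < firstMoment c) (t : ℝ) :
    ∃ (g : ℕ →₀ ℚ) (θ : ℚ), (Summable fun k : ℕ => ν.real {k} * Real.exp ((g k : ℝ) + θ * k)) ∧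
      t < dualValue (fun k => ν.real {k}) ρ g θ c := by
  classical
  rw [firstMoment_eq_tsum, ENNReal.tsum_eq_iSup_sum, lt_iSup_iff] at h
  obtain ⟨s, hs⟩ := h
  have hs' : (ρ : ℝ) < ∑ k ∈ s, (k : ℝ) * c.real {k} := by
    have h2 := (ENNReal.toReal_lt_toReal ENNReal.coe_ne_top
      (ENNReal.sum_ne_top.2 fun k _ => by finiteness)).2 hs
    rw [ENNReal.toReal_sum fun k _ => by finiteness] at h2
    simpa [Measure.real] using h2
  obtain ⟨m, hm⟩ := exists_nat_gt (t / (∑ k ∈ s, (k : ℝ) * c.real {k} - ρ))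
  let g : ℕ →₀ ℚ := Finsupp.onFinset s (fun k => if k ∈ s then (m * k : ℚ) else 0)
    (fun k hk => by by_contra h; simp [h] at hk)
  have hg : ∀ k, (g k : ℝ) = if k ∈ s then (m * k : ℝ) else 0 := fun k => by
    simp only [g, Finsupp.onFinset_apply]; split_ifs <;> simp
  have hν := hasSum_real_singleton ν
  have hle : ∀ k : ℕ, ν.real {k} * Real.exp ((g k : ℝ) + ((-m : ℚ) : ℝ) * k) ≤ ν.real {k} := by
    intro k
    refine mul_le_of_le_one_right measureReal_nonneg (Real.exp_le_one_iff.2 ?_)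
    rw [hg]
    have : (0 : ℝ) ≤ m * k := by positivity
    push_cast
    split_ifs <;> linarith
  have hsum : Summable fun k : ℕ => ν.real {k} * Real.exp ((g k : ℝ) + ((-m : ℚ) : ℝ) * k) :=
    Summable.of_nonneg_of_le (fun k => mul_nonneg measureReal_nonneg (Real.exp_pos _).le) hle
      hν.summable
  refine ⟨g, -m, hsum, ?_⟩
  have hlog : Real.log (∑' k : ℕ, ν.real {k} * Real.exp ((g k : ℝ) + ((-m : ℚ) : ℝ) * k)) ≤ 0 := by
    refine Real.log_nonpos (tsum_nonneg fun k =>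
      mul_nonneg measureReal_nonneg (Real.exp_pos _).le) ?_
    rw [← hν.tsum_eq]
    exact hsum.tsum_le_tsum hle hν.summable
  have hgs : ∑ k ∈ g.support, c.real {k} * (g k : ℝ) = m * ∑ k ∈ s, (k : ℝ) * c.real {k} := by
    rw [Finset.mul_sum, Finset.sum_subset (Finsupp.support_onFinset_subset)]
    · refine Finset.sum_congr rfl fun k hk => ?_
      rw [hg, if_pos hk]; ring
    · intro k _ hk
      rw [Finsupp.notMem_support_iff.1 hk]; simp
  rw [div_lt_iff₀ (by linarith)] at hm
  rw [dualValue, hgs]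
  push_cast at hlog ⊢
  linarith

/-- At a point charged by c but not by ν, g can be raised arbitrarily without changing the
exponential sum. -/
theorem exists_rat_dualValue_gt_of_not_ac (ν c : Measure ℕ) [IsProbabilityMeasure ν]
    [IsProbabilityMeasure c] (ρ : ℝ) (h : ¬ c ≪ ν) (t : ℝ) :
    ∃ (g : ℕ →₀ ℚ) (θ : ℚ), (Summable fun k : ℕ => ν.real {k} * Real.exp ((g k : ℝ) + θ * k)) ∧
      t < dualValue (fun k => ν.real {k}) ρ g θ c := by
  classical
  obtain ⟨j, hνj, hcj⟩ : ∃ j, ν {j} = 0 ∧ c {j} ≠ 0 := by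
    by_contra! hcon
    refine h fun s hs => ?_
    rw [← c.tsum_indicator_apply_singleton s MeasurableSet.of_discrete, ENNReal.tsum_eq_zero]
    intro k
    by_cases hk : k ∈ s
    · rw [Set.indicator_of_mem hk]
      exact hcon k (measure_mono_null (Set.singleton_subset_iff.2 hk) hs)
    · rw [Set.indicator_of_notMem hk]
  have hcj' : 0 < c.real {j} := (measureReal_ne_zero_iff).2 hcj |>.lt_of_le' measureReal_nonneg
  obtain ⟨m, hm⟩ := exists_nat_gt (t / c.real {j})
  rw [div_lt_iff₀ hcj'] at hm
  have hterm : ∀ k : ℕ, ν.real {k} * Real.exp (((Finsupp.single j (m : ℚ) k : ℚ) : ℝ)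
      + ((0 : ℚ) : ℝ) * k) = ν.real {k} := by
    intro k
    by_cases hk : k = j
    · have : ν.real {j} = 0 := by rw [Measure.real, hνj]; rfl
      rw [hk, this, zero_mul]
    · simp [Ne.symm hk]
  have hν := hasSum_real_singleton ν
  refine ⟨Finsupp.single j (m : ℚ), 0, ?_, ?_⟩
  · simp only [hterm]
    exact hν.summable
  · rw [dualValue]
    simp only [hterm]
    rw [hν.tsum_eq, Real.log_one, Finset.sum_subset Finsupp.support_single_subset]
    · simp only [Finset.sum_singleton, Finsupp.single_eq_same, Rat.cast_natCast, Rat.cast_zero]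
      linarith
    · intro k _ hk
      rw [Finsupp.notMem_support_iff.1 hk]; simp

/-- For fixed θ the formal optimizer is g = log(dc/dν) - θk, for which the exponential sum is 1;
hence log S ≤ S - 1 may be used without loss. Restricting g to a finite set, making it finite where
c vanishes and making it rational cost γ/4 each, out of an available gap γ. -/
theorem exists_rat_dualValue_gt_of_ac (ν c : Measure ℕ) [IsProbabilityMeasure ν]
    [IsProbabilityMeasure c] {ρ : ℝ≥0} (hρ : firstMoment c ≤ ρ) (hac : c ≪ ν) (θ : ℚ)
    (hθ : 0 ≤ θ) (hsum : Summable fun k : ℕ => ν.real {k} * Real.exp ((θ : ℝ) * k)) (t : ℝ)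
    (ht : ENNReal.ofReal t
      < klDiv c ν + ENNReal.ofReal θ * ((ρ : ℝ≥0∞) - firstMoment c)) :
    ∃ g : ℕ →₀ ℚ, (Summable fun k : ℕ => ν.real {k} * Real.exp ((g k : ℝ) + θ * k)) ∧
      t < dualValue (fun k => ν.real {k}) ρ g θ c := by
  classical
  have hθ' : (0 : ℝ) ≤ θ := by exact_mod_cast hθ
  have hfin : firstMoment c ≠ ∞ := ne_top_of_le_ne_top ENNReal.coe_ne_top hρ
  set m₁ : ℝ := (firstMoment c).toReal with hm₁
  have hm₁ρ : m₁ ≤ ρ := by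
    have := ENNReal.toReal_mono ENNReal.coe_ne_top hρ
    simpa using this
  set kl : ℕ → ℝ := fun k => c.real {k} * Real.log (c.real {k} / ν.real {k}) + ν.real {k}
    - c.real {k} with hkl
  have hcν : ∀ k, c.real {k} ≠ 0 → ν.real {k} ≠ 0 := by
    intro k hk h0
    rw [measureReal_ne_zero_iff] at hk
    rw [measureReal_eq_zero_iff] at h0
    exact hk (hac h0)
  have hkl0 : ∀ k, 0 ≤ kl k := by
    intro k
    by_cases hk : ν.real {k} = 0
    · have : c.real {k} = 0 := by
        by_contra h
        exact hcν k h hk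
      simp [hkl, this, hk]
    · have hνk : 0 < ν.real {k} := lt_of_le_of_ne measureReal_nonneg (Ne.symm hk)
      have h1 := klFun_nonneg (x := c.real {k} / ν.real {k}) (by positivity)
      have h2 : kl k = ν.real {k} * klFun (c.real {k} / ν.real {k}) := by
        rw [hkl, klFun_apply]
        field_simp
      rw [h2]
      positivity
  have hrest : ENNReal.ofReal θ * ((ρ : ℝ≥0∞) - firstMoment c)
      = ENNReal.ofReal (θ * (ρ - m₁)) := by
    rw [ENNReal.ofReal_mul hθ', ENNReal.ofReal_sub _ ENNReal.toReal_nonneg,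
      ENNReal.ofReal_toReal hfin, ENNReal.ofReal_coe_nnreal]
  obtain ⟨s₀, hs₀⟩ : ∃ s₀ : Finset ℕ, t < ∑ k ∈ s₀, kl k + θ * (ρ - m₁) := by
    rw [klDiv_nat_eq_tsum c ν hac, hrest, ENNReal.tsum_eq_iSup_sum, ENNReal.iSup_add,
      lt_iSup_iff] at ht
    obtain ⟨s₀, hs₀⟩ := ht
    refine ⟨s₀, ?_⟩
    rw [← ENNReal.ofReal_sum_of_nonneg fun k _ => hkl0 k, ← ENNReal.ofReal_add
      (Finset.sum_nonneg fun k _ => hkl0 k) (mul_nonneg hθ' (by linarith))] at hs₀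
    exact (ENNReal.ofReal_lt_ofReal_iff').1 hs₀ |>.1
  set γ : ℝ := ∑ k ∈ s₀, kl k + θ * (ρ - m₁) - t with hγ
  have hγ0 : 0 < γ := by rw [hγ]; linarith
  set S : ℝ := ∑' k : ℕ, ν.real {k} * Real.exp ((θ : ℝ) * k) with hS
  -- Outside s the function g is zero, so s must also capture all but γ/4 of the exponential sum of
  -- ν at θ.
  obtain ⟨s, hss, hstail⟩ : ∃ s : Finset ℕ, s₀ ⊆ s ∧
      S - γ / 4 < ∑ k ∈ s, ν.real {k} * Real.exp ((θ : ℝ) * k) := by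
    have h1 : ∀ᶠ s : Finset ℕ in atTop, S - γ / 4 < ∑ k ∈ s, ν.real {k} * Real.exp ((θ : ℝ) * k) :=
      hsum.hasSum.eventually_const_lt (by linarith)
    obtain ⟨s, h2, h3⟩ := ((eventually_ge_atTop s₀).and h1).exists
    exact ⟨s, h2, h3⟩
  obtain ⟨M, hM⟩ : ∃ M : ℝ, Real.exp (-M) < γ / 4 := by
    have := Real.tendsto_exp_neg_atTop_nhds_zero.eventually_lt_const (show 0 < γ / 4 by positivity)
    exact this.exists
  -- Where c vanishes the optimizer would be -∞; the value -M leaves at most γ/4 in the exponential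
  -- sum and is multiplied by zero in the linear part.
  set g₀ : ℕ → ℝ := fun k =>
    (if c.real {k} = 0 then -M else Real.log (c.real {k} / ν.real {k})) - θ * k with hg₀
  -- Rounding down keeps the bound on the exponential sum, and the linear part loses at most γ/4
  -- because c has mass at most 1 on s.
  have hrat : ∀ k, ∃ r : ℚ, g₀ k - γ / 4 < r ∧ (r : ℝ) < g₀ k := fun k =>
    exists_rat_btwn (by linarith)
  choose r hr1 hr2 using hrat
  let g : ℕ →₀ ℚ := Finsupp.onFinset s (fun k => if k ∈ s then r k else 0)
    (fun k hk => by by_contra h; simp [h] at hk)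
  have hgs : ∀ k ∈ s, g k = r k := fun k hk => by simp [g, hk]
  have hgn : ∀ k ∉ s, g k = 0 := fun k hk => by simp [g, hk]
  have hsum' : Summable fun k : ℕ => ν.real {k} * Real.exp ((g k : ℝ) + θ * k) := by
    refine hsum.congr_cofinite ?_
    have : ∀ᶠ k in cofinite, k ∉ s := s.finite_toSet.eventually_cofinite_notMem
    filter_upwards [this] with k hk
    simp [hgn k hk]
  refine ⟨g, hsum', ?_⟩
  have hlin : ∑ k ∈ s, c.real {k} * g₀ k - γ / 4 ≤ ∑ k ∈ g.support, c.real {k} * (g k : ℝ) := by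
    have e : ∑ k ∈ g.support, c.real {k} * (g k : ℝ) = ∑ k ∈ s, c.real {k} * (r k : ℝ) := by
      rw [Finset.sum_subset (Finsupp.support_onFinset_subset)]
      · exact Finset.sum_congr rfl fun k hk => by rw [hgs k hk]
      · intro k _ hk
        rw [Finsupp.notMem_support_iff.1 hk]; simp
    rw [e]
    have h1 : ∑ k ∈ s, c.real {k} * (g₀ k - γ / 4) ≤ ∑ k ∈ s, c.real {k} * (r k : ℝ) :=
      Finset.sum_le_sum fun k _ => mul_le_mul_of_nonneg_left (hr1 k).le measureReal_nonneg
    have h2 : ∑ k ∈ s, c.real {k} * (g₀ k - γ / 4)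
        = ∑ k ∈ s, c.real {k} * g₀ k - (∑ k ∈ s, c.real {k}) * (γ / 4) := by
      rw [Finset.sum_mul, ← Finset.sum_sub_distrib]
      exact Finset.sum_congr rfl fun k _ => by ring
    have h3 := mul_le_mul_of_nonneg_right (sum_real_singleton_le_one c s) (by linarith : 0 ≤ γ / 4)
    linarith
  have hlin2 : ∑ k ∈ s, c.real {k} * g₀ k
      = ∑ k ∈ s, c.real {k} * Real.log (c.real {k} / ν.real {k})
        - θ * ∑ k ∈ s, (k : ℝ) * c.real {k} := by
    rw [Finset.mul_sum, ← Finset.sum_sub_distrib]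
    refine Finset.sum_congr rfl fun k _ => ?_
    rw [hg₀]
    by_cases hk : c.real {k} = 0
    · simp [hk]
    · simp only [hk, if_false]; ring
  have hZ : ∑' k : ℕ, ν.real {k} * Real.exp ((g k : ℝ) + θ * k)
      ≤ ∑ k ∈ s, c.real {k} + γ / 4 + γ / 4 := by
    rw [← hsum'.sum_add_tsum_compl (s := s)]
    have h1 : ∑ k ∈ s, ν.real {k} * Real.exp ((g k : ℝ) + θ * k)
        ≤ ∑ k ∈ s, (c.real {k} + ν.real {k} * (γ / 4)) := by
      refine Finset.sum_le_sum fun k hk => ?_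
      have h2 : ν.real {k} * Real.exp ((g k : ℝ) + θ * k)
          ≤ ν.real {k} * Real.exp (g₀ k + θ * k) := by
        rw [hgs k hk]
        exact mul_le_mul_of_nonneg_left (Real.exp_le_exp.2 (by linarith [hr2 k])) measureReal_nonneg
      refine h2.trans ?_
      have h3 : (0 : ℝ) ≤ ν.real {k} * (γ / 4) := by positivity
      by_cases hk0 : c.real {k} = 0
      · have : g₀ k + θ * k = -M := by simp [hg₀, hk0]
        rw [this, hk0, zero_add]
        exact mul_le_mul_of_nonneg_left hM.le measureReal_nonneg
      · have h4 : g₀ k + θ * k = Real.log (c.real {k} / ν.real {k}) := by simp [hg₀, hk0]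
        have hck : 0 < c.real {k} := lt_of_le_of_ne measureReal_nonneg (Ne.symm hk0)
        have hνk : 0 < ν.real {k} := lt_of_le_of_ne measureReal_nonneg (Ne.symm (hcν k hk0))
        rw [h4, Real.exp_log (by positivity), mul_div_cancel₀ _ hνk.ne']
        linarith
    rw [Finset.sum_add_distrib, ← Finset.sum_mul] at h1
    have h5 := mul_le_mul_of_nonneg_right (sum_real_singleton_le_one ν s) (by linarith : 0 ≤ γ / 4)
    have h6 : ∑' k : ↥((s : Set ℕ)ᶜ), ν.real {(k : ℕ)} * Real.exp ((g k : ℝ) + θ * (k : ℕ))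
        = ∑' k : ↥((s : Set ℕ)ᶜ), ν.real {(k : ℕ)} * Real.exp ((θ : ℝ) * (k : ℕ)) :=
      tsum_congr fun k => by
        have : (k : ℕ) ∉ s := fun h => k.2 (Finset.mem_coe.2 h)
        simp [hgn _ this]
    have h7 := hsum.sum_add_tsum_compl (s := s)
    rw [h6]
    linarith
  have hZ0 : 0 < ∑' k : ℕ, ν.real {k} * Real.exp ((g k : ℝ) + θ * k) := by
    have hnn : ∀ k : ℕ, 0 ≤ ν.real {k} * Real.exp ((g k : ℝ) + θ * k) := fun k =>
      mul_nonneg measureReal_nonneg (Real.exp_pos _).le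
    obtain ⟨k, hk⟩ : ∃ k, ν.real {k} ≠ 0 := by
      by_contra! hcon
      have := hasSum_real_singleton ν
      simp only [hcon] at this
      exact zero_ne_one (hasSum_zero.unique this)
    exact hsum'.tsum_pos hnn k (mul_pos (lt_of_le_of_ne measureReal_nonneg (Ne.symm hk))
      (Real.exp_pos _))
  have hlog := Real.log_le_sub_one_of_pos hZ0
  have hkls : ∑ k ∈ s₀, kl k ≤ ∑ k ∈ s, kl k :=
    Finset.sum_le_sum_of_subset_of_nonneg hss fun k _ _ => hkl0 k
  have hkls' : ∑ k ∈ s, kl k = ∑ k ∈ s, c.real {k} * Real.log (c.real {k} / ν.real {k})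
      + ∑ k ∈ s, ν.real {k} - ∑ k ∈ s, c.real {k} := by
    rw [← Finset.sum_add_distrib, ← Finset.sum_sub_distrib]
  have hm := mul_le_mul_of_nonneg_left (sum_mul_le_firstMoment c hfin s) hθ'
  have hν1 := sum_real_singleton_le_one ν s
  rw [dualValue]
  rw [← hm₁] at hm
  linarith

/-- Every value below the rate is exceeded by one of countably many continuous functionals. -/
theorem rateOf_le_iSup_dualValue (ν c : Measure ℕ) [IsProbabilityMeasure ν]
    [IsProbabilityMeasure c] (lam : ℝ≥0∞) (ρ : ℝ≥0)
    (hlam : ∀ θ : ℝ, 0 ≤ θ → ENNReal.ofReal θ < lam →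
      Summable fun k : ℕ => ν.real {k} * Real.exp (θ * k)) :
    rateOf ν lam ρ c ≤ ⨆ i : {i : (ℕ →₀ ℚ) × ℚ //
        Summable fun k : ℕ => ν.real {k} * Real.exp ((i.1 k : ℝ) + i.2 * k)},
      ENNReal.ofReal (dualValue (fun k => ν.real {k}) ρ i.1.1 i.1.2 c) := by
  refine le_of_forall_lt fun t ht => ?_
  have htop : t ≠ ∞ := ne_top_of_lt ht
  obtain ⟨g, θ, hs, hgt⟩ : ∃ (g : ℕ →₀ ℚ) (θ : ℚ),
      (Summable fun k : ℕ => ν.real {k} * Real.exp ((g k : ℝ) + θ * k)) ∧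
      t.toReal < dualValue (fun k => ν.real {k}) ρ g θ c := by
    by_cases hρ : firstMoment c ≤ (ρ : ℝ≥0∞)
    · by_cases hac : c ≪ ν
      · rw [rateOf, if_pos hρ] at ht
        obtain ⟨θ, hθ, hsum, hlt⟩ : ∃ θ : ℚ, 0 ≤ θ ∧
            (Summable fun k : ℕ => ν.real {k} * Real.exp ((θ : ℝ) * k)) ∧
            t < klDiv c ν + ENNReal.ofReal θ * ((ρ : ℝ≥0∞) - firstMoment c) := by
          -- A rational θ slightly below lam suffices, since the value is continuous in θ up to lam
          -- = ∞ included. For lam = 0 there is nothing below, and θ = 0 is exact.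
          rcases eq_or_ne lam 0 with h0 | h0
          · refine ⟨0, le_rfl, ?_, ?_⟩
            · simpa using (hasSum_real_singleton ν).summable
            · simpa [h0] using ht
          · have hcont : Continuous fun r : ℝ≥0∞ =>
                klDiv c ν + r * ((ρ : ℝ≥0∞) - firstMoment c) :=
              continuous_const.add (ENNReal.continuous_mul_const
                (ENNReal.sub_ne_top ENNReal.coe_ne_top))
            have hnhds := hcont.continuousAt.eventually_const_lt ht
            obtain ⟨l, hl, hIoc⟩ := exists_Ioc_subset_of_mem_nhds hnhds ⟨0, pos_iff_ne_zero.2 h0⟩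
            obtain ⟨θ, hθ, h1, h2⟩ := ENNReal.lt_iff_exists_rat_btwn.1 hl
            refine ⟨θ, hθ, hlam θ (by exact_mod_cast hθ) h2, ?_⟩
            exact hIoc ⟨h1, h2.le⟩
        obtain ⟨g, h1, h2⟩ := exists_rat_dualValue_gt_of_ac ν c hρ hac θ hθ hsum t.toReal
          (by rwa [ENNReal.ofReal_toReal htop])
        exact ⟨g, θ, h1, h2⟩
      · exact exists_rat_dualValue_gt_of_not_ac ν c ρ hac _
    · exact exists_rat_dualValue_gt_of_firstMoment_gt ν c (not_le.1 hρ) _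
  refine lt_of_lt_of_le ?_ (le_iSup _ ⟨(g, θ), hs⟩)
  rw [← ENNReal.ofReal_toReal htop]
  exact (ENNReal.ofReal_lt_ofReal_iff (lt_of_le_of_lt ENNReal.toReal_nonneg hgt)).2 hgt

end CanonicalEnsemble

end

noncomputable section

namespace CanonicalEnsemble

/-! ### Counting configurations -/

/-- With `log_factorial_le` a crude form of Stirling's formula; errors of order log n are irrelevant
at speed L. -/
theorem mul_log_sub_le_log_factorial (n : ℕ) :
    n * Real.log n - n ≤ Real.log (n.factorial : ℝ) := by
  induction n with
  | zero => simp
  | succ n ih =>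
    rw [Nat.factorial_succ, Nat.cast_mul, Real.log_mul (by positivity) (by positivity)]
    rcases Nat.eq_zero_or_pos n with rfl | hn
    · simp
    have hn' : (0 : ℝ) < n := by exact_mod_cast hn
    have h1 := Real.log_le_sub_one_of_pos (show (0 : ℝ) < ((n + 1 : ℕ) : ℝ) / n by positivity)
    rw [Real.log_div (by positivity) hn'.ne'] at h1
    have h2 : ((n + 1 : ℕ) : ℝ) / n - 1 = 1 / n := by push_cast; field_simp; ring
    rw [h2] at h1
    have h3 := mul_le_mul_of_nonneg_left h1 hn'.le
    rw [mul_one_div_cancel hn'.ne'] at h3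
    push_cast at h3 ⊢
    linarith

theorem log_factorial_le {n : ℕ} (hn : 0 < n) :
    Real.log (n.factorial : ℝ) ≤ n * Real.log n - n + 1 + Real.log n := by
  induction n, hn using Nat.le_induction with
  | base => simp
  | succ n hn ih =>
    rw [Nat.factorial_succ, Nat.cast_mul, Real.log_mul (by positivity) (by positivity)]
    have hn' : (0 : ℝ) < n := by exact_mod_cast hn
    have h1 := Real.one_sub_inv_le_log_of_pos
      (show (0 : ℝ) < ((n + 1 : ℕ) : ℝ) / n by positivity)
    rw [Real.log_div (by positivity) hn'.ne'] at h1
    have h2 : 1 - (((n + 1 : ℕ) : ℝ) / n)⁻¹ = 1 / ((n : ℝ) + 1) := by push_cast; field_simp; ring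
    rw [h2] at h1
    have h3 := mul_le_mul_of_nonneg_left h1 (show (0 : ℝ) ≤ n + 1 by positivity)
    rw [mul_one_div_cancel (by positivity)] at h3
    push_cast at h3 ⊢
    linarith

theorem empirical_singleton {N L : ℕ} (η : Config N L) (k : ℕ) :
    empirical η {k} = (L : ℝ≥0∞)⁻¹ * (Finset.univ.filter fun x => η.1 x = k).card := by
  rw [empirical, Measure.smul_apply, Measure.finsetSum_apply, smul_eq_mul, Finset.card_filter,
    Nat.cast_sum]
  congr 1
  refine Finset.sum_congr rfl fun x _ => ?_
  rw [Measure.dirac_apply' _ (MeasurableSet.singleton k)]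
  by_cases hx : η.1 x = k <;> simp [hx]

/-- Permuting the sites of a configuration. -/
def permConfig {N L : ℕ} (η : Config N L) (σ : Equiv.Perm (Fin L)) : Config N L :=
  ⟨η.1 ∘ σ, (Equiv.sum_comp σ η.1).trans η.2⟩

theorem clusterMap_permConfig {N L : ℕ} {R : ℝ≥0} (hL : 0 < L)
    (hR : (N : ℝ≥0) / (L : ℝ≥0) ≤ R) (η : Config N L) (σ : Equiv.Perm (Fin L)) :
    clusterMap hL hR (permConfig η σ) = clusterMap hL hR η := by
  have : empirical (permConfig η σ) = empirical η := by
    unfold empirical permConfig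
    congr 1
    exact Equiv.sum_comp σ fun x => Measure.dirac (η.1 x)
  exact Subtype.ext (Subtype.ext this)

theorem weight_permConfig (w : ℕ → ℝ≥0) {N L : ℕ} (η : Config N L) (σ : Equiv.Perm (Fin L)) :
    weight w (permConfig η σ) = weight w η :=
  Equiv.prod_comp σ fun x => (w (η.1 x) : ℝ≥0∞)

/-- Orbit–stabilizer for the site permutations: the stabilizer permutes sites of equal occupation,
so its order is the product of the factorials, and the orbit has at least multinomial size. -/
theorem factorial_le_mul_card_image_permConfig {N L : ℕ} (η : Config N L) (T : Finset ℕ)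
    (hT : ∀ x, η.1 x ∈ T) :
    L.factorial ≤ (∏ s ∈ T, (Finset.univ.filter fun x => η.1 x = s).card.factorial) *
      (Finset.univ.image (permConfig η)).card := by
  classical
  have hst := DomMulAct.stabilizer_card' η.1
  have h1 : Fintype.card {g : Equiv.Perm (Fin L) // η.1 ∘ g = η.1}
      = ∏ s ∈ T, (Finset.univ.filter fun x => η.1 x = s).card.factorial := by
    rw [hst]
    have hsub : Finset.univ.image η.1 ⊆ T := by
      intro s hs
      obtain ⟨x, -, rfl⟩ := Finset.mem_image.1 hs
      exact hT x
    rw [← Finset.prod_subset hsub]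
    · exact Finset.prod_congr rfl fun s _ => by rw [Fintype.card_subtype]
    · intro s _ hs
      have : (Finset.univ.filter fun x => η.1 x = s) = ∅ := by
        refine Finset.filter_eq_empty_iff.2 fun x _ hx => hs ?_
        exact Finset.mem_image.2 ⟨x, Finset.mem_univ x, hx⟩
      rw [this]
      simp
  rw [← h1]
  have h2 : (Finset.univ : Finset (Equiv.Perm (Fin L))).card = L.factorial := by
    rw [Finset.card_univ, Fintype.card_perm, Fintype.card_fin]
  rw [← h2]
  refine Finset.card_le_mul_card_image _ _ fun ζ hζ => ?_
  obtain ⟨σ₀, -, rfl⟩ := Finset.mem_image.1 hζ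
  rw [← Fintype.card_subtype]
  -- Every fibre of the orbit map is a translate of the stabilizer.
  refine Fintype.card_le_of_injective (fun σ => ⟨σ.1 * σ₀⁻¹, ?_⟩) ?_
  · have h3 : η.1 ∘ σ.1 = η.1 ∘ σ₀ := congrArg Subtype.val σ.2
    funext x
    have := congrFun h3 (σ₀⁻¹ x)
    simpa using this
  · intro σ τ h
    have h4 : σ.1 * σ₀⁻¹ = τ.1 * σ₀⁻¹ := congrArg Subtype.val h
    exact Subtype.ext (mul_right_cancel h4)

theorem weight_eq_prod_pow (w : ℕ → ℝ≥0) {N L : ℕ} (η : Config N L) (T : Finset ℕ)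
    (hT : ∀ x, η.1 x ∈ T) :
    weight w η = ∏ s ∈ T, (w s : ℝ≥0∞) ^ (Finset.univ.filter fun x => η.1 x = s).card := by
  rw [weight, ← Finset.prod_fiberwise_of_maps_to (s := Finset.univ) (t := T) (g := η.1)
    (fun x _ => hT x)]
  refine Finset.prod_congr rfl fun s _ => ?_
  rw [← Finset.prod_const]
  refine Finset.prod_congr rfl fun x hx => ?_
  rw [(Finset.mem_filter.1 hx).2]

/-- Lower bound for the weight of all configurations with the same empirical distribution. -/
theorem exp_le_unnormalizedLaw {N L : ℕ} {R : ℝ≥0} (hL : 0 < L)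
    (hR : (N : ℝ≥0) / (L : ℝ≥0) ≤ R) (q : ℕ → ℝ≥0) (η : Config N L) (T : Finset ℕ)
    (hT : ∀ x, η.1 x ∈ T) (hq : ∀ s ∈ T, q s ≠ 0)
    (m : ℕ → ℕ) (hm : ∀ s ∈ T, (Finset.univ.filter fun x => η.1 x = s).card = m s)
    (hm0 : ∀ s ∈ T, 0 < m s) {U : Set (MomentLE R)} (hU : clusterMap hL hR η ∈ U) :
    ENNReal.ofReal (Real.exp (-(L * (∑ s ∈ T, (m s / L : ℝ) * Real.log ((m s / L : ℝ) / q s)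
      + T.card * ((1 + Real.log L) / L))))) ≤ unnormalizedLaw q hL hR U := by
  classical
  have hL0 : (0 : ℝ) < L := by exact_mod_cast hL
  have hqpos : ∀ s ∈ T, (0 : ℝ) < q s := fun s hs => NNReal.coe_pos.2 (pos_iff_ne_zero.2 (hq s hs))
  set O := Finset.univ.image (permConfig η) with hO
  have h1 : (O.card : ℝ≥0∞) * weight q η ≤ unnormalizedLaw q hL hR U := by
    refine le_trans ?_ (Measure.le_sum_apply _ U)
    calc (O.card : ℝ≥0∞) * weight q η = ∑ ζ ∈ O, weight q η := by
          rw [Finset.sum_const, nsmul_eq_mul]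
      _ ≤ ∑ ζ ∈ O, (weight q ζ • Measure.dirac (clusterMap hL hR ζ)) U := by
          refine Finset.sum_le_sum fun ζ hζ => ?_
          obtain ⟨σ, -, rfl⟩ := Finset.mem_image.1 hζ
          rw [Measure.smul_apply, smul_eq_mul, weight_permConfig, clusterMap_permConfig,
            Measure.dirac_apply_of_mem hU, mul_one]
      _ ≤ _ := ENNReal.sum_le_tsum O
  refine le_trans ?_ h1
  have hfac := factorial_le_mul_card_image_permConfig η T hT
  rw [Finset.prod_congr rfl fun s hs => by rw [hm s hs]] at hfac
  rw [weight_eq_prod_pow q η T hT, Finset.prod_congr rfl fun s hs => by rw [hm s hs]]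
  have hsumm : ∑ s ∈ T, (m s : ℝ) = L := by
    have : ∑ s ∈ T, m s = L := by
      rw [← Finset.sum_congr rfl fun s hs => hm s hs,
        ← Finset.card_eq_sum_card_fiberwise (fun x _ => hT x), Finset.card_univ, Fintype.card_fin]
    exact_mod_cast this
  have hcast : ((O.card : ℝ≥0∞) * ∏ s ∈ T, (q s : ℝ≥0∞) ^ m s)
      = ENNReal.ofReal (O.card * ∏ s ∈ T, (q s : ℝ) ^ m s) := by
    rw [ENNReal.ofReal_mul (Nat.cast_nonneg _), ENNReal.ofReal_natCast,
      ENNReal.ofReal_prod_of_nonneg fun s _ => by positivity]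
    congr 1
    refine Finset.prod_congr rfl fun s _ => ?_
    rw [ENNReal.ofReal_pow (NNReal.coe_nonneg _), ENNReal.ofReal_coe_nnreal]
  rw [hcast]
  refine ENNReal.ofReal_le_ofReal ?_
  have hfac' : (L.factorial : ℝ) ≤ (∏ s ∈ T, ((m s).factorial : ℝ)) * O.card := by
    exact_mod_cast hfac
  have hOpos : (0 : ℝ) < O.card := by
    by_contra! hcon
    have : (∏ s ∈ T, ((m s).factorial : ℝ)) * O.card ≤ 0 :=
      mul_nonpos_of_nonneg_of_nonpos (by positivity) hcon
    have h2 : (0 : ℝ) < L.factorial := by positivity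
    linarith
  have hprod : 0 < ∏ s ∈ T, (q s : ℝ) ^ m s :=
    Finset.prod_pos fun s hs => pow_pos (hqpos s hs) _
  rw [← Real.le_log_iff_exp_le (by positivity), Real.log_mul hOpos.ne' hprod.ne',
    Real.log_prod fun s hs => (pow_pos (hqpos s hs) _).ne']
  have hlogO : Real.log L.factorial - ∑ s ∈ T, Real.log ((m s).factorial : ℝ)
      ≤ Real.log O.card := by
    have h3 := Real.log_le_log (by positivity) hfac'
    rw [Real.log_mul (Finset.prod_pos fun s _ => by positivity).ne' hOpos.ne',
      Real.log_prod fun s _ => by positivity] at h3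
    linarith
  have hlogL := mul_log_sub_le_log_factorial L
  have hms : ∀ s ∈ T, (m s : ℝ) ≤ L := by
    intro s hs
    rw [← hsumm]
    exact Finset.single_le_sum (f := fun s => (m s : ℝ)) (fun _ _ => Nat.cast_nonneg _) hs
  -- Summed over s, the terms `m s * log L - m s` give L log L - L, which the lower bound for log L!
  -- cancels. What remains is the entropy and an error 1 + log L per occupied size.
  have hterm : ∀ s ∈ T, Real.log ((m s).factorial : ℝ) - Real.log ((q s : ℝ) ^ m s)
      ≤ L * ((m s / L : ℝ) * Real.log ((m s / L : ℝ) / q s)) + m s * Real.log L - m s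
        + (1 + Real.log L) := by
    intro s hs
    have hmpos : (0 : ℝ) < m s := by exact_mod_cast hm0 s hs
    have h4 := log_factorial_le (hm0 s hs)
    have h5 : L * ((m s / L : ℝ) * Real.log ((m s / L : ℝ) / q s))
        = m s * (Real.log (m s) - Real.log L - Real.log (q s)) := by
      rw [Real.log_div (by positivity) (hqpos s hs).ne', Real.log_div hmpos.ne' hL0.ne']
      field_simp
    have h6 := Real.log_le_log hmpos (hms s hs)
    rw [h5, Real.log_pow]
    linarith
  have hall := Finset.sum_le_sum hterm
  simp only [Finset.sum_add_distrib, Finset.sum_sub_distrib, ← Finset.mul_sum, ← Finset.sum_mul,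
    hsumm, Finset.sum_const, nsmul_eq_mul] at hall
  have hfin : (L : ℝ) * (∑ s ∈ T, (m s / L : ℝ) * Real.log ((m s / L : ℝ) / q s)
      + T.card * ((1 + Real.log L) / L))
      = L * ∑ s ∈ T, (m s / L : ℝ) * Real.log ((m s / L : ℝ) / q s)
        + T.card * (1 + Real.log L) := by
    field_simp
  rw [hfin]
  simp only [Finset.mul_sum] at hall ⊢
  linarith

theorem exists_config_card_eq {N L : ℕ} (T : Finset ℕ) (m : ℕ → ℕ) (hL : ∑ s ∈ T, m s = L)
    (hN : ∑ s ∈ T, s * m s = N) :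
    ∃ η : Config N L, (∀ x, η.1 x ∈ T) ∧
      ∀ s ∈ T, (Finset.univ.filter fun x => η.1 x = s).card = m s := by
  classical
  have hcard : Fintype.card (Fin L) = Fintype.card (Σ s : T, Fin (m s)) := by
    rw [Fintype.card_sigma, Fintype.card_fin, ← hL, ← Finset.sum_coe_sort T m]
    simp
  obtain ⟨e⟩ := Fintype.card_eq.1 hcard
  set f : Fin L → ℕ := fun x => ((e x).1 : ℕ) with hf
  have hfT : ∀ x, f x ∈ T := fun x => (e x).1.2
  have hfc : ∀ s ∈ T, (Finset.univ.filter fun x => f x = s).card = m s := by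
    intro s hs
    rw [← Fintype.card_subtype]
    have e2 : {x // f x = s} ≃ Fin (m s) :=
      (e.subtypeEquiv (q := fun y => y.1 = (⟨s, hs⟩ : T)) (fun x => by
        rw [Subtype.ext_iff])).trans
        (Equiv.sigmaSubtype (⟨s, hs⟩ : T))
    rw [Fintype.card_congr e2, Fintype.card_fin]
  refine ⟨⟨f, ?_⟩, hfT, hfc⟩
  rw [← Finset.sum_fiberwise_of_maps_to (s := Finset.univ) (t := T) (g := f) (fun x _ => hfT x),
    ← hN]
  refine Finset.sum_congr rfl fun s hs => ?_
  rw [← hfc s hs, Finset.sum_congr rfl fun x hx => (Finset.mem_filter.1 hx).2, Finset.sum_const,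
    smul_eq_mul, mul_comm]

end CanonicalEnsemble

end

noncomputable section

namespace CanonicalEnsemble

/-! ### The exponential lower bound for finitely supported distributions -/

/-- Neighbourhoods of `c` have unnormalized measure at least `exp (- L (t + o(1)))`. -/
def Reachable (q : ℕ → ℝ≥0) {N L : ℕ → ℕ} {R : ℝ≥0} (hL : ∀ n, 0 < L n)
    (hR : ∀ n, (N n : ℝ≥0) / (L n : ℝ≥0) ≤ R) (c : MomentLE R) (t : ℝ) : Prop :=
  ∀ U ∈ 𝓝 c, ∀ ε > 0, ∀ᶠ n in atTop,
    ENNReal.ofReal (Real.exp (-(L n * (t + ε)))) ≤ unnormalizedLaw q (hL n) (hR n) U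

section Reachable

variable {q : ℕ → ℝ≥0} {N L : ℕ → ℕ} {R : ℝ≥0} {hL : ∀ n, 0 < L n}
  {hR : ∀ n, (N n : ℝ≥0) / (L n : ℝ≥0) ≤ R}

/-- A neighbourhood of c is a neighbourhood of all nearby points, so lower bounds pass to limits.
This reduces the general case to convenient approximations of c, along any nontrivial filter. -/
theorem Reachable.of_tendsto {ι : Type*} {l : Filter ι} [l.NeBot] {u : ι → MomentLE R}
    {c : MomentLE R} {τ : ι → ℝ} {t : ℝ} (hu : Tendsto u l (𝓝 c))
    (hτ : ∀ ε > 0, ∀ᶠ i in l, τ i ≤ t + ε) (h : ∀ᶠ i in l, Reachable q hL hR (u i) (τ i)) :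
    Reachable q hL hR c t := by
  intro U hU ε hε
  obtain ⟨i, hi1, hi2, hi3⟩ := ((hu.eventually (eventually_mem_nhds_iff.2 hU)).and
    ((hτ (ε / 2) (by positivity)).and h)).exists
  filter_upwards [hi3 U hi1 (ε / 2) (by positivity)] with n hn
  refine le_trans (ENNReal.ofReal_le_ofReal (Real.exp_le_exp.2 (neg_le_neg ?_))) hn
  exact mul_le_mul_of_nonneg_left (by linarith) (Nat.cast_nonneg _)

theorem Reachable.mono {c : MomentLE R} {s t : ℝ} (h : Reachable q hL hR c s) (hst : s ≤ t) :
    Reachable q hL hR c t :=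
  Reachable.of_tendsto (l := (atTop : Filter ℕ)) (u := fun _ => c) (τ := fun _ => s)
    tendsto_const_nhds (fun ε hε => Eventually.of_forall fun _ => by linarith)
    (Eventually.of_forall fun _ => h)

end Reachable

/-- Generator of the differences of the support of a weight. -/
theorem exists_bezout (q : ℕ → ℝ≥0) (j : ℕ) :
    ∃ (d : ℤ) (S : Finset ℕ) (b : ℕ → ℤ), (∀ s ∈ S, q s ≠ 0) ∧
      (∑ s ∈ S, b s * ((s : ℤ) - j) = d) ∧ ∀ s, q s ≠ 0 → d ∣ (s : ℤ) - j := by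
  classical
  -- The ideal generated by the differences is principal; writing its generator as a combination of
  -- finitely many differences gives the coefficients.
  set v : ℕ → ℤ := fun s => if q s ≠ 0 then (s : ℤ) - j else 0 with hv
  set I : Ideal ℤ := Ideal.span (Set.range v) with hI
  set d := Submodule.IsPrincipal.generator I with hd
  have hdI : d ∈ I := Submodule.IsPrincipal.generator_mem I
  obtain ⟨c, hc⟩ := (Finsupp.mem_ideal_span_range_iff_exists_finsupp).1 hdI
  refine ⟨d, c.support.filter fun s => q s ≠ 0, c, fun s hs => (Finset.mem_filter.1 hs).2, ?_, ?_⟩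
  · rw [← hc, Finsupp.sum, Finset.sum_filter]
    refine Finset.sum_congr rfl fun s _ => ?_
    by_cases hs : q s ≠ 0 <;> simp [hv, hs]
  · intro s hs
    have h1 : v s ∈ I := Ideal.subset_span ⟨s, rfl⟩
    have h2 := (Submodule.IsPrincipal.mem_iff_generator_dvd I).1 h1
    simpa [hv, hs] using h2

/-- The only arithmetic information extracted from the existence of an admissible configuration; it
makes the rounding defect of the particle number correctable. -/
theorem dvd_sub_of_normalization_ne_zero {q : ℕ → ℝ≥0} {j : ℕ} {d : ℤ}
    (hd : ∀ s, q s ≠ 0 → d ∣ (s : ℤ) - j) {N L : ℕ} (hZ : normalization q N L ≠ 0) :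
    d ∣ (N : ℤ) - L * j := by
  obtain ⟨η, hη⟩ : ∃ η : Config N L, weight q η ≠ 0 := by
    by_contra! hcon
    exact hZ (ENNReal.tsum_eq_zero.2 hcon)
  have hη' : ∀ x, q (η.1 x) ≠ 0 := by
    intro x hx
    exact hη (Finset.prod_eq_zero (Finset.mem_univ x) (by simp [hx]))
  have hsum : (N : ℤ) - L * j = ∑ x, ((η.1 x : ℤ) - j) := by
    rw [Finset.sum_sub_distrib, ← Nat.cast_sum, η.2]
    simp
  rw [hsum]
  exact Finset.dvd_sum fun x _ => hd _ (hη' x)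

/-- Integer occupation numbers with prescribed number of sites and particles that approximate
given frequencies. -/
theorem exists_counts {N L : ℕ → ℕ} (hLpos : ∀ n, 0 < L n) (hL : Tendsto L atTop atTop) {ρ : ℝ}
    (hNL : Tendsto (fun n => (N n : ℝ) / L n) atTop (𝓝 ρ)) (T : Finset ℕ) (a : ℕ → ℝ)
    (ha : ∀ s ∈ T, 0 < a s) (hsum : ∑ s ∈ T, a s = 1) (hmean : ∑ s ∈ T, s * a s = ρ)
    {j : ℕ} (hj : j ∈ T) (d : ℤ) (b : ℕ → ℤ) (hb : ∑ s ∈ T, b s * ((s : ℤ) - j) = d)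
    (hdT : ∀ s ∈ T, d ∣ (s : ℤ) - j) (hdN : ∀ n, d ∣ (N n : ℤ) - L n * j) :
    ∃ m : ℕ → ℕ → ℕ, (∀ s ∈ T, Tendsto (fun n => (m n s : ℝ) / L n) atTop (𝓝 (a s))) ∧
      ∀ᶠ n in atTop, ∑ s ∈ T, m n s = L n ∧ ∑ s ∈ T, s * m n s = N n := by
  classical
  have hLinf : Tendsto (fun n => (L n : ℝ)) atTop atTop := tendsto_natCast_atTop_atTop.comp hL
  have hL0 : ∀ n, (L n : ℝ) ≠ 0 := fun n => by exact_mod_cast (hLpos n).ne'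
  set T' := T.erase j with hT'
  set fl : ℕ → ℕ → ℤ := fun n s => ⌊(L n : ℝ) * a s⌋ with hfl
  have hfllim : ∀ s, Tendsto (fun n => (fl n s : ℝ) / L n) atTop (𝓝 (a s)) := by
    intro s
    have h1 : Tendsto (fun n => a s - 1 / (L n : ℝ)) atTop (𝓝 (a s)) := by
      have := (tendsto_const_nhds (x := a s)).sub (tendsto_const_nhds.div_atTop hLinf (a := (1 : ℝ)))
      simpa using this
    refine tendsto_of_tendsto_of_tendsto_of_le_of_le h1 tendsto_const_nhds (fun n => ?_) fun n => ?_
    · have hpos : (0 : ℝ) < L n := by exact_mod_cast hLpos n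
      have h2 := (Int.sub_one_lt_floor ((L n : ℝ) * a s)).le
      change a s - 1 / (L n : ℝ) ≤ _
      rw [le_div_iff₀ hpos, sub_mul, one_div, inv_mul_cancel₀ hpos.ne']
      linarith
    · have hpos : (0 : ℝ) < L n := by exact_mod_cast hLpos n
      have h2 := Int.floor_le ((L n : ℝ) * a s)
      change _ / (L n : ℝ) ≤ a s
      rw [div_le_iff₀ hpos]
      linarith
  -- The defect of the particle number left by rounding down. It is o(L) because the frequencies
  -- have mean ρ, and it is divisible by d.
  set X : ℕ → ℤ := fun n => (N n : ℤ) - L n * j - ∑ s ∈ T', fl n s * ((s : ℤ) - j) with hX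
  have hdX : ∀ n, d ∣ X n := fun n => dvd_sub (hdN n) (Finset.dvd_sum fun s hs =>
    Dvd.dvd.mul_left (hdT s (Finset.mem_of_mem_erase hs)) _)
  have hT'sum : ∀ f : ℕ → ℝ, ∑ s ∈ T', f s * ((s : ℝ) - j) = ∑ s ∈ T, f s * ((s : ℝ) - j) := by
    intro f
    rw [← Finset.add_sum_erase T _ hj]
    simp [hT']
  have hXlim : Tendsto (fun n => (X n : ℝ) / L n) atTop (𝓝 0) := by
    have h1 : ∀ n, (X n : ℝ) / L n = (N n : ℝ) / L n - j
        - ∑ s ∈ T', (fl n s : ℝ) / L n * ((s : ℝ) - j) := by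
      intro n
      have : ∑ s ∈ T', (fl n s : ℝ) / L n * ((s : ℝ) - j)
          = (∑ s ∈ T', (fl n s : ℝ) * ((s : ℝ) - j)) / L n := by
        rw [Finset.sum_div]
        exact Finset.sum_congr rfl fun s _ => by ring
      rw [this, hX]
      push_cast
      have := hL0 n
      field_simp
    simp only [h1]
    have h2 : ρ - j - ∑ s ∈ T', a s * ((s : ℝ) - j) = 0 := by
      rw [hT'sum]
      simp only [mul_sub, Finset.sum_sub_distrib, ← Finset.sum_mul, hsum]
      rw [← hmean]
      simp [mul_comm]
    rw [← h2]
    exact (hNL.sub tendsto_const_nhds).sub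
      (tendsto_finsetSum _ fun s _ => (hfllim s).mul tendsto_const_nhds)
  set e : ℕ → ℤ := fun n => X n / d with he
  have hXe : ∀ n, X n = d * e n := fun n => (Int.mul_ediv_cancel' (hdX n)).symm
  have helim : Tendsto (fun n => (e n : ℝ) / L n) atTop (𝓝 0) := by
    by_cases hd0 : d = 0
    · simp [he, hd0]
    · have hd0' : (d : ℝ) ≠ 0 := by exact_mod_cast hd0
      have h1 : ∀ n, (e n : ℝ) / L n = (X n : ℝ) / L n / d := by
        intro n
        rw [hXe]
        push_cast
        field_simp
      simp only [h1]
      simpa using hXlim.div_const (d : ℝ)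
  -- Adding e · b(s) sites of size s changes the particle number by e · d = X relative to size j.
  -- The class j then absorbs the number of sites, which does not affect the sum of the differences
  -- s - j. All corrections are o(L), so the counts stay positive.
  set z : ℕ → ℕ → ℤ := fun n s => if s = j then L n - ∑ r ∈ T', (fl n r + e n * b r)
    else fl n s + e n * b s with hz
  have hzT' : ∀ n, ∀ s ∈ T', z n s = fl n s + e n * b s := fun n s hs => by
    simp [hz, Finset.ne_of_mem_erase hs]
  have hzlim' : ∀ s, Tendsto (fun n => ((fl n s + e n * b s : ℤ) : ℝ) / L n) atTop (𝓝 (a s)) := by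
    intro s
    have h1 : ∀ n, ((fl n s + e n * b s : ℤ) : ℝ) / L n = (fl n s : ℝ) / L n
        + (e n : ℝ) / L n * b s := by
      intro n
      push_cast
      ring
    simp only [h1]
    simpa using (hfllim s).add (helim.mul_const (b s : ℝ))
  have hzlim : ∀ s ∈ T, Tendsto (fun n => (z n s : ℝ) / L n) atTop (𝓝 (a s)) := by
    intro s hs
    by_cases hsj : s = j
    · subst hsj
      have h1 : ∀ n, (z n s : ℝ) / L n = 1 - ∑ r ∈ T', ((fl n r + e n * b r : ℤ) : ℝ) / L n := by
        intro n
        have h2 : z n s = L n - ∑ r ∈ T', (fl n r + e n * b r) := by simp [hz]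
        rw [h2, Int.cast_sub, Int.cast_sum, sub_div, Finset.sum_div, Int.cast_natCast,
          div_self (hL0 n)]
      simp only [h1]
      have h3 : a s = 1 - ∑ r ∈ T', a r := by
        rw [← hsum, ← Finset.add_sum_erase T _ hs]
        simp [hT']
      rw [h3]
      exact tendsto_const_nhds.sub (tendsto_finsetSum _ fun r _ => hzlim' r)
    · have h1 : ∀ n, z n s = fl n s + e n * b s := fun n => by simp [hz, hsj]
      simp only [h1]
      exact hzlim' s
  have hpos : ∀ᶠ n in atTop, ∀ s ∈ T, 0 ≤ z n s := by
    refine (Filter.eventually_all_finset T).2 fun s hs => ?_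
    filter_upwards [(hzlim s hs).eventually_const_lt (ha s hs)] with n hn
    have hp : (0 : ℝ) < L n := by exact_mod_cast hLpos n
    have : (0 : ℝ) < z n s := by
      rwa [lt_div_iff₀ hp, zero_mul] at hn
    exact_mod_cast this.le
  refine ⟨fun n s => (z n s).toNat, fun s hs => ?_, ?_⟩
  · refine (hzlim s hs).congr' ?_
    filter_upwards [hpos] with n hn
    congr 1
    exact_mod_cast (Int.toNat_of_nonneg (hn s hs)).symm
  · filter_upwards [hpos] with n hn
    have hs1 : ∑ s ∈ T, z n s = L n := by
      rw [← Finset.add_sum_erase T _ hj, Finset.sum_congr rfl (hzT' n)]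
      simp [hz]
    have hs2 : ∑ s ∈ T, z n s * ((s : ℤ) - j) = (N n : ℤ) - L n * j := by
      have e1 : ∑ s ∈ T, z n s * ((s : ℤ) - j)
          = ∑ s ∈ T', (fl n s * ((s : ℤ) - j) + e n * (b s * ((s : ℤ) - j))) := by
        rw [← Finset.add_sum_erase T _ hj, sub_self, mul_zero, zero_add]
        refine Finset.sum_congr rfl fun s hs => ?_
        rw [hzT' n s hs]
        ring
      have e2 : ∑ s ∈ T', b s * ((s : ℤ) - j) = d := by
        rw [← hb, ← Finset.add_sum_erase T _ hj]
        simp [hT']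
      rw [e1, Finset.sum_add_distrib, ← Finset.mul_sum, e2, mul_comm, ← hXe, hX]
      ring
    constructor
    · zify
      rw [← hs1]
      exact Finset.sum_congr rfl fun s hs => Int.toNat_of_nonneg (hn s hs)
    · zify
      have e3 : ∑ s ∈ T, (s : ℤ) * ((z n s).toNat : ℤ) = ∑ s ∈ T, (s : ℤ) * z n s :=
        Finset.sum_congr rfl fun s hs => by rw [Int.toNat_of_nonneg (hn s hs)]
      rw [e3]
      have e4 : ∑ s ∈ T, (s : ℤ) * z n s = ∑ s ∈ T, z n s * ((s : ℤ) - j) + (∑ s ∈ T, z n s) * j := by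
        rw [Finset.sum_mul, ← Finset.sum_add_distrib]
        exact Finset.sum_congr rfl fun s _ => by ring
      rw [e4, hs1, hs2]
      ring

/-- Integer counts approximating the frequencies give empirical measures converging to c. Their cost
converges to the entropy because all limiting frequencies on T are positive, where the logarithm is
continuous. -/
theorem reachable_of_forall_pos {q : ℕ → ℝ≥0} {N L : ℕ → ℕ} {R : ℝ≥0} (hLpos : ∀ n, 0 < L n)
    (hR : ∀ n, (N n : ℝ≥0) / (L n : ℝ≥0) ≤ R) (hL : Tendsto L atTop atTop) {ρ : ℝ}
    (hNL : Tendsto (fun n => (N n : ℝ) / L n) atTop (𝓝 ρ)) (T : Finset ℕ) (c : MomentLE R)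
    (hc : ∀ s ∈ T, 0 < c.toMeasure.real {s}) (hcT : ∀ s ∉ T, c.toMeasure.real {s} = 0)
    (hq : ∀ s ∈ T, q s ≠ 0)
    (hsum : ∑ s ∈ T, c.toMeasure.real {s} = 1) (hmean : ∑ s ∈ T, s * c.toMeasure.real {s} = ρ)
    {j : ℕ} (hj : j ∈ T) (d : ℤ) (b : ℕ → ℤ) (hb : ∑ s ∈ T, b s * ((s : ℤ) - j) = d)
    (hdT : ∀ s ∈ T, d ∣ (s : ℤ) - j) (hdN : ∀ n, d ∣ (N n : ℤ) - L n * j) :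
    Reachable q hLpos hR c
      (∑ s ∈ T, c.toMeasure.real {s} * Real.log (c.toMeasure.real {s} / q s)) := by
  classical
  set a : ℕ → ℝ := fun s => c.toMeasure.real {s} with ha
  obtain ⟨m, hmlim, hm⟩ := exists_counts hLpos hL hNL T a hc hsum hmean hj d b hb hdT hdN
  have hmpos : ∀ᶠ n in atTop, ∀ s ∈ T, 0 < m n s := by
    refine (Filter.eventually_all_finset T).2 fun s hs => ?_
    filter_upwards [(hmlim s hs).eventually_const_lt (hc s hs)] with n hn
    by_contra! hcon
    have : m n s = 0 := by omega
    simp [this] at hn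
  set cost : ℕ → ℝ := fun n => ∑ s ∈ T, ((m n s : ℝ) / L n) * Real.log (((m n s : ℝ) / L n) / q s)
    + T.card * ((1 + Real.log (L n)) / L n) with hcost
  have hLinf : Tendsto (fun n => (L n : ℝ)) atTop atTop := tendsto_natCast_atTop_atTop.comp hL
  have hcostlim : Tendsto cost atTop (𝓝 (∑ s ∈ T, a s * Real.log (a s / q s))) := by
    have h1 : Tendsto (fun n => (1 + Real.log (L n)) / (L n : ℝ)) atTop (𝓝 0) := by
      have h2 : Tendsto (fun x : ℝ => (1 + Real.log x) / x) atTop (𝓝 0) := by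
        have h3 : Tendsto (fun x : ℝ => Real.log x / x) atTop (𝓝 0) :=
          Real.isLittleO_log_id_atTop.tendsto_div_nhds_zero
        have h4 := (tendsto_inv_atTop_zero (𝕜 := ℝ)).add h3
        simp only [add_zero] at h4
        exact h4.congr fun x => by rw [add_div, one_div]
      exact h2.comp hLinf
    have h2 : Tendsto (fun n => ∑ s ∈ T, ((m n s : ℝ) / L n)
        * Real.log (((m n s : ℝ) / L n) / q s)) atTop (𝓝 (∑ s ∈ T, a s * Real.log (a s / q s))) := by
      refine tendsto_finsetSum _ fun s hs => ?_
      have hqs : (q s : ℝ) ≠ 0 := by exact_mod_cast hq s hs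
      exact (hmlim s hs).mul (((hmlim s hs).div_const _).log (div_ne_zero (hc s hs).ne' hqs))
    simpa using h2.add (h1.const_mul (T.card : ℝ))
  have hex : ∀ᶠ n in atTop, ∃ x : MomentLE R,
      (∀ s ∈ T, x.toMeasure {s} = ENNReal.ofReal ((m n s : ℝ) / L n)) ∧
      (∀ s ∉ T, x.toMeasure {s} = 0) ∧
      ∀ U : Set (MomentLE R), x ∈ U →
        ENNReal.ofReal (Real.exp (-(L n * cost n))) ≤ unnormalizedLaw q (hLpos n) (hR n) U := by
    filter_upwards [hm, hmpos] with n hn hn0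
    obtain ⟨η, hηT, hηc⟩ := exists_config_card_eq T (m n) hn.1 hn.2
    have hx : ∀ s, (clusterMap (hLpos n) (hR n) η).toMeasure {s}
        = (L n : ℝ≥0∞)⁻¹ * (Finset.univ.filter fun x => η.1 x = s).card := empirical_singleton η
    refine ⟨clusterMap (hLpos n) (hR n) η, fun s hs => ?_, fun s hs => ?_, fun U hU => ?_⟩
    · have hp : (0 : ℝ) < L n := by exact_mod_cast hLpos n
      rw [hx, hηc s hs, ENNReal.ofReal_div_of_pos hp, ENNReal.ofReal_natCast,
        ENNReal.ofReal_natCast, ENNReal.div_eq_inv_mul]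
    · rw [hx]
      have : (Finset.univ.filter fun x => η.1 x = s) = ∅ := by
        refine Finset.filter_eq_empty_iff.2 fun x _ hxs => hs (hxs ▸ hηT x)
      simp [this]
    · exact exp_le_unnormalizedLaw (hLpos n) (hR n) q η T hηT hq (m n) hηc hn0 hU
  have : Nonempty (MomentLE R) := ⟨c⟩
  obtain ⟨u, hu⟩ := hex.choice
  have hulim : Tendsto u atTop (𝓝 c) := by
    refine MomentLE.tendsto_of_forall_singleton fun s => ?_
    by_cases hs : s ∈ T
    · have h1 : Tendsto (fun n => ENNReal.ofReal ((m n s : ℝ) / L n)) atTop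
          (𝓝 (c.toMeasure {s})) := by
        rw [← ofReal_measureReal]
        exact (ENNReal.continuous_ofReal.tendsto _).comp (hmlim s hs)
      exact h1.congr' (hu.mono fun n hn => (hn.1 s hs).symm)
    · have h1 : c.toMeasure {s} = 0 := (measureReal_eq_zero_iff).1 (hcT s hs)
      rw [h1]
      exact tendsto_const_nhds.congr' (hu.mono fun n hn => (hn.2.1 s hs).symm)
  intro U hU ε hε
  filter_upwards [hu, hulim hU, hcostlim.eventually_lt_const
    (show ∑ s ∈ T, a s * Real.log (a s / q s) < ∑ s ∈ T, a s * Real.log (a s / q s) + ε by linarith)]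
    with n hn hnU hnc
  refine le_trans (ENNReal.ofReal_le_ofReal (Real.exp_le_exp.2 (neg_le_neg ?_))) (hn.2.2 U hnU)
  exact mul_le_mul_of_nonneg_left hnc.le (Nat.cast_nonneg _)

end CanonicalEnsemble

end

noncomputable section

namespace CanonicalEnsemble

/-! ### The exponential lower bound in general -/

/-- The finitely supported distribution with given weights. -/
theorem MomentLE.exists_real_singleton_eq {R : ℝ≥0} (T : Finset ℕ) (a : ℕ → ℝ)
    (ha : ∀ s, 0 ≤ a s) (haT : ∀ s ∉ T, a s = 0) (hsum : ∑ s ∈ T, a s = 1)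
    (hmean : ∑ s ∈ T, s * a s ≤ R) :
    ∃ c : MomentLE R, ∀ s, c.toMeasure.real {s} = a s := by
  classical
  set μ : Measure ℕ := ∑ s ∈ T, ENNReal.ofReal (a s) • Measure.dirac s with hμ
  have hprob : IsProbabilityMeasure μ := by
    constructor
    rw [hμ]
    simp only [Measure.finsetSum_apply, Measure.smul_apply, measure_univ, smul_eq_mul, mul_one]
    rw [← ENNReal.ofReal_sum_of_nonneg fun s _ => ha s, hsum, ENNReal.ofReal_one]
  have hmom : firstMoment μ ≤ R := by
    rw [firstMoment, hμ, lintegral_finsetSum_measure]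
    simp only [lintegral_smul_measure, lintegral_dirac, smul_eq_mul]
    have : ∀ s ∈ T, ENNReal.ofReal (a s) * (s : ℝ≥0∞) = ENNReal.ofReal (s * a s) := fun s _ => by
      rw [mul_comm, ENNReal.ofReal_mul (Nat.cast_nonneg _), ENNReal.ofReal_natCast]
    rw [Finset.sum_congr rfl this, ← ENNReal.ofReal_sum_of_nonneg fun s _ =>
      mul_nonneg (Nat.cast_nonneg _) (ha s), ← ENNReal.ofReal_coe_nnreal]
    exact ENNReal.ofReal_le_ofReal hmean
  refine ⟨⟨⟨μ, hprob⟩, hmom⟩, fun s => ?_⟩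
  change μ.real {s} = a s
  rw [Measure.real, hμ]
  simp only [Measure.finsetSum_apply, Measure.smul_apply, smul_eq_mul]
  have hd : ∀ r ∈ T, ENNReal.ofReal (a r) * Measure.dirac r {s}
      = if r = s then ENNReal.ofReal (a s) else 0 := by
    intro r _
    rw [Measure.dirac_apply' _ (MeasurableSet.singleton s)]
    by_cases h : r = s <;> simp [h]
  rw [Finset.sum_congr rfl hd, Finset.sum_ite_eq']
  split_ifs with hs
  · rw [ENNReal.toReal_ofReal (ha s)]
  · rw [haT s hs]; rfl

theorem MomentLE.tendsto_of_forall_real_singleton {ι : Type*} {l : Filter ι}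
    [l.IsCountablyGenerated] {R : ℝ≥0} {u : ι → MomentLE R} {c : MomentLE R}
    (h : ∀ k, Tendsto (fun i => (u i).toMeasure.real {k}) l (𝓝 (c.toMeasure.real {k}))) :
    Tendsto u l (𝓝 c) := by
  refine MomentLE.tendsto_of_forall_singleton fun k => ?_
  have := (ENNReal.continuous_ofReal.tendsto _).comp (h k)
  have e : ∀ d : MomentLE R, ENNReal.ofReal (d.toMeasure.real {k}) = d.toMeasure {k} :=
    fun d => ofReal_measureReal
  simpa only [Function.comp_def, e] using this

theorem convex_mul_log_div {q x y ε : ℝ} (hq : 0 < q) (hx : 0 ≤ x) (hy : 0 ≤ y) (h0 : 0 ≤ ε)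
    (h1 : ε ≤ 1) :
    ((1 - ε) * x + ε * y) * Real.log (((1 - ε) * x + ε * y) / q)
      ≤ (1 - ε) * (x * Real.log (x / q)) + ε * (y * Real.log (y / q)) := by
  have key := Real.convexOn_mul_log.2 (show x / q ∈ Set.Ici (0 : ℝ) by
    exact div_nonneg hx hq.le) (show y / q ∈ Set.Ici (0 : ℝ) by exact div_nonneg hy hq.le)
    (show 0 ≤ 1 - ε by linarith) h0 (by ring)
  simp only [smul_eq_mul] at key
  have h2 : (1 - ε) * (x / q) + ε * (y / q) = ((1 - ε) * x + ε * y) / q := by ring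
  rw [h2] at key
  have := mul_le_mul_of_nonneg_left key hq.le
  have e1 : q * (((1 - ε) * x + ε * y) / q * Real.log (((1 - ε) * x + ε * y) / q))
      = ((1 - ε) * x + ε * y) * Real.log (((1 - ε) * x + ε * y) / q) := by
    field_simp
  have e2 : q * ((1 - ε) * (x / q * Real.log (x / q)) + ε * (y / q * Real.log (y / q)))
      = (1 - ε) * (x * Real.log (x / q)) + ε * (y * Real.log (y / q)) := by
    field_simp
  rwa [e1, e2] at this

/-- The uniform distribution on S is mixed with a point mass at j or at k, according to the side of
ρ on which its mean lies. -/
theorem exists_pos_weights (S : Finset ℕ) {j k : ℕ} {ρ : ℝ} (hj : j ∈ S) (hk : k ∈ S)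
    (hjρ : (j : ℝ) < ρ) (hkρ : ρ < k) :
    ∃ b : ℕ → ℝ, (∀ s ∈ S, 0 < b s) ∧ (∀ s ∉ S, b s = 0) ∧ ∑ s ∈ S, b s = 1 ∧
      ∑ s ∈ S, s * b s = ρ := by
  classical
  have hcard : (0 : ℝ) < S.card := by exact_mod_cast Finset.card_pos.2 ⟨j, hj⟩
  set μ : ℝ := ∑ s ∈ S, (s : ℝ) * (S.card : ℝ)⁻¹ with hμ
  have key : ∀ i ∈ S, ∀ x : ℝ, 0 ≤ x → x < 1 → (1 - x) * μ + x * i = ρ →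
      ∃ b : ℕ → ℝ, (∀ s ∈ S, 0 < b s) ∧ (∀ s ∉ S, b s = 0) ∧ ∑ s ∈ S, b s = 1 ∧
      ∑ s ∈ S, s * b s = ρ := by
    intro i hi x hx0 hx1 hx
    refine ⟨fun s => if s ∈ S then (1 - x) * (S.card : ℝ)⁻¹ + x * (if s = i then 1 else 0) else 0,
      fun s hs => ?_, fun s hs => by simp [hs], ?_, ?_⟩
    · simp only [hs, if_true]
      have h1 : 0 < (1 - x) * (S.card : ℝ)⁻¹ := mul_pos (by linarith) (inv_pos.2 hcard)
      have h2 : 0 ≤ x * (if s = i then (1 : ℝ) else 0) := mul_nonneg hx0 (by split_ifs <;> simp)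
      linarith
    · rw [Finset.sum_congr rfl fun s hs => if_pos hs, Finset.sum_add_distrib, ← Finset.mul_sum,
        ← Finset.mul_sum, Finset.sum_const, nsmul_eq_mul, mul_inv_cancel₀ hcard.ne',
        Finset.sum_ite_eq', if_pos hi]
      ring
    · have : ∀ s ∈ S, (s : ℝ) * (if s ∈ S then (1 - x) * (S.card : ℝ)⁻¹
          + x * (if s = i then 1 else 0) else 0)
          = (1 - x) * (s * (S.card : ℝ)⁻¹) + x * (if s = i then (i : ℝ) else 0) := by
        intro s hs
        rw [if_pos hs]
        split_ifs with h
        · rw [h]; ring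
        · ring
      rw [Finset.sum_congr rfl this, Finset.sum_add_distrib, ← Finset.mul_sum, ← Finset.mul_sum,
        Finset.sum_ite_eq', if_pos hi, ← hμ, hx]
  rcases le_or_gt μ ρ with h | h
  · have hkμ : 0 < k - μ := by linarith
    refine key k hk ((ρ - μ) / (k - μ)) (div_nonneg (by linarith) hkμ.le)
      ((div_lt_one hkμ).2 (by linarith)) ?_
    field_simp
    ring
  · have hjμ : 0 < μ - j := by linarith
    refine key j hj ((μ - ρ) / (μ - j)) (div_nonneg (by linarith) hjμ.le)
      ((div_lt_one hjμ).2 (by linarith)) ?_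
    field_simp
    ring

section

variable {q : ℕ → ℝ≥0} {N L : ℕ → ℕ} {R : ℝ≥0} (hLpos : ∀ n, 0 < L n)
  (hR : ∀ n, (N n : ℝ≥0) / (L n : ℝ≥0) ≤ R) (hL : Tendsto L atTop atTop) {ρ : ℝ} (hρR : ρ ≤ R)
  (hNL : Tendsto (fun n => (N n : ℝ) / L n) atTop (𝓝 ρ))
  (hZ : ∀ n, normalization q (N n) (L n) ≠ 0) {j k : ℕ} (hqj : q j ≠ 0) (hqk : q k ≠ 0)
  (hj : (j : ℝ) < ρ) (hk : ρ < k)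

include hL hρR hNL hZ hqj hqk hj hk

/-- The support is enlarged by j, k and the sizes in the Bezout relation, and c is mixed with a
strictly positive distribution of the same mean ρ. Convexity bounds the entropy of the mixture,
whose extra weight then tends to zero. -/
theorem reachable_of_mean_eq (T : Finset ℕ) (c : MomentLE R)
    (hcT : ∀ s ∉ T, c.toMeasure.real {s} = 0) (hq : ∀ s ∈ T, q s ≠ 0)
    (hsum : ∑ s ∈ T, c.toMeasure.real {s} = 1) (hmean : ∑ s ∈ T, s * c.toMeasure.real {s} = ρ) :
    Reachable q hLpos hR c
      (∑ s ∈ T, c.toMeasure.real {s} * Real.log (c.toMeasure.real {s} / q s)) := by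
  classical
  obtain ⟨d, S₀, b₀, hS₀, hb₀, hd⟩ := exists_bezout q j
  set S : Finset ℕ := insert j (insert k (T ∪ S₀)) with hS
  have hTS : T ⊆ S := fun s hs => by simp [hS, hs]
  have hS₀S : S₀ ⊆ S := fun s hs => by simp [hS, hs]
  have hjS : j ∈ S := by simp [hS]
  have hkS : k ∈ S := by simp [hS]
  have hqS : ∀ s ∈ S, q s ≠ 0 := by
    intro s hs
    simp only [hS, Finset.mem_insert, Finset.mem_union] at hs
    rcases hs with rfl | rfl | hs | hs
    · exact hqj
    · exact hqk
    · exact hq s hs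
    · exact hS₀ s hs
  have hqpos : ∀ s ∈ S, (0 : ℝ) < q s := fun s hs =>
    NNReal.coe_pos.2 (pos_iff_ne_zero.2 (hqS s hs))
  obtain ⟨p, hp0, hpS, hp1, hpm⟩ := exists_pos_weights S hjS hkS hj hk
  have hbS : ∑ s ∈ S, (if s ∈ S₀ then b₀ s else 0) * ((s : ℤ) - j) = d := by
    rw [← hb₀, ← Finset.sum_subset hS₀S]
    · exact Finset.sum_congr rfl fun s hs => by rw [if_pos hs]
    · intro s _ hs
      rw [if_neg hs, zero_mul]
  set a : ℕ → ℝ := fun s => c.toMeasure.real {s} with ha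
  have ha0 : ∀ s, 0 ≤ a s := fun s => measureReal_nonneg
  have hext : ∀ f : ℕ → ℝ → ℝ, (∀ s, f s 0 = 0) → ∑ s ∈ S, f s (a s) = ∑ s ∈ T, f s (a s) := by
    intro f hf
    refine (Finset.sum_subset hTS fun s _ hs => ?_).symm
    rw [show a s = 0 from hcT s hs, hf]
  have haS1 : ∑ s ∈ S, a s = 1 := (hext (fun _ x => x) (fun _ => rfl)).trans hsum
  have haSm : ∑ s ∈ S, s * a s = ρ := (hext (fun s x => s * x) (fun _ => mul_zero _)).trans hmean
  have haSE := hext (fun s x => x * Real.log (x / q s)) (fun _ => by simp)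
  set e : ℕ → ℝ := fun i => 1 / ((i : ℝ) + 1) with he
  have he0 : ∀ i, 0 < e i := fun i => by rw [he]; positivity
  have he1 : ∀ i, e i ≤ 1 := fun i => by
    rw [he]
    exact (div_le_one (by positivity)).2 (by linarith [(Nat.cast_nonneg i : (0 : ℝ) ≤ i)])
  have helim : Tendsto e atTop (𝓝 0) := tendsto_one_div_add_atTop_nhds_zero_nat
  have hmixpos : ∀ i, ∀ s ∈ S, 0 < (1 - e i) * a s + e i * p s := fun i s hs =>
    add_pos_of_nonneg_of_pos (mul_nonneg (by linarith [he1 i]) (ha0 s)) (mul_pos (he0 i) (hp0 s hs))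
  have hmix0 : ∀ i, ∀ s ∉ S, (1 - e i) * a s + e i * p s = 0 := fun i s hs => by
    rw [hpS s hs, show a s = 0 from hcT s fun h => hs (hTS h)]; ring
  have hmix1 : ∀ i, ∑ s ∈ S, ((1 - e i) * a s + e i * p s) = 1 := fun i => by
    rw [Finset.sum_add_distrib, ← Finset.mul_sum, ← Finset.mul_sum, haS1, hp1]; ring
  have hmixm : ∀ i, ∑ s ∈ S, (s : ℝ) * ((1 - e i) * a s + e i * p s) = ρ := fun i => by
    have : ∀ s ∈ S, (s : ℝ) * ((1 - e i) * a s + e i * p s)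
        = (1 - e i) * (s * a s) + e i * (s * p s) := fun s _ => by ring
    rw [Finset.sum_congr rfl this, Finset.sum_add_distrib, ← Finset.mul_sum, ← Finset.mul_sum,
      haSm, hpm]
    ring
  have hex : ∀ i, ∃ c' : MomentLE R, ∀ s, c'.toMeasure.real {s} = (1 - e i) * a s + e i * p s := by
    intro i
    refine MomentLE.exists_real_singleton_eq S _ (fun s => ?_) (hmix0 i) (hmix1 i)
      ((hmixm i).trans_le hρR)
    by_cases hs : s ∈ S
    · exact (hmixpos i s hs).le
    · exact (hmix0 i s hs).ge
  choose u hu using hex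
  refine Reachable.of_tendsto (l := atTop) (u := u)
    (τ := fun i => ∑ s ∈ S, (u i).toMeasure.real {s} * Real.log ((u i).toMeasure.real {s} / q s))
    ?_ ?_ (Eventually.of_forall fun i => ?_)
  · refine MomentLE.tendsto_of_forall_real_singleton fun s => ?_
    simp only [hu]
    have h1 := ((tendsto_const_nhds (x := (1 : ℝ))).sub helim).mul_const (a s)
    have h2 := helim.mul_const (p s)
    simpa using h1.add h2
  · intro ε hε
    set E := ∑ s ∈ T, a s * Real.log (a s / q s)
    set E' := ∑ s ∈ S, p s * Real.log (p s / q s)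
    have hle : ∀ i, ∑ s ∈ S, (u i).toMeasure.real {s} * Real.log ((u i).toMeasure.real {s} / q s)
        ≤ (1 - e i) * E + e i * E' := by
      intro i
      rw [← haSE, Finset.mul_sum, Finset.mul_sum, ← Finset.sum_add_distrib]
      refine Finset.sum_le_sum fun s hs => ?_
      rw [hu]
      exact convex_mul_log_div (hqpos s hs) (ha0 s) (hp0 s hs).le (he0 i).le (he1 i)
    have hlim : Tendsto (fun i => (1 - e i) * E + e i * E') atTop (𝓝 E) := by
      have h1 := ((tendsto_const_nhds (x := (1 : ℝ))).sub helim).mul_const E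
      simpa using h1.add (helim.mul_const E')
    filter_upwards [hlim.eventually_lt_const (show E < E + ε by linarith)] with i hi
    exact (hle i).trans hi.le
  · refine reachable_of_forall_pos hLpos hR hL hNL S (u i) (fun s hs => ?_) (fun s hs => ?_) hqS ?_
      ?_ hjS d _ hbS (fun s hs => hd s (hqS s hs))
      (fun n => dvd_sub_of_normalization_ne_zero hd (hZ n))
    · rw [hu]; exact hmixpos i s hs
    · rw [hu]; exact hmix0 i s hs
    · simp only [hu]; exact hmix1 i
    · simp only [hu]; exact hmixm i

/-- A deficit of mass may be compensated by occupied sites of size `m`. -/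
theorem exists_reachable_mix (T : Finset ℕ) (a : ℕ → ℝ) (ha : ∀ s, 0 ≤ a s)
    (haT : ∀ s ∉ T, a s = 0) (hq : ∀ s ∈ T, q s ≠ 0) (hsum : ∑ s ∈ T, a s = 1)
    (hmean : ∑ s ∈ T, s * a s ≤ ρ) {m : ℕ} (hm : ρ < m) (hqm : q m ≠ 0) {x : ℝ}
    (hx : x = (ρ - ∑ s ∈ T, s * a s) / (m - ∑ s ∈ T, s * a s)) :
    ∃ c : MomentLE R, (∀ s, c.toMeasure.real {s} = (1 - x) * a s + x * (if s = m then 1 else 0)) ∧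
      Reachable q hLpos hR c
        ((1 - x) * ∑ s ∈ T, a s * Real.log (a s / q s) + x * (-Real.log (q m))) := by
  classical
  set μ : ℝ := ∑ s ∈ T, s * a s with hμ
  have hmμ : 0 < m - μ := by linarith
  have hx0 : 0 ≤ x := by rw [hx]; exact div_nonneg (by linarith) hmμ.le
  have hx1 : x ≤ 1 := by rw [hx]; exact (div_le_one hmμ).2 (by linarith)
  have hxm : (1 - x) * μ + x * m = ρ := by rw [hx]; field_simp; ring
  set S : Finset ℕ := insert m T with hS
  have hTS : T ⊆ S := Finset.subset_insert _ _
  have hmS : m ∈ S := Finset.mem_insert_self _ _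
  have hqS : ∀ s ∈ S, q s ≠ 0 := by
    intro s hs
    rcases Finset.mem_insert.1 hs with rfl | hs
    · exact hqm
    · exact hq s hs
  have hqpos : ∀ s ∈ S, (0 : ℝ) < q s := fun s hs =>
    NNReal.coe_pos.2 (pos_iff_ne_zero.2 (hqS s hs))
  have hext : ∀ f : ℕ → ℝ → ℝ, (∀ s, f s 0 = 0) → ∑ s ∈ S, f s (a s) = ∑ s ∈ T, f s (a s) := by
    intro f hf
    refine (Finset.sum_subset hTS fun s _ hs => ?_).symm
    rw [haT s hs, hf]
  have haS1 : ∑ s ∈ S, a s = 1 := (hext (fun _ x => x) (fun _ => rfl)).trans hsum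
  have haSm : ∑ s ∈ S, s * a s = μ := hext (fun s x => s * x) (fun _ => mul_zero _)
  have haSE := hext (fun s x => x * Real.log (x / q s)) (fun _ => by simp)
  set v : ℕ → ℝ := fun s => (1 - x) * a s + x * (if s = m then 1 else 0) with hv
  have hv0 : ∀ s, 0 ≤ v s := fun s => add_nonneg (mul_nonneg (by linarith) (ha s))
    (mul_nonneg hx0 (by split_ifs <;> simp))
  have hvS : ∀ s ∉ S, v s = 0 := fun s hs => by
    have h1 : s ≠ m := fun h => hs (h ▸ hmS)
    simp [hv, haT s fun h => hs (hTS h), h1]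
  have hv1 : ∑ s ∈ S, v s = 1 := by
    rw [hv, Finset.sum_add_distrib, ← Finset.mul_sum, ← Finset.mul_sum, haS1,
      Finset.sum_ite_eq', if_pos hmS]
    ring
  have hvm : ∑ s ∈ S, s * v s = ρ := by
    have : ∀ s ∈ S, (s : ℝ) * v s = (1 - x) * (s * a s) + x * (if s = m then (m : ℝ) else 0) := by
      intro s _
      simp only [hv]
      split_ifs with h
      · rw [h]; ring
      · ring
    rw [Finset.sum_congr rfl this, Finset.sum_add_distrib, ← Finset.mul_sum, ← Finset.mul_sum,
      haSm, Finset.sum_ite_eq', if_pos hmS, hxm]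
  obtain ⟨c, hc⟩ := MomentLE.exists_real_singleton_eq (R := R) S v hv0 hvS hv1 (hvm.trans_le hρR)
  refine ⟨c, hc, ?_⟩
  have hreach := reachable_of_mean_eq hLpos hR hL hρR hNL hZ hqj hqk hj hk S c
    (fun s hs => by rw [hc, hvS s hs]) hqS (by simp only [hc]; exact hv1)
    (by simp only [hc]; exact hvm)
  refine hreach.mono ?_
  -- The entropy of the point mass at m, so that convexity splits the cost of the mixture as
  -- claimed.
  have h1 : ∑ s ∈ S, (if s = m then (1 : ℝ) else 0) * Real.log ((if s = m then (1 : ℝ) else 0) / q s)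
      = -Real.log (q m) := by
    have : ∀ s ∈ S, (if s = m then (1 : ℝ) else 0) * Real.log ((if s = m then (1 : ℝ) else 0) / q s)
        = if s = m then -Real.log (q m) else 0 := by
      intro s _
      split_ifs with h
      · rw [h, one_mul, one_div, Real.log_inv]
      · simp
    rw [Finset.sum_congr rfl this, Finset.sum_ite_eq', if_pos hmS]
  rw [← haSE, ← h1, Finset.mul_sum, Finset.mul_sum, ← Finset.sum_add_distrib]
  refine Finset.sum_le_sum fun s hs => ?_
  rw [hc]
  exact convex_mul_log_div (hqpos s hs) (ha s) (by split_ifs <;> simp) hx0 hx1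

/-- Compensation of a deficit of mass by very large sites. -/
theorem reachable_of_mean_le (T : Finset ℕ) (c : MomentLE R)
    (hcT : ∀ s ∉ T, c.toMeasure.real {s} = 0) (hq : ∀ s ∈ T, q s ≠ 0)
    (hsum : ∑ s ∈ T, c.toMeasure.real {s} = 1) (hmean : ∑ s ∈ T, s * c.toMeasure.real {s} ≤ ρ)
    {lam : ℝ} (hlam : ∀ θ > lam, ∃ᶠ m : ℕ in atTop, Real.exp (-(θ * m)) ≤ q m) :
    Reachable q hLpos hR c
      (∑ s ∈ T, c.toMeasure.real {s} * Real.log (c.toMeasure.real {s} / q s)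
        + lam * (ρ - ∑ s ∈ T, s * c.toMeasure.real {s})) := by
  classical
  set a : ℕ → ℝ := fun s => c.toMeasure.real {s} with ha
  set μ : ℝ := ∑ s ∈ T, s * a s with hμ
  set E : ℝ := ∑ s ∈ T, a s * Real.log (a s / q s) with hE
  have hθ : ∀ θ > lam, Reachable q hLpos hR c (E + θ * (ρ - μ)) := by
    intro θ hθ
    -- The compensating size m runs through the infinitely many sizes with `q m` at least exp(-θm).
    -- A fraction x of such sites restores the mean; x tends to 0 while x · m tends to the deficit,
    -- so c is unchanged in the limit and the cost is θ per unit of missing mass.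
    set l : Filter ℕ := atTop ⊓ 𝓟 {m : ℕ | Real.exp (-(θ * m)) ≤ q m} with hl
    have hne : l.NeBot := Filter.frequently_iff_neBot.1 (hlam θ hθ)
    have hlat : l ≤ atTop := inf_le_left
    set x : ℕ → ℝ := fun m => (ρ - μ) / (m - μ) with hx
    have hsubinf : Tendsto (fun m : ℕ => (m : ℝ) - μ) atTop atTop :=
      tendsto_atTop_add_const_right _ _ tendsto_natCast_atTop_atTop
    have hxlim : Tendsto x l (𝓝 0) := (tendsto_const_nhds.div_atTop hsubinf).mono_left hlat
    have hxmlim : Tendsto (fun m : ℕ => x m * m) l (𝓝 (ρ - μ)) := by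
      have h1 : Tendsto (fun m : ℕ => (ρ - μ) + x m * μ) l (𝓝 (ρ - μ)) := by
        simpa using tendsto_const_nhds.add (hxlim.mul_const μ)
      refine h1.congr' ?_
      have h2 : ∀ᶠ m : ℕ in l, 0 < (m : ℝ) - μ := hlat (hsubinf.eventually_gt_atTop 0)
      filter_upwards [h2] with m hm
      rw [hx]
      field_simp
      ring
    have hex : ∀ᶠ m : ℕ in l, ∃ c' : MomentLE R,
        (∀ s, c'.toMeasure.real {s} = (1 - x m) * a s + x m * (if s = m then 1 else 0)) ∧
        Reachable q hLpos hR c' ((1 - x m) * E + x m * (-Real.log (q m))) := by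
      have h1 : ∀ᶠ m : ℕ in l, Real.exp (-(θ * m)) ≤ q m :=
        mem_inf_of_right (mem_principal_self _)
      have h2 : ∀ᶠ m : ℕ in l, ρ < m :=
        hlat (tendsto_natCast_atTop_atTop.eventually_gt_atTop ρ)
      filter_upwards [h1, h2] with m hm1 hm2
      have hqm : q m ≠ 0 := by
        have : (0 : ℝ) < q m := (Real.exp_pos _).trans_le hm1
        exact (NNReal.coe_pos.1 this).ne'
      exact exists_reachable_mix hLpos hR hL hρR hNL hZ hqj hqk hj hk T a
        (fun s => measureReal_nonneg) hcT hq hsum hmean hm2 hqm rfl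
    have : Nonempty (MomentLE R) := ⟨c⟩
    obtain ⟨u, hu⟩ := hex.choice
    refine Reachable.of_tendsto (l := l) (u := u) (τ := fun m => (1 - x m) * E
      + x m * (-Real.log (q m))) ?_ ?_ (hu.mono fun m hm => hm.2)
    · refine MomentLE.tendsto_of_forall_real_singleton fun s => ?_
      have h1 : Tendsto (fun m => (1 - x m) * a s + x m * (if s = m then 1 else 0)) l
          (𝓝 (a s)) := by
        have h2 : ∀ᶠ m : ℕ in l, (1 - x m) * a s = (1 - x m) * a s
            + x m * (if s = m then 1 else 0) := by
          filter_upwards [hlat (eventually_gt_atTop s)] with m hm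
          rw [if_neg hm.ne, mul_zero, add_zero]
        refine Tendsto.congr' h2 ?_
        simpa using ((tendsto_const_nhds (x := (1 : ℝ))).sub hxlim).mul_const (a s)
      exact h1.congr' (hu.mono fun m hm => (hm.1 s).symm)
    · intro ε hε
      have hlim : Tendsto (fun m : ℕ => (1 - x m) * E + x m * m * θ) l
          (𝓝 (E + (ρ - μ) * θ)) := by
        have h1 := ((tendsto_const_nhds (x := (1 : ℝ))).sub hxlim).mul_const E
        simpa using h1.add (hxmlim.mul_const θ)
      have h1 : ∀ᶠ m : ℕ in l, Real.exp (-(θ * m)) ≤ q m :=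
        mem_inf_of_right (mem_principal_self _)
      have h2 : ∀ᶠ m : ℕ in l, 0 < (m : ℝ) - μ := hlat (hsubinf.eventually_gt_atTop 0)
      filter_upwards [hlim.eventually_lt_const (show E + (ρ - μ) * θ < E + (ρ - μ) * θ + ε by
        linarith), h1, h2] with m hm hm1 hm2
      have hx0 : 0 ≤ x m := div_nonneg (by linarith) hm2.le
      have h3 := Real.log_le_log (Real.exp_pos _) hm1
      rw [Real.log_exp] at h3
      have h4 := mul_le_mul_of_nonneg_left (show -Real.log (q m) ≤ θ * m by linarith) hx0
      linarith
  -- Finally θ decreases to lam.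
  refine Reachable.of_tendsto (l := 𝓝[>] lam) (u := fun _ => c)
    (τ := fun θ => E + θ * (ρ - μ)) tendsto_const_nhds ?_
    (eventually_mem_nhdsWithin.mono fun θ h => hθ θ h)
  intro ε hε
  have hlim : Tendsto (fun θ : ℝ => E + θ * (ρ - μ)) (𝓝[>] lam) (𝓝 (E + lam * (ρ - μ))) := by
    have : Continuous fun θ : ℝ => E + θ * (ρ - μ) := by fun_prop
    exact (this.tendsto lam).mono_left nhdsWithin_le_nhds
  exact (hlim.eventually_lt_const (show _ < E + lam * (ρ - μ) + ε by linarith)).mono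
    fun θ h => h.le

end

end CanonicalEnsemble

end

/-! ### Truncation and the lower bound for the full rate function -/

noncomputable section

namespace CanonicalEnsemble

theorem hasSum_mul_real_singleton (c : Measure ℕ) [IsFiniteMeasure c] (hc : firstMoment c ≠ ∞) :
    HasSum (fun k : ℕ => (k : ℝ) * c.real {k}) (firstMoment c).toReal := by
  have h1 : ∀ k : ℕ, ((k : ℝ≥0∞) * c {k}).toReal = (k : ℝ) * c.real {k} := fun k => by
    simp [Measure.real]
  have h2 : Summable fun k : ℕ => ((k : ℝ≥0∞) * c {k}).toReal :=
    ENNReal.summable_toReal (by rwa [← firstMoment_eq_tsum])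
  have h3 : ∑' k : ℕ, ((k : ℝ≥0∞) * c {k}).toReal = (firstMoment c).toReal := by
    rw [firstMoment_eq_tsum, ENNReal.tsum_toReal_eq fun k => by finiteness]
  rw [← h3]
  simpa only [h1] using h2.hasSum

/-- The terms c log(c/ν) may be negative, so their partial sums are compared through the nonnegative
terms c log(c/ν) + ν - c; the mass of ν outside s is the price. -/
theorem sum_mul_log_le_klDiv (c ν : Measure ℕ) [IsProbabilityMeasure c] [IsProbabilityMeasure ν]
    (hac : c ≪ ν) (hkl : klDiv c ν ≠ ∞) (s : Finset ℕ) :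
    ∑ k ∈ s, c.real {k} * Real.log (c.real {k} / ν.real {k})
      ≤ (klDiv c ν).toReal + (1 - ∑ k ∈ s, ν.real {k}) := by
  have h1 : ENNReal.ofReal (∑ k ∈ s, (c.real {k} * Real.log (c.real {k} / ν.real {k}) + ν.real {k}
      - c.real {k})) ≤ klDiv c ν := by
    rw [klDiv_nat_eq_tsum c ν hac]
    refine le_trans ?_ (ENNReal.sum_le_tsum s)
    exact ENNReal.le_of_forall_pos_le_add fun _ _ _ =>
      le_add_right (Finset.le_sum_of_subadditive _ ENNReal.ofReal_zero.le
        (fun _ _ => ENNReal.ofReal_add_le) _ _)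
  have h2 := (ENNReal.ofReal_le_iff_le_toReal hkl).1 h1
  rw [Finset.sum_sub_distrib, Finset.sum_add_distrib] at h2
  have h3 := sum_real_singleton_le_one c s
  linarith

/-- Truncation of a distribution of finite entropy and finite first moment. -/
theorem exists_truncation (c ν : Measure ℕ) [IsProbabilityMeasure c] [IsProbabilityMeasure ν]
    (hac : c ≪ ν) (hkl : klDiv c ν ≠ ∞) (hmom : firstMoment c ≠ ∞) :
    ∃ (T : ℕ → Finset ℕ) (a : ℕ → ℕ → ℝ) (τ : ℕ → ℝ),
      (∀ᶠ K in atTop, (∀ s ∈ T K, ν.real {s} ≠ 0) ∧ (∀ s, 0 ≤ a K s) ∧ (∀ s ∉ T K, a K s = 0) ∧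
        ∑ s ∈ T K, a K s = 1 ∧ ∑ s ∈ T K, s * a K s ≤ (firstMoment c).toReal ∧
        ∑ s ∈ T K, a K s * Real.log (a K s / ν.real {s}) ≤ τ K) ∧
      (∀ s, Tendsto (fun K => a K s) atTop (𝓝 (c.real {s}))) ∧
      Tendsto (fun K => ∑ s ∈ T K, s * a K s) atTop (𝓝 (firstMoment c).toReal) ∧
      Tendsto τ atTop (𝓝 (klDiv c ν).toReal) := by
  classical
  set m₁ := (firstMoment c).toReal with hm₁
  have hcν : ∀ k, ν.real {k} = 0 → c.real {k} = 0 := by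
    intro k h0
    rw [measureReal_eq_zero_iff] at h0 ⊢
    exact hac h0
  set Q : ℕ → ℝ := fun K => ∑ s ∈ Finset.range K, c.real {s} with hQ
  have hQlim : Tendsto Q atTop (𝓝 1) := (hasSum_real_singleton c).tendsto_sum_nat
  have hVlim : Tendsto (fun K => ∑ s ∈ Finset.range K, ν.real {s}) atTop (𝓝 1) :=
    (hasSum_real_singleton ν).tendsto_sum_nat
  have hMsum := hasSum_mul_real_singleton c hmom
  have hMlim : Tendsto (fun K => ∑ s ∈ Finset.range K, (s : ℝ) * c.real {s}) atTop (𝓝 m₁) :=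
    hMsum.tendsto_sum_nat
  set T : ℕ → Finset ℕ := fun K => (Finset.range K).filter fun s => ν.real {s} ≠ 0 with hT
  -- The truncation is c conditioned on {0, …, K - 1}, written with normalization `Q K`.
  set a : ℕ → ℕ → ℝ := fun K s => if s < K then c.real {s} / Q K else 0 with ha
  have hsumT : ∀ (K : ℕ) (f : ℕ → ℝ → ℝ), (∀ s, f s 0 = 0) →
      ∑ s ∈ T K, f s (a K s) = ∑ s ∈ Finset.range K, f s (c.real {s} / Q K) := by
    intro K f hf
    rw [hT, Finset.sum_filter]
    refine Finset.sum_congr rfl fun s hs => ?_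
    have hsK : s < K := Finset.mem_range.1 hs
    by_cases h : ν.real {s} = 0
    · rw [if_neg (not_not.2 h), hcν s h, zero_div, hf]
    · rw [if_pos h, ha]
      simp only [hsK, if_true]
  have hmeanT : ∀ K, ∑ s ∈ T K, (s : ℝ) * a K s
      = (∑ s ∈ Finset.range K, (s : ℝ) * c.real {s}) / Q K := by
    intro K
    rw [hsumT K (fun s x => s * x) (fun _ => mul_zero _), Finset.sum_div]
    exact Finset.sum_congr rfl fun s _ => by ring
  set τ : ℕ → ℝ := fun K => ((klDiv c ν).toReal + (1 - ∑ s ∈ Finset.range K, ν.real {s})) / Q K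
    - Real.log (Q K) with hτ
  refine ⟨T, a, τ, ?_, fun s => ?_, ?_, ?_⟩
  · filter_upwards [hQlim.eventually_const_lt (show (0 : ℝ) < 1 by norm_num)] with K hK
    refine ⟨fun s hs => (Finset.mem_filter.1 hs).2, fun s => ?_, fun s hs => ?_, ?_, ?_, ?_⟩
    · simp only [ha]
      split_ifs
      · exact div_nonneg measureReal_nonneg hK.le
      · exact le_rfl
    · simp only [ha]
      split_ifs with h
      · have : ν.real {s} = 0 := by
          by_contra h0
          exact hs (Finset.mem_filter.2 ⟨Finset.mem_range.2 h, h0⟩)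
        rw [hcν s this, zero_div]
      · rfl
    · rw [hsumT K (fun _ x => x) (fun _ => rfl), ← Finset.sum_div]
      exact div_self hK.ne'
    · rw [hmeanT, div_le_iff₀ hK]
      -- Conditioning on an initial segment cannot raise the mean: the removed points are at least K
      -- and the kept ones at most K.
      set A := ∑ s ∈ Finset.range K, (s : ℝ) * c.real {s} with hA
      have h1 : HasSum (fun s : ℕ => ((s : ℝ) - K) * c.real {s}) (m₁ - K) := by
        have := hMsum.sub ((hasSum_real_singleton c).mul_left (K : ℝ))
        simpa [sub_mul] using this
      have h2 : A - K * Q K ≤ m₁ - K := by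
        have h3 := sum_le_hasSum (Finset.range K) (fun s hs => by
          have : (K : ℝ) ≤ s := by exact_mod_cast not_lt.1 fun h => hs (Finset.mem_range.2 h)
          exact mul_nonneg (by linarith) measureReal_nonneg) h1
        refine le_trans (le_of_eq ?_) h3
        rw [hA, hQ, Finset.mul_sum, ← Finset.sum_sub_distrib]
        exact Finset.sum_congr rfl fun s _ => by ring
      have h4 : A ≤ K * Q K := by
        rw [hA, hQ, Finset.mul_sum]
        refine Finset.sum_le_sum fun s hs => ?_
        have : (s : ℝ) ≤ K := by exact_mod_cast (Finset.mem_range.1 hs).le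
        exact mul_le_mul_of_nonneg_right this measureReal_nonneg
      have h5 : Q K ≤ 1 := sum_real_singleton_le_one c _
      nlinarith
    · rw [hsumT K (fun s x => x * Real.log (x / ν.real {s})) (fun _ => by simp)]
      have h1 := sum_mul_log_le_klDiv c ν hac hkl (Finset.range K)
      have h2 : ∑ s ∈ Finset.range K, c.real {s} / Q K * Real.log (c.real {s} / Q K / ν.real {s})
          = (∑ s ∈ Finset.range K, c.real {s} * Real.log (c.real {s} / ν.real {s})) / Q K
            - Real.log (Q K) := by
        have h3 : Real.log (Q K) = ∑ s ∈ Finset.range K, c.real {s} / Q K * Real.log (Q K) := by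
          rw [← Finset.sum_mul, ← Finset.sum_div, div_self hK.ne', one_mul]
        conv_rhs => rw [h3]
        rw [Finset.sum_div, ← Finset.sum_sub_distrib]
        refine Finset.sum_congr rfl fun s _ => ?_
        by_cases hs : c.real {s} = 0
        · simp [hs]
        · have hνs : ν.real {s} ≠ 0 := fun h => hs (hcν s h)
          rw [div_right_comm, Real.log_div (div_ne_zero hs hνs) hK.ne']
          ring
      rw [h2, hτ]
      simp only
      gcongr
  · have h1 : Tendsto (fun K => c.real {s} / Q K) atTop (𝓝 (c.real {s})) := by
      have := (tendsto_const_nhds (x := c.real {s})).div hQlim one_ne_zero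
      rw [div_one] at this
      exact this
    refine h1.congr' ?_
    filter_upwards [eventually_gt_atTop s] with K hK
    simp [ha, hK]
  · simp only [hmeanT]
    have := hMlim.div hQlim one_ne_zero
    rw [div_one] at this
    exact this
  · have h1 := ((tendsto_const_nhds (x := (klDiv c ν).toReal)).add
      ((tendsto_const_nhds (x := (1 : ℝ))).sub hVlim)).div hQlim one_ne_zero
    have h2 := h1.sub (hQlim.log one_ne_zero)
    rw [sub_self, add_zero, div_one, Real.log_one, sub_zero] at h2
    exact h2

/-- The exponential lower bound with the rate function. -/
theorem reachable_rateOf (ν : Measure ℕ) [IsProbabilityMeasure ν] {N L : ℕ → ℕ} {R : ℝ≥0}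
    (hLpos : ∀ n, 0 < L n) (hR : ∀ n, (N n : ℝ≥0) / (L n : ℝ≥0) ≤ R)
    (hL : Tendsto L atTop atTop) {ρ : ℝ≥0} (hρR : ρ ≤ R)
    (hNL : Tendsto (fun n => (N n : ℝ) / L n) atTop (𝓝 ρ))
    (hZ : ∀ n, normalization (fun k => (ν {k}).toNNReal) (N n) (L n) ≠ 0) {j k : ℕ}
    (hqj : ν {j} ≠ 0) (hqk : ν {k} ≠ 0) (hj : (j : ℝ) < ρ) (hk : (ρ : ℝ) < k) {lam : ℝ≥0∞}
    (hlam : ∀ θ : ℝ, lam < ENNReal.ofReal θ → ∃ᶠ m : ℕ in atTop, Real.exp (-(θ * m)) ≤ ν.real {m})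
    (c : MomentLE R) (hc : rateOf ν lam ρ c.toMeasure ≠ ∞) :
    Reachable (fun k => (ν {k}).toNNReal) hLpos hR c (rateOf ν lam ρ c.toMeasure).toReal := by
  classical
  set q : ℕ → ℝ≥0 := fun k => (ν {k}).toNNReal with hq
  have hqν : ∀ s, (q s : ℝ) = ν.real {s} := fun s => rfl
  have hq0 : ∀ s, ν.real {s} ≠ 0 → q s ≠ 0 := fun s hs h => hs (by rw [← hqν, h]; rfl)
  have hqj' : q j ≠ 0 := hq0 j ((measureReal_ne_zero_iff).2 hqj)
  have hqk' : q k ≠ 0 := hq0 k ((measureReal_ne_zero_iff).2 hqk)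
  have hρR' : (ρ : ℝ) ≤ R := by exact_mod_cast hρR
  have hle : firstMoment c.toMeasure ≤ ρ := by
    by_contra hcon
    exact hc (if_neg hcon)
  rw [rateOf, if_pos hle] at hc ⊢
  have hkl : klDiv c.toMeasure ν ≠ ∞ := fun h => hc (by simp [h])
  have hlm : lam * ((ρ : ℝ≥0∞) - firstMoment c.toMeasure) ≠ ∞ := fun h => hc (by simp [h])
  have hac : c.toMeasure ≪ ν := (klDiv_ne_top_iff.1 hkl).1
  have hfin : firstMoment c.toMeasure ≠ ∞ := ne_top_of_le_ne_top ENNReal.coe_ne_top hle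
  set m₁ := (firstMoment c.toMeasure).toReal with hm₁
  have hm₁ρ : m₁ ≤ ρ := by
    have := ENNReal.toReal_mono ENNReal.coe_ne_top hle
    simpa using this
  obtain ⟨T, a, τ, hprop, halim, hmlim, hτlim⟩ := exists_truncation c.toMeasure ν hac hkl hfin
  have hval : (klDiv c.toMeasure ν + lam * ((ρ : ℝ≥0∞) - firstMoment c.toMeasure)).toReal
      = (klDiv c.toMeasure ν).toReal + lam.toReal * (ρ - m₁) := by
    rw [ENNReal.toReal_add hkl hlm, ENNReal.toReal_mul, ENNReal.toReal_sub_of_le hle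
      ENNReal.coe_ne_top]
    rfl
  rw [hval]
  have : Nonempty (MomentLE R) := ⟨c⟩
  -- A genuine deficit forces lam to be finite, and very large sites compensate for it.
  rcases hm₁ρ.lt_or_eq with hlt | heq
  · have hlamtop : lam ≠ ∞ := by
      intro htop
      refine hlm ?_
      rw [htop, ENNReal.top_mul]
      rw [Ne, tsub_eq_zero_iff_le, not_le, ← ENNReal.toReal_lt_toReal hfin ENNReal.coe_ne_top]
      simpa using hlt
    have hlam' : ∀ θ > lam.toReal, ∃ᶠ m : ℕ in atTop, Real.exp (-(θ * m)) ≤ q m := by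
      intro θ hθ
      exact hlam θ ((ENNReal.lt_ofReal_iff_toReal_lt hlamtop).2 hθ)
    have hex : ∀ᶠ K in atTop, ∃ c' : MomentLE R, (∀ s, c'.toMeasure.real {s} = a K s) ∧
        Reachable q hLpos hR c' (τ K + lam.toReal * (ρ - ∑ s ∈ T K, s * a K s)) := by
      filter_upwards [hprop] with K hK
      obtain ⟨h1, h2, h3, h4, h5, h6⟩ := hK
      obtain ⟨c', hc'⟩ := MomentLE.exists_real_singleton_eq (R := R) (T K) (a K) h2 h3 h4
        (h5.trans (hm₁ρ.trans hρR'))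
      refine ⟨c', hc', ?_⟩
      have := reachable_of_mean_le hLpos hR hL hρR' hNL hZ hqj' hqk' hj hk (T K) c'
        (fun s hs => by rw [hc', h3 s hs]) (fun s hs => hq0 s (h1 s hs)) (by simpa only [hc'])
        (by simpa only [hc'] using h5.trans hm₁ρ) hlam'
      simp only [hc'] at this
      exact this.mono (by simpa only [hqν] using add_le_add_left h6 _)
    obtain ⟨u, hu⟩ := hex.choice
    refine Reachable.of_tendsto (l := atTop) (u := u)
      (τ := fun K => τ K + lam.toReal * (ρ - ∑ s ∈ T K, s * a K s)) ?_ ?_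
      (hu.mono fun K hK => hK.2)
    · refine MomentLE.tendsto_of_forall_real_singleton fun s => ?_
      exact (halim s).congr' (hu.mono fun K hK => (hK.1 s).symm)
    · intro ε hε
      have hlim := hτlim.add ((tendsto_const_nhds (x := (ρ : ℝ))).sub hmlim |>.const_mul lam.toReal)
      exact (hlim.eventually_lt_const (lt_add_of_pos_right _ hε)).mono fun K hK => hK.le
  -- Without deficit lam may be infinite, so large sites could be unaffordable. Truncation leaves
  -- only a vanishing deficit, which is filled by sites of the fixed size k > ρ at vanishing cost.
  · set x : ℕ → ℝ := fun K => (ρ - ∑ s ∈ T K, s * a K s) / (k - ∑ s ∈ T K, s * a K s) with hx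
    have hxlim : Tendsto x atTop (𝓝 0) := by
      have h1 := ((tendsto_const_nhds (x := (ρ : ℝ))).sub hmlim).div
        ((tendsto_const_nhds (x := (k : ℝ))).sub hmlim) (by rw [← hm₁, heq]; linarith)
      rw [← hm₁, heq, sub_self, zero_div] at h1
      exact h1
    have hex : ∀ᶠ K in atTop, ∃ c' : MomentLE R,
        (∀ s, c'.toMeasure.real {s} = (1 - x K) * a K s + x K * (if s = k then 1 else 0)) ∧
        Reachable q hLpos hR c' ((1 - x K) * ∑ s ∈ T K, a K s * Real.log (a K s / q s)
          + x K * (-Real.log (q k))) := by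
      filter_upwards [hprop] with K hK
      obtain ⟨h1, h2, h3, h4, h5, h6⟩ := hK
      exact exists_reachable_mix hLpos hR hL hρR' hNL hZ hqj' hqk' hj hk (T K) (a K) h2 h3
        (fun s hs => hq0 s (h1 s hs)) h4 (h5.trans hm₁ρ) hk hqk' rfl
    obtain ⟨u, hu⟩ := hex.choice
    refine Reachable.of_tendsto (l := atTop) (u := u)
      (τ := fun K => (1 - x K) * ∑ s ∈ T K, a K s * Real.log (a K s / q s)
          + x K * (-Real.log (q k))) ?_ ?_ (hu.mono fun K hK => hK.2)
    · refine MomentLE.tendsto_of_forall_real_singleton fun s => ?_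
      have h1 : Tendsto (fun K => (1 - x K) * a K s + x K * (if s = k then 1 else 0)) atTop
          (𝓝 (c.toMeasure.real {s})) := by
        have := (((tendsto_const_nhds (x := (1 : ℝ))).sub hxlim).mul (halim s)).add
          (hxlim.mul_const (if s = k then (1 : ℝ) else 0))
        simpa using this
      exact h1.congr' (hu.mono fun K hK => (hK.1 s).symm)
    · intro ε hε
      have hlim : Tendsto (fun K => (1 - x K) * τ K + x K * (-Real.log (q k))) atTop
          (𝓝 (klDiv c.toMeasure ν).toReal) := by
        have := (((tendsto_const_nhds (x := (1 : ℝ))).sub hxlim).mul hτlim).add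
          (hxlim.mul_const (-Real.log (q k)))
        simpa using this
      rw [heq, sub_self, mul_zero, add_zero]
      filter_upwards [hlim.eventually_lt_const (lt_add_of_pos_right _ hε), hprop,
        hxlim.eventually_lt_const (show (0 : ℝ) < 1 by norm_num)] with K hK hp hx1
      refine le_trans ?_ hK.le
      have := mul_le_mul_of_nonneg_left hp.2.2.2.2.2 (show 0 ≤ 1 - x K by linarith)
      simp only [hqν]
      linarith

end CanonicalEnsemble

end

noncomputable section

namespace CanonicalEnsemble

/-! ### Exponential bounds for the canonical laws of a probability weight -/

theorem tsum_coe_toNNReal_singleton (ν : Measure ℕ) [IsProbabilityMeasure ν] :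
    ∑' k, (((ν {k}).toNNReal : ℝ≥0) : ℝ≥0∞) = 1 := by
  have := ν.tsum_indicator_apply_singleton Set.univ MeasurableSet.univ
  simpa [ENNReal.coe_toNNReal (measure_ne_top ν _)] using this

theorem normalization_le_one (ν : Measure ℕ) [IsProbabilityMeasure ν] (N L : ℕ) :
    normalization (fun k => (ν {k}).toNNReal) N L ≤ 1 := by
  refine (tsum_config_prod_le_pow (fun k => (((ν {k}).toNNReal : ℝ≥0) : ℝ≥0∞)) N L).trans ?_
  rw [tsum_coe_toNNReal_singleton, one_pow]

/-- The bounds for unnormalized laws carry over because the normalization is at most 1 and at least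
exp(-o(L)). The hypotheses `hlt` and `hgt` say that lam is the exponential decay rate of ν, each as
one of the estimates needs it. -/
theorem exponentialBounds_canonicalLaw (ν : Measure ℕ) [IsProbabilityMeasure ν] {N L : ℕ → ℕ}
    {R : ℝ≥0} (hLpos : ∀ n, 0 < L n) (hR : ∀ n, (N n : ℝ≥0) / (L n : ℝ≥0) ≤ R)
    (hL : Tendsto L atTop atTop) {ρ : ℝ≥0}
    (hNL : Tendsto (fun n => (N n : ℝ≥0) / (L n : ℝ≥0)) atTop (𝓝 ρ))
    (hZ : ∀ n, normalization (fun k => (ν {k}).toNNReal) (N n) (L n) ≠ 0) {j k : ℕ}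
    (hqj : ν {j} ≠ 0) (hqk : ν {k} ≠ 0) (hj : (j : ℝ) < ρ) (hk : (ρ : ℝ) < k) {lam : ℝ≥0∞}
    (hlt : ∀ θ : ℝ, 0 ≤ θ → ENNReal.ofReal θ < lam →
      Summable fun k : ℕ => ν.real {k} * Real.exp (θ * k))
    (hgt : ∀ θ : ℝ, lam < ENNReal.ofReal θ → ∃ᶠ m : ℕ in atTop, Real.exp (-(θ * m)) ≤ ν.real {m})
    (hν : firstMoment ν ≤ ρ) (hν0 : lam * ((ρ : ℝ≥0∞) - firstMoment ν) = 0) :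
    ExponentialBounds (fun n => canonicalLaw (fun k => (ν {k}).toNNReal) (hLpos n) (hR n)) L
      (fun c : MomentLE R => rateOf ν lam ρ c.toMeasure)
      (fun (i : {i : (ℕ →₀ ℚ) × ℚ //
          Summable fun k : ℕ => ν.real {k} * Real.exp ((i.1 k : ℝ) + i.2 * k)}) (c : MomentLE R) =>
        dualValue (fun k => ν.real {k}) ρ i.1.1 i.1.2 c.toMeasure) := by
  set q : ℕ → ℝ≥0 := fun k => (ν {k}).toNNReal with hq
  have hρR : ρ ≤ R := le_of_tendsto' hNL hR
  have hNL' : Tendsto (fun n => (N n : ℝ) / L n) atTop (𝓝 (ρ : ℝ)) := by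
    have := (NNReal.continuous_coe.tendsto ρ).comp hNL
    simpa [Function.comp_def] using this
  have hreach : ∀ c : MomentLE R, rateOf ν lam ρ c.toMeasure ≠ ∞ →
      Reachable q hLpos hR c (rateOf ν lam ρ c.toMeasure).toReal := fun c hc =>
    reachable_rateOf ν hLpos hR hL hρR hNL' hZ hqj hqk hj hk hgt c hc
  -- Since ν itself has rate zero, the lower bound on the whole space shows that the normalization
  -- is not exponentially small.
  let cν : MomentLE R := ⟨⟨ν, inferInstance⟩, hν.trans (by exact_mod_cast hρR)⟩
  have hcν : rateOf ν lam ρ cν.toMeasure = 0 := by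
    change rateOf ν lam ρ ν = 0
    rw [rateOf, if_pos hν, klDiv_self, hν0, add_zero]
  have hnorm : ∀ ε > 0, ∀ᶠ n in atTop,
      ENNReal.ofReal (Real.exp (-(L n * ε))) ≤ normalization q (N n) (L n) := by
    intro ε hε
    have h1 := hreach cν (by rw [hcν]; exact ENNReal.zero_ne_top) Set.univ univ_mem ε hε
    filter_upwards [h1] with n hn
    rwa [hcν, ENNReal.toReal_zero, zero_add, unnormalizedLaw_univ] at hn
  refine ⟨hLpos, hL, fun i => continuous_dualValue _ _ _ _,
    fun c => rateOf_le_iSup_dualValue ν c.toMeasure lam ρ hlt, ?_, ?_⟩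
  · rintro ⟨⟨g, θ⟩, hs⟩ ε hε
    have hθlim : Tendsto (fun n => (θ : ℝ) * (ρ - (N n : ℝ) / L n)) atTop (𝓝 0) := by
      have := ((tendsto_const_nhds (x := (ρ : ℝ))).sub hNL').const_mul (θ : ℝ)
      simpa using this
    filter_upwards [hnorm (ε / 2) (by positivity),
      hθlim.eventually_lt_const (show 0 < ε / 2 by positivity)] with n hn hθn
    have hLn : (0 : ℝ) < L n := by exact_mod_cast hLpos n
    have h1 := lintegral_exp_dualValue_le (hLpos n) (hR n) q
      ⟨j, fun h => hqj ((ENNReal.toNNReal_eq_zero_iff _).1 h |>.resolve_right (measure_ne_top ν _))⟩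
      ρ g θ hs
    rw [canonicalLaw_eq_smul, lintegral_smul_measure, smul_eq_mul, ← ENNReal.div_eq_inv_mul,
      ENNReal.div_le_iff (hZ n) (normalization_ne_top _ _ _)]
    refine h1.trans ?_
    calc ENNReal.ofReal (Real.exp (θ * (L n * ρ - N n)))
        ≤ ENNReal.ofReal (Real.exp (ε * L n) * Real.exp (-(L n * (ε / 2)))) := by
          rw [← Real.exp_add]
          refine ENNReal.ofReal_le_ofReal (Real.exp_le_exp.2 ?_)
          have h2 : (θ : ℝ) * (L n * ρ - N n) = L n * (θ * (ρ - (N n : ℝ) / L n)) := by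
            field_simp
          have h3 := mul_le_mul_of_nonneg_left hθn.le hLn.le
          rw [h2]
          linarith
      _ = ENNReal.ofReal (Real.exp (ε * L n)) * ENNReal.ofReal (Real.exp (-(L n * (ε / 2)))) :=
          ENNReal.ofReal_mul (Real.exp_pos _).le
      _ ≤ _ := mul_le_mul_right hn _
  · intro c hc U hU ε hε
    filter_upwards [hreach c hc U hU ε hε] with n hn
    refine hn.trans ?_
    rw [canonicalLaw_eq_smul, Measure.smul_apply, smul_eq_mul]
    exact le_mul_of_one_le_left zero_le (ENNReal.one_le_inv.2 (normalization_le_one ν _ _))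

end CanonicalEnsemble

end

noncomputable section

namespace CanonicalEnsemble

/-! ### The partition function -/

section Partition

variable {w : ℕ → ℝ≥0}

theorem Z_mono {φ ψ : ℝ≥0∞} (h : φ ≤ ψ) : Z w φ ≤ Z w ψ :=
  ENNReal.tsum_le_tsum fun n => by gcongr

theorem Z_lt_top_of_lt {φ : ℝ≥0∞} (h : φ < criticalFugacity w) : Z w φ < ∞ := by
  obtain ⟨ψ, hψ, hlt⟩ := lt_sSup_iff.1 h
  exact (Z_mono hlt.le).trans_lt hψ

theorem le_criticalFugacity {φ : ℝ≥0∞} (h : Z w φ ≠ ∞) : φ ≤ criticalFugacity w :=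
  le_sSup (lt_top_iff_ne_top.2 h)

theorem Z_ne_zero {j : ℕ} (hj : w j ≠ 0) {φ : ℝ≥0∞} (hφ : φ ≠ 0) : Z w φ ≠ 0 := by
  intro h
  have := ENNReal.tsum_eq_zero.1 h j
  simp [hφ, hj] at this

theorem tilted_singleton (w : ℕ → ℝ≥0) (φ : ℝ≥0∞) (k : ℕ) :
    tilted w φ {k} = φ ^ k * w k / Z w φ := by
  rw [tilted, withDensity_apply _ (MeasurableSet.singleton k), lintegral_singleton]
  simp

theorem isProbabilityMeasure_tilted_weight {φ : ℝ≥0∞} (h0 : Z w φ ≠ 0) (h1 : Z w φ ≠ ∞) :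
    IsProbabilityMeasure (tilted w φ) := by
  constructor
  rw [tilted, withDensity_apply _ MeasurableSet.univ, setLIntegral_univ, lintegral_count]
  simp only [div_eq_mul_inv]
  rw [ENNReal.tsum_mul_right]
  exact ENNReal.mul_inv_cancel h0 h1

/-- The numerator of the mean of `ω^φ`. -/
def massSum (w : ℕ → ℝ≥0) (φ : ℝ≥0∞) : ℝ≥0∞ := ∑' k : ℕ, (k : ℝ≥0∞) * (φ ^ k * w k)

/-- The total excess over the density `r`. -/
def excess (w : ℕ → ℝ≥0) (r φ : ℝ≥0∞) : ℝ≥0∞ := ∑' k : ℕ, ((k : ℝ≥0∞) - r) * (φ ^ k * w k)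

/-- The total deficit below the density `r`. -/
def deficit (w : ℕ → ℝ≥0) (r φ : ℝ≥0∞) : ℝ≥0∞ := ∑' k : ℕ, (r - (k : ℝ≥0∞)) * (φ ^ k * w k)

theorem firstMoment_tilted (w : ℕ → ℝ≥0) (φ : ℝ≥0∞) :
    firstMoment (tilted w φ) = massSum w φ / Z w φ := by
  rw [firstMoment_eq_tsum, massSum, div_eq_mul_inv, ← ENNReal.tsum_mul_right]
  refine tsum_congr fun k => ?_
  rw [tilted_singleton, div_eq_mul_inv]
  simp only [mul_assoc]

theorem massSum_add_deficit (w : ℕ → ℝ≥0) (r φ : ℝ≥0∞) :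
    massSum w φ + deficit w r φ = r * Z w φ + excess w r φ := by
  rw [massSum, deficit, excess, Z, ← ENNReal.tsum_mul_left, ← ENNReal.tsum_add, ← ENNReal.tsum_add]
  refine tsum_congr fun k => ?_
  rw [← add_mul, ← add_mul, add_tsub_eq_max, add_tsub_eq_max, max_comm]

theorem deficit_le (w : ℕ → ℝ≥0) (r φ : ℝ≥0∞) : deficit w r φ ≤ r * Z w φ := by
  rw [deficit, Z, ← ENNReal.tsum_mul_left]
  exact ENNReal.tsum_le_tsum fun k => mul_le_mul_left tsub_le_self _

theorem excess_le (w : ℕ → ℝ≥0) (r φ : ℝ≥0∞) : excess w r φ ≤ massSum w φ := by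
  exact ENNReal.tsum_le_tsum fun k => mul_le_mul_left tsub_le_self _

/-- Comparing two nonnegative sums replaces the sign of M₁ - r; the statement stays meaningful when
the mass sum is infinite, since the deficit is always finite here. -/
theorem firstMoment_tilted_le_iff {r φ : ℝ≥0∞} (hr : r ≠ ∞) (h0 : Z w φ ≠ 0) (h1 : Z w φ ≠ ∞) :
    firstMoment (tilted w φ) ≤ r ↔ excess w r φ ≤ deficit w r φ := by
  have hrZ : r * Z w φ ≠ ∞ := ENNReal.mul_ne_top hr h1
  have hd : deficit w r φ ≠ ∞ := ne_top_of_le_ne_top hrZ (deficit_le w r φ)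
  rw [firstMoment_tilted, ENNReal.div_le_iff h0 h1]
  have h := massSum_add_deficit w r φ
  constructor
  · intro hle
    have h2 : r * Z w φ + excess w r φ ≤ r * Z w φ + deficit w r φ := by
      rw [← h]; gcongr
    exact (ENNReal.add_le_add_iff_left hrZ).1 h2
  · intro hle
    have h2 : massSum w φ + deficit w r φ ≤ r * Z w φ + deficit w r φ := by
      rw [h]; gcongr
    exact (ENNReal.add_le_add_iff_right hd).1 h2

theorem firstMoment_tilted_eq_iff {r φ : ℝ≥0∞} (hr : r ≠ ∞) (h0 : Z w φ ≠ 0) (h1 : Z w φ ≠ ∞) :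
    firstMoment (tilted w φ) = r ↔ excess w r φ = deficit w r φ := by
  have hrZ : r * Z w φ ≠ ∞ := ENNReal.mul_ne_top hr h1
  have hd : deficit w r φ ≠ ∞ := ne_top_of_le_ne_top hrZ (deficit_le w r φ)
  rw [firstMoment_tilted]
  have h := massSum_add_deficit w r φ
  constructor
  · intro he
    rw [← he, ENNReal.div_mul_cancel h0 h1, he] at h
    rw [← he, ENNReal.div_mul_cancel h0 h1] at hrZ
    exact ((ENNReal.add_right_inj hrZ).1 h).symm
  · intro he
    rw [he] at h
    rw [(ENNReal.add_left_inj hd).1 h, ENNReal.mul_div_cancel_right h0 h1]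

/-- Comparison of excess and deficit at two fugacities. -/
theorem excess_mul_le (w : ℕ → ℝ≥0) {r : ℝ≥0} {x : ℝ≥0∞} (hx : 1 ≤ x) (φ : ℝ≥0∞) :
    x ^ (⌊r⌋₊ + 1) * excess w r φ ≤ excess w r (x * φ) := by
  rw [excess, excess, ← ENNReal.tsum_mul_left]
  refine ENNReal.tsum_le_tsum fun k => ?_
  rcases le_or_gt (k : ℝ≥0) r with hk | hk
  · have : (k : ℝ≥0∞) - r = 0 := tsub_eq_zero_of_le (by exact_mod_cast hk)
    simp [this]
  · have hk' : ⌊r⌋₊ + 1 ≤ k := Nat.succ_le_of_lt ((Nat.floor_lt zero_le).2 hk)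
    rw [mul_pow, mul_left_comm, mul_assoc]
    gcongr

/-- Sizes below r carry at most ⌊r⌋ powers of the fugacity, whereas by `excess_mul_le` sizes above r
carry at least one more. This gap of one power drives the monotonicity and growth arguments below.
-/
theorem deficit_mul_le (w : ℕ → ℝ≥0) {r : ℝ≥0} {x : ℝ≥0∞} (hx : 1 ≤ x) (φ : ℝ≥0∞) :
    deficit w r (x * φ) ≤ x ^ ⌊r⌋₊ * deficit w r φ := by
  rw [deficit, deficit, ← ENNReal.tsum_mul_left]
  refine ENNReal.tsum_le_tsum fun k => ?_
  rcases le_or_gt r (k : ℝ≥0) with hk | hk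
  · have : (r : ℝ≥0∞) - k = 0 := tsub_eq_zero_of_le (by exact_mod_cast hk)
    simp [this]
  · have hk' : k ≤ ⌊r⌋₊ := Nat.le_floor hk.le
    rw [mul_pow, mul_assoc, mul_left_comm]
    exact mul_le_mul (pow_le_pow_right₀ hx hk') le_rfl zero_le zero_le

/-- Bernoulli's inequality bounds k φ ^ k by a constant times ψ ^ k for some ψ between φ and φ_c. -/
theorem massSum_lt_top {φ : ℝ≥0∞} (h : φ < criticalFugacity w) : massSum w φ < ∞ := by
  obtain ⟨ψ', hφψ, hψ'⟩ := exists_between h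
  have hφt : φ ≠ ∞ := ne_top_of_lt h
  have hψt : ψ' ≠ ∞ := ne_top_of_lt hψ'
  lift φ to ℝ≥0 using hφt
  lift ψ' to ℝ≥0 using hψt
  have hφψ' : φ < ψ' := by exact_mod_cast hφψ
  have hδ : (0 : ℝ) < (ψ' : ℝ) - φ := by
    have : (φ : ℝ) < ψ' := by exact_mod_cast hφψ'
    linarith
  set C : ℝ≥0 := ⟨(ψ' : ℝ) / ((ψ' : ℝ) - φ), by positivity⟩ with hC
  have hterm : ∀ k : ℕ, (k : ℝ≥0) * φ ^ k ≤ C * ψ' ^ k := by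
    intro k
    rw [← NNReal.coe_le_coe]
    push_cast
    rcases eq_or_lt_of_le (NNReal.coe_nonneg φ) with h0 | h0
    · rw [← h0]
      rcases Nat.eq_zero_or_pos k with rfl | hk
      · simp
      · rw [zero_pow hk.ne', mul_zero]
        positivity
    · have h1 := one_add_mul_le_pow (a := ((ψ' : ℝ) - φ) / φ)
        (by have : 0 ≤ ((ψ' : ℝ) - φ) / φ := by positivity
            linarith) k
      have h2 : 1 + ((ψ' : ℝ) - φ) / φ = ψ' / φ := by field_simp; ring
      rw [h2, div_pow, le_div_iff₀ (by positivity)] at h1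
      have h3 : (k : ℝ) * (((ψ' : ℝ) - φ) / φ) * (φ : ℝ) ^ k ≤ (ψ' : ℝ) ^ k := by
        have : (0 : ℝ) ≤ (φ : ℝ) ^ k := by positivity
        linarith
      have hCv : (C : ℝ) = (ψ' : ℝ) / ((ψ' : ℝ) - φ) := rfl
      rw [hCv]
      have h4 := mul_le_mul_of_nonneg_left h3 (show 0 ≤ (φ : ℝ) / ((ψ' : ℝ) - φ) by positivity)
      have h5 : (φ : ℝ) / ((ψ' : ℝ) - φ) * ((k : ℝ) * (((ψ' : ℝ) - φ) / φ) * (φ : ℝ) ^ k)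
          = (k : ℝ) * (φ : ℝ) ^ k := by
        field_simp
      rw [h5] at h4
      refine h4.trans ?_
      gcongr
  have hle : massSum w φ ≤ C * Z w ψ' := by
    rw [massSum, Z, ← ENNReal.tsum_mul_left]
    refine ENNReal.tsum_le_tsum fun k => ?_
    rw [← mul_assoc, ← mul_assoc]
    exact mul_le_mul_left (by exact_mod_cast hterm k) _
  exact hle.trans_lt (ENNReal.mul_lt_top ENNReal.coe_lt_top (Z_lt_top_of_lt hψ'))

theorem firstMoment_tilted_zero (w : ℕ → ℝ≥0) : firstMoment (tilted w 0) = 0 := by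
  rw [firstMoment_tilted, massSum]
  have : ∑' k : ℕ, (k : ℝ≥0∞) * ((0 : ℝ≥0∞) ^ k * w k) = 0 := by
    refine ENNReal.tsum_eq_zero.2 fun k => ?_
    rcases Nat.eq_zero_or_pos k with rfl | hk
    · simp
    · simp [hk.ne']
  rw [this, ENNReal.zero_div]

/-- With r the mean at φ, excess and deficit agree there. At xφ the excess has gained one more
factor x > 1 than the deficit, unless both vanish, which two charged points exclude. -/
theorem firstMoment_tilted_lt_of_lt {j k : ℕ} (hj : w j ≠ 0) (hk : w k ≠ 0) (hjk : j < k)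
    {φ ψ : ℝ≥0∞} (hφ : φ ≠ 0) (hφψ : φ < ψ) (hψ : ψ < criticalFugacity w) :
    firstMoment (tilted w φ) < firstMoment (tilted w ψ) := by
  have hφc := hφψ.trans hψ
  have hψ0 : ψ ≠ 0 := (pos_iff_ne_zero.2 hφ |>.trans hφψ).ne'
  have hZφ0 := Z_ne_zero hj hφ
  have hZφ := (Z_lt_top_of_lt hφc).ne
  have hZψ0 := Z_ne_zero hj hψ0
  have hZψ := (Z_lt_top_of_lt hψ).ne
  have hfin : firstMoment (tilted w φ) ≠ ∞ := by
    rw [firstMoment_tilted]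
    exact ENNReal.div_ne_top (massSum_lt_top hφc).ne hZφ0
  obtain ⟨r, hr⟩ : ∃ r : ℝ≥0, (r : ℝ≥0∞) = firstMoment (tilted w φ) :=
    ⟨_, ENNReal.coe_toNNReal hfin⟩
  rw [← hr]
  by_contra! hle
  have h1 := (firstMoment_tilted_le_iff ENNReal.coe_ne_top hZψ0 hZψ).1 hle
  have h2 := (firstMoment_tilted_eq_iff (r := r) ENNReal.coe_ne_top hZφ0 hZφ).1 hr.symm
  have hφt : φ ≠ ∞ := ne_top_of_lt hφψ
  have hψt : ψ ≠ ∞ := ne_top_of_lt hψ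
  set x := ψ / φ with hx
  have hxφ : x * φ = ψ := ENNReal.div_mul_cancel hφ hφt
  have hx1 : 1 < x := by
    rw [hx, ENNReal.lt_div_iff_mul_lt (Or.inl hφ) (Or.inl hφt), one_mul]
    exact hφψ
  have hxt : x ≠ ∞ := ENNReal.div_ne_top hψt hφ
  have hx0 : x ≠ 0 := (zero_lt_one.trans hx1).ne'
  have h3 := excess_mul_le w (r := r) hx1.le φ
  have h4 := deficit_mul_le w (r := r) hx1.le φ
  rw [hxφ] at h3 h4
  have h5 := h3.trans (h1.trans h4)
  rw [← h2, pow_succ, mul_assoc, ENNReal.mul_le_mul_iff_right (pow_ne_zero _ hx0)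
    (ENNReal.pow_ne_top hxt)] at h5
  have hPfin : excess w r φ ≠ ∞ :=
    ne_top_of_le_ne_top (massSum_lt_top hφc).ne (excess_le w r φ)
  have hP0 : excess w r φ = 0 := by
    by_contra hne
    have h6 : 1 * excess w r φ < x * excess w r φ := ENNReal.mul_lt_mul_left hne hPfin hx1
    rw [one_mul] at h6
    exact absurd h5 (not_le.2 h6)
  have hB0 : deficit w r φ = 0 := by rw [← h2, hP0]
  have e1 := ENNReal.tsum_eq_zero.1 hP0 k
  have e2 := ENNReal.tsum_eq_zero.1 hB0 j
  simp only [mul_eq_zero, pow_eq_zero_iff', hφ, ENNReal.coe_eq_zero, hk, hj, false_and, or_false,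
    tsub_eq_zero_iff_le] at e1 e2
  have : (k : ℝ≥0∞) ≤ j := e1.trans e2
  exact absurd (Nat.cast_le.1 this) (not_le.2 hjk)

/-- By strict monotonicity no fugacity below φ_c has mean r ≥ ρ_c, so whether or not the mean is
attained, the definition yields φ_c. -/
theorem fugacity_eq_criticalFugacity {j k : ℕ} (hj : w j ≠ 0) (hk : w k ≠ 0) (hjk : j < k)
    {r : ℝ≥0∞} (hr : criticalDensity w ≤ r) (hr0 : r ≠ 0) : fugacity w r = criticalFugacity w := by
  have key : ∀ φ, IsFugacity w r φ → φ = criticalFugacity w := by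
    rintro φ ⟨h0, h1, h2⟩
    refine le_antisymm (le_criticalFugacity h1) (not_lt.1 fun hlt => ?_)
    have hφ : φ ≠ 0 := by
      rintro rfl
      exact hr0 (h2.symm.trans (firstMoment_tilted_zero w))
    obtain ⟨ψ, hφψ, hψ⟩ := exists_between hlt
    have h3 := firstMoment_tilted_lt_of_lt hj hk hjk hφ hφψ hψ
    have h4 : firstMoment (tilted w ψ) ≤ criticalDensity w :=
      le_iSup₂ (f := fun φ (_ : φ < criticalFugacity w) => firstMoment (tilted w φ)) ψ hψ
    rw [h2] at h3
    exact absurd (h4.trans hr) (not_le.2 h3)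
  unfold fugacity
  split_ifs with h
  · exact key _ h.choose_spec
  · rfl

theorem criticalFugacity_pos (hw : ∃ φ : ℝ≥0∞, 0 < φ ∧ Z w φ < ∞) : 0 < criticalFugacity w := by
  obtain ⟨φ, h0, h1⟩ := hw
  exact h0.trans_le (le_criticalFugacity h1.ne)

theorem criticalDensity_ne_zero (hw : ∃ φ : ℝ≥0∞, 0 < φ ∧ Z w φ < ∞) {k : ℕ} (hk : w k ≠ 0)
    (hk0 : k ≠ 0) : criticalDensity w ≠ 0 := by
  obtain ⟨φ, h0, hφ⟩ := exists_between (criticalFugacity_pos hw)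
  have h1 : firstMoment (tilted w φ) ≤ criticalDensity w :=
    le_iSup₂ (f := fun φ (_ : φ < criticalFugacity w) => firstMoment (tilted w φ)) φ hφ
  intro h
  rw [h, nonpos_iff_eq_zero, firstMoment_tilted, ENNReal.div_eq_zero_iff] at h1
  rcases h1 with h1 | h1
  · have := ENNReal.tsum_eq_zero.1 h1 k
    simp [hk, hk0, h0.ne'] at this
  · exact (Z_lt_top_of_lt hφ).ne h1

end Partition

end CanonicalEnsemble

end

noncomputable section

namespace CanonicalEnsemble

/-! ### The equilibrium distribution at and below the critical density -/

section Equilibrium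

variable {w : ℕ → ℝ≥0}

theorem deficit_mono {r φ ψ : ℝ≥0∞} (h : φ ≤ ψ) : deficit w r φ ≤ deficit w r ψ :=
  ENNReal.tsum_le_tsum fun n => by gcongr

/-- Finiteness of the partition sum at φ_c is not yet known; the deficit is compared with its value
at φ_c / 2. -/
theorem deficit_criticalFugacity_ne_top (hc0 : criticalFugacity w ≠ 0)
    (hc : criticalFugacity w ≠ ∞) (r : ℝ≥0) : deficit w r (criticalFugacity w) ≠ ∞ := by
  have h1 : Z w (criticalFugacity w / 2) < ∞ := Z_lt_top_of_lt (ENNReal.half_lt_self hc0 hc)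
  have h2 := deficit_mul_le w (r := r) one_le_two (criticalFugacity w / 2)
  rw [ENNReal.mul_div_cancel two_ne_zero ENNReal.ofNat_ne_top] at h2
  refine ne_top_of_le_ne_top (ENNReal.mul_ne_top (by simp) ?_) h2
  exact ne_top_of_le_ne_top (ENNReal.mul_ne_top ENNReal.coe_ne_top h1.ne) (deficit_le w r _)

theorem excess_ne_zero {k : ℕ} (hk : w k ≠ 0) {r φ : ℝ≥0∞} (hrk : r < k) (hφ : φ ≠ 0) :
    excess w r φ ≠ 0 := by
  intro h
  have := ENNReal.tsum_eq_zero.1 h k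
  simp only [mul_eq_zero, pow_eq_zero_iff', hφ, ENNReal.coe_eq_zero, hk, false_and, or_false,
    tsub_eq_zero_iff_le] at this
  exact absurd hrk (not_lt.2 this)

theorem deficit_ne_zero {j : ℕ} (hj : w j ≠ 0) {r φ : ℝ≥0∞} (hjr : j < r) (hφ : φ ≠ 0) :
    deficit w r φ ≠ 0 := by
  intro h
  have := ENNReal.tsum_eq_zero.1 h j
  simp only [mul_eq_zero, pow_eq_zero_iff', hφ, ENNReal.coe_eq_zero, hj, false_and, or_false,
    tsub_eq_zero_iff_le] at this
  exact absurd hjr (not_lt.2 this)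

section Supercritical

variable {j k : ℕ} {r : ℝ≥0}

theorem excess_le_deficit_of_criticalDensity_le (hj : w j ≠ 0) (hr : criticalDensity w ≤ r)
    {φ : ℝ≥0∞} (hφ0 : φ ≠ 0) (hφ : φ < criticalFugacity w) : excess w r φ ≤ deficit w r φ := by
  refine (firstMoment_tilted_le_iff ENNReal.coe_ne_top (Z_ne_zero hj hφ0)
    (Z_lt_top_of_lt hφ).ne).1 (le_trans ?_ hr)
  exact le_iSup₂ (f := fun φ (_ : φ < criticalFugacity w) => firstMoment (tilted w φ)) φ hφ

/-- If φ_c were infinite, scaling the fugacity from 1 to n + 1 would give (n + 1) · excess ≤ deficit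
at fugacity 1 for every n, against a nonzero excess and a finite deficit. -/
theorem criticalFugacity_ne_top (hk : w k ≠ 0) (hrk : (r : ℝ≥0∞) < k)
    (hr : criticalDensity w ≤ r) : criticalFugacity w ≠ ∞ := by
  intro htop
  have hlt : ∀ x : ℕ, (x : ℝ≥0∞) < criticalFugacity w := fun x => by
    rw [htop]; exact ENNReal.natCast_lt_top x
  have he := excess_ne_zero hk hrk one_ne_zero
  have hd : deficit w r 1 ≠ ∞ := by
    have := Z_lt_top_of_lt (hlt 1)
    rw [Nat.cast_one] at this
    exact ne_top_of_le_ne_top (ENNReal.mul_ne_top ENNReal.coe_ne_top this.ne) (deficit_le w r 1)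
  obtain ⟨n, hn⟩ := ENNReal.exists_nat_mul_gt he hd
  have hx0 : ((n + 1 : ℕ) : ℝ≥0∞) ≠ 0 := by exact_mod_cast n.succ_ne_zero
  have hx1 : (1 : ℝ≥0∞) ≤ (n + 1 : ℕ) := by exact_mod_cast Nat.le_add_left 1 n
  have h1 := excess_mul_le w (r := r) hx1 1
  have h2 := deficit_mul_le w (r := r) hx1 1
  rw [mul_one] at h1 h2
  have h3 := h1.trans ((excess_le_deficit_of_criticalDensity_le hk hr hx0 (hlt _)).trans h2)
  rw [pow_succ, mul_assoc, ENNReal.mul_le_mul_iff_right (pow_ne_zero _ hx0)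
    (ENNReal.pow_ne_top (ENNReal.natCast_ne_top _))] at h3
  refine absurd (lt_of_lt_of_le hn ?_) (not_lt.2 h3)
  gcongr
  exact n.le_succ

/-- The inequality holds below φ_c and passes to the limit in every finite partial sum of the
excess. -/
theorem excess_criticalFugacity_le (hj : w j ≠ 0) (hc0 : criticalFugacity w ≠ 0)
    (hr : criticalDensity w ≤ r) :
    excess w r (criticalFugacity w) ≤ deficit w r (criticalFugacity w) := by
  rw [excess, ENNReal.tsum_eq_iSup_sum]
  refine iSup_le fun s => ?_
  set f : ℝ≥0∞ → ℝ≥0∞ := fun φ => ∑ k ∈ s, ((k : ℝ≥0∞) - r) * (φ ^ k * w k) with hf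
  have hcont : Continuous f := by
    refine continuous_finsetSum _ fun k _ => ?_
    refine (ENNReal.continuous_const_mul (ENNReal.sub_ne_top (ENNReal.natCast_ne_top k))).comp ?_
    exact (ENNReal.continuous_mul_const ENNReal.coe_ne_top).comp (ENNReal.continuous_pow k)
  have : (𝓝[<] criticalFugacity w).NeBot :=
    nhdsLT_neBot_of_exists_lt ⟨0, pos_iff_ne_zero.2 hc0⟩
  refine le_of_tendsto (hcont.continuousWithinAt (s := Set.Iio (criticalFugacity w))) ?_
  filter_upwards [self_mem_nhdsWithin,
    mem_nhdsWithin_of_mem_nhds (lt_mem_nhds (pos_iff_ne_zero.2 hc0))] with φ hφ hφ0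
  calc f φ ≤ excess w r φ := ENNReal.sum_le_tsum s
    _ ≤ deficit w r φ := excess_le_deficit_of_criticalDensity_le hj hr hφ0.ne' hφ
    _ ≤ _ := deficit_mono (le_of_lt hφ)

/-- Sizes k ≥ m = ⌊r⌋ + 1 enter the excess over r with factor at least m - r > 0, and sizes k < m
enter the deficit below m with factor at least 1. -/
theorem Z_ne_top_of_excess_ne_top {φ : ℝ≥0∞} (he : excess w r φ ≠ ∞)
    (hd : ∀ r : ℝ≥0, deficit w r φ ≠ ∞) : Z w φ ≠ ∞ := by
  set m := ⌊r⌋₊ + 1 with hm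
  have hrm : r < m := by exact_mod_cast Nat.lt_floor_add_one r
  set δ : ℝ≥0∞ := (m : ℝ≥0∞) - r with hδ
  have hδ0 : δ ≠ 0 := by
    rw [hδ, Ne, tsub_eq_zero_iff_le, not_le]
    exact_mod_cast hrm
  have hδt : δ ≠ ∞ := ENNReal.sub_ne_top (ENNReal.natCast_ne_top m)
  have hle : δ * Z w φ ≤ δ * deficit w (m : ℝ≥0) φ + excess w r φ := by
    rw [Z, deficit, excess, ← ENNReal.tsum_mul_left, ← ENNReal.tsum_mul_left, ← ENNReal.tsum_add]
    refine ENNReal.tsum_le_tsum fun k => ?_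
    rcases lt_or_ge k m with hk | hk
    · refine le_add_right (mul_le_mul_right (le_mul_of_one_le_left zero_le ?_) _)
      rw [ENNReal.coe_natCast, ← ENNReal.natCast_sub]
      exact_mod_cast Nat.sub_pos_of_lt hk
    · refine le_add_left (mul_le_mul_left (tsub_le_tsub_right ?_ _) _)
      exact_mod_cast hk
  intro hZ
  rw [hZ, ENNReal.mul_top hδ0, top_le_iff] at hle
  exact ENNReal.add_ne_top.2 ⟨ENNReal.mul_ne_top hδt (hd _), he⟩ hle

theorem Z_criticalFugacity_ne_top (hk : w k ≠ 0) (hrk : (r : ℝ≥0∞) < k)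
    (hc0 : criticalFugacity w ≠ 0) (hr : criticalDensity w ≤ r) :
    Z w (criticalFugacity w) ≠ ∞ := by
  have hd := deficit_criticalFugacity_ne_top hc0 (criticalFugacity_ne_top hk hrk hr)
  exact Z_ne_top_of_excess_ne_top
    (ne_top_of_le_ne_top (hd r) (excess_criticalFugacity_le hk hc0 hr)) hd

end Supercritical

section Subcritical

/-- Dividing the fugacity by n + 1 favours the deficit by a factor n + 1. This supplies the lower
end point for the intermediate value theorem. -/
theorem exists_excess_le_deficit {j : ℕ} (hj : w j ≠ 0) {r : ℝ≥0} (hjr : (j : ℝ≥0∞) < r)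
    {φ : ℝ≥0∞} (hφ0 : φ ≠ 0) (hφ : φ < criticalFugacity w) :
    ∃ ψ ≤ φ, ψ ≠ 0 ∧ excess w r ψ ≤ deficit w r ψ := by
  have hE : excess w r φ ≠ ∞ := ne_top_of_le_ne_top (massSum_lt_top hφ).ne (excess_le w r φ)
  obtain ⟨n, hn⟩ := ENNReal.exists_nat_mul_gt (deficit_ne_zero hj hjr hφ0) hE
  set x : ℝ≥0∞ := ((n + 1 : ℕ) : ℝ≥0∞) with hx
  have hx0 : x ≠ 0 := by rw [hx]; exact_mod_cast n.succ_ne_zero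
  have hxt : x ≠ ∞ := ENNReal.natCast_ne_top _
  have hx1 : 1 ≤ x := by rw [hx]; exact_mod_cast Nat.le_add_left 1 n
  have hxφ : x * (φ / x) = φ := ENNReal.mul_div_cancel hx0 hxt
  refine ⟨φ / x, ENNReal.div_le_of_le_mul' (le_mul_of_one_le_left zero_le hx1),
    (ENNReal.div_pos hφ0 hxt).ne', ?_⟩
  have h1 := excess_mul_le w (r := r) hx1 (φ / x)
  have h2 := deficit_mul_le w (r := r) hx1 (φ / x)
  rw [hxφ] at h1 h2
  have h3 : (n : ℝ≥0∞) * deficit w r φ ≤ x * deficit w r φ := by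
    rw [hx]; gcongr; exact n.le_succ
  have h4 : x ^ (⌊r⌋₊ + 1) * excess w r (φ / x) ≤ x ^ (⌊r⌋₊ + 1) * deficit w r (φ / x) := by
    refine h1.trans (hn.le.trans (h3.trans ?_))
    rw [pow_succ', mul_assoc]
    exact mul_le_mul_right h2 _
  exact (ENNReal.mul_le_mul_iff_right (pow_ne_zero _ hx0) (ENNReal.pow_ne_top hxt)).1 h4

theorem coe_pow_mul_eq (t : ℝ≥0) (k : ℕ) (a : ℝ≥0) :
    (t : ℝ≥0∞) ^ k * a = ENNReal.ofReal ((t : ℝ) ^ k * a) := by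
  rw [← ENNReal.coe_pow, ← ENNReal.coe_mul, ← ENNReal.ofReal_coe_nnreal]
  push_cast
  rfl

theorem Z_coe_toReal (t : ℝ≥0) : (Z w t).toReal = ∑' k : ℕ, (t : ℝ) ^ k * w k := by
  rw [Z, ENNReal.tsum_toReal_eq]
  · simp
  · intro k; rw [coe_pow_mul_eq]; exact ENNReal.ofReal_ne_top

theorem massSum_coe_toReal (t : ℝ≥0) :
    (massSum w t).toReal = ∑' k : ℕ, (k : ℝ) * ((t : ℝ) ^ k * w k) := by
  rw [massSum, ENNReal.tsum_toReal_eq]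
  · simp
  · intro k
    rw [coe_pow_mul_eq]
    exact ENNReal.mul_ne_top (ENNReal.natCast_ne_top k) ENNReal.ofReal_ne_top

theorem summable_Z {t : ℝ≥0} (ht : (t : ℝ≥0∞) < criticalFugacity w) :
    Summable fun k : ℕ => (t : ℝ) ^ k * w k := by
  simpa using ENNReal.summable_toReal (Z_lt_top_of_lt ht).ne

theorem summable_massSum {t : ℝ≥0} (ht : (t : ℝ≥0∞) < criticalFugacity w) :
    Summable fun k : ℕ => (k : ℝ) * ((t : ℝ) ^ k * w k) := by
  simpa using ENNReal.summable_toReal (massSum_lt_top ht).ne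

/-- The intermediate value theorem for the mass sum minus r times the partition sum, which is
continuous on [ψ, φ] because its terms are dominated by those at φ < φ_c. -/
theorem exists_isFugacity {j : ℕ} (hj : w j ≠ 0) {r : ℝ≥0} (hjr : (j : ℝ≥0∞) < r)
    (hr : r < criticalDensity w) : ∃ φ, IsFugacity w r φ := by
  obtain ⟨φ, hφ⟩ := lt_iSup_iff.1 hr
  obtain ⟨hφc, hφr⟩ := lt_iSup_iff.1 hφ
  have hφ0 : φ ≠ 0 := by
    rintro rfl
    rw [firstMoment_tilted_zero] at hφr
    exact not_lt_zero hφr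
  obtain ⟨ψ, hψφ, hψ0, hψ⟩ := exists_excess_le_deficit hj hjr hφ0 hφc
  have hψc := hψφ.trans_lt hφc
  have hψr := (firstMoment_tilted_le_iff ENNReal.coe_ne_top (Z_ne_zero hj hψ0)
    (Z_lt_top_of_lt hψc).ne).2 hψ
  have hφt := ne_top_of_lt hφc
  have hψt := ne_top_of_lt hψc
  lift φ to ℝ≥0 using hφt
  lift ψ to ℝ≥0 using hψt
  rw [firstMoment_tilted, ENNReal.div_le_iff (Z_ne_zero hj hψ0) (Z_lt_top_of_lt hψc).ne] at hψr
  rw [firstMoment_tilted, ENNReal.lt_div_iff_mul_lt (Or.inl (Z_ne_zero hj hφ0))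
    (Or.inl (Z_lt_top_of_lt hφc).ne)] at hφr
  set f : ℝ → ℝ := fun t => ∑' k : ℕ, ((k : ℝ) * (t ^ k * w k) - r * (t ^ k * w k)) with hf
  have hfv : ∀ t : ℝ≥0, (t : ℝ≥0∞) < criticalFugacity w →
      f t = (massSum w t).toReal - r * (Z w t).toReal := by
    intro t ht
    rw [hf, Z_coe_toReal, massSum_coe_toReal]
    simp only
    rw [(summable_massSum ht).tsum_sub ((summable_Z ht).mul_left _), tsum_mul_left]
  have hcont : ContinuousOn f (Set.Icc (ψ : ℝ) φ) := by
    refine continuousOn_tsum (u := fun k : ℕ => (k : ℝ) * ((φ : ℝ) ^ k * w k)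
      + r * ((φ : ℝ) ^ k * w k)) (fun k => by fun_prop)
      ((summable_massSum hφc).add ((summable_Z hφc).mul_left _)) ?_
    intro k t ht
    have ht0 : 0 ≤ t := le_trans ψ.2 ht.1
    have hp : t ^ k * w k ≤ (φ : ℝ) ^ k * w k := by
      gcongr
      exact ht.2
    have h0 : 0 ≤ t ^ k * (w k : ℝ) := by positivity
    refine (norm_sub_le _ _).trans ?_
    rw [Real.norm_of_nonneg (by positivity), Real.norm_of_nonneg (by positivity)]
    gcongr
  have h1 : f ψ ≤ 0 := by
    rw [hfv ψ hψc]
    have := ENNReal.toReal_mono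
      (ENNReal.mul_ne_top ENNReal.coe_ne_top (Z_lt_top_of_lt hψc).ne) hψr
    rw [ENNReal.toReal_mul, ENNReal.coe_toReal] at this
    linarith
  have h2 : 0 ≤ f φ := by
    rw [hfv φ hφc]
    have := ENNReal.toReal_mono (massSum_lt_top hφc).ne hφr.le
    rw [ENNReal.toReal_mul, ENNReal.coe_toReal] at this
    linarith
  obtain ⟨t, ht, hft⟩ := intermediate_value_Icc (by exact_mod_cast hψφ) hcont ⟨h1, h2⟩
  lift t to ℝ≥0 using le_trans ψ.2 ht.1
  have hψt : (ψ : ℝ≥0∞) ≤ t := by exact_mod_cast ht.1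
  have htφ : (t : ℝ≥0∞) ≤ φ := by exact_mod_cast ht.2
  have htc := htφ.trans_lt hφc
  have hZ0 : Z w t ≠ 0 := Z_ne_zero hj ((pos_iff_ne_zero.2 hψ0).trans_le hψt).ne'
  have hZt := (Z_lt_top_of_lt htc).ne
  refine ⟨t, hZ0, hZt, ?_⟩
  rw [hfv t htc, sub_eq_zero] at hft
  rw [firstMoment_tilted]
  have : massSum w t = r * Z w t := by
    rw [← ENNReal.toReal_eq_toReal_iff' (massSum_lt_top htc).ne
      (ENNReal.mul_ne_top ENNReal.coe_ne_top hZt), ENNReal.toReal_mul, ENNReal.coe_toReal, hft]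
  rw [this, ENNReal.mul_div_cancel_right hZ0 hZt]

end Subcritical

end Equilibrium

end CanonicalEnsemble

end

noncomputable section

namespace CanonicalEnsemble

/-! ### The tail of the equilibrium distribution -/

section Tail

variable {w : ℕ → ℝ≥0} {φ : ℝ≥0∞}

/-- The exponential rate of decay of `ω^φ`. -/
def tailExponent (w : ℕ → ℝ≥0) (φ : ℝ≥0∞) : ℝ≥0∞ :=
  (ENNReal.log (criticalFugacity w) - ENNReal.log φ).toENNReal

/-- Exponential moments of ω^φ are ratios of partition sums, so θ is subcritical or supercritical
for the moment according to the position of φ e^θ relative to φ_c. -/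
theorem tsum_tilted_mul_exp (w : ℕ → ℝ≥0) (φ : ℝ≥0∞) (θ : ℝ) :
    ∑' k : ℕ, tilted w φ {k} * ENNReal.ofReal (Real.exp (θ * k))
      = Z w (φ * ENNReal.ofReal (Real.exp θ)) / Z w φ := by
  rw [div_eq_mul_inv, Z, ← ENNReal.tsum_mul_right]
  refine tsum_congr fun k => ?_
  rw [tilted_singleton, div_eq_mul_inv, mul_pow, ← ENNReal.ofReal_pow (Real.exp_pos _).le,
    ← Real.exp_nat_mul, mul_comm θ]
  ring

theorem log_mul_exp (φ : ℝ≥0∞) (θ : ℝ) :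
    ENNReal.log (φ * ENNReal.ofReal (Real.exp θ)) = θ + ENNReal.log φ := by
  rw [ENNReal.log_mul_add, ENNReal.log_ofReal_of_pos (Real.exp_pos θ), Real.log_exp, add_comm]

theorem mul_exp_lt_criticalFugacity {θ : ℝ} (h : ENNReal.ofReal θ < tailExponent w φ) :
    φ * ENNReal.ofReal (Real.exp θ) < criticalFugacity w := by
  by_contra! hle
  have h1 := ENNReal.log_le_log hle
  rw [log_mul_exp] at h1
  have h2 := EReal.toENNReal_le_toENNReal (EReal.sub_le_of_le_add h1)
  rw [EReal.real_coe_toENNReal] at h2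
  exact absurd h (not_lt.2 h2)

theorem criticalFugacity_lt_mul_exp (hφ0 : φ ≠ 0) (hφt : φ ≠ ∞) {θ : ℝ}
    (h : tailExponent w φ < ENNReal.ofReal θ) :
    criticalFugacity w < φ * ENNReal.ofReal (Real.exp θ) := by
  by_contra! hle
  have h1 := ENNReal.log_le_log hle
  rw [log_mul_exp] at h1
  have hb : ENNReal.log φ ≠ ⊥ := by rwa [Ne, ENNReal.log_eq_bot_iff]
  have ht : ENNReal.log φ ≠ ⊤ := by rwa [Ne, ENNReal.log_eq_top_iff]
  have h2 := EReal.toENNReal_le_toENNReal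
    ((EReal.le_sub_iff_add_le (Or.inl hb) (Or.inl ht)).2 h1)
  rw [EReal.real_coe_toENNReal] at h2
  exact absurd h (not_lt.2 h2)

theorem summable_tilted_mul_exp (h0 : Z w φ ≠ 0) {θ : ℝ}
    (h : ENNReal.ofReal θ < tailExponent w φ) :
    Summable fun k : ℕ => (tilted w φ).real {k} * Real.exp (θ * k) := by
  have h1 : ∑' k : ℕ, tilted w φ {k} * ENNReal.ofReal (Real.exp (θ * k)) ≠ ∞ := by
    rw [tsum_tilted_mul_exp]
    exact ENNReal.div_ne_top (Z_lt_top_of_lt (mul_exp_lt_criticalFugacity h)).ne h0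
  have h2 := ENNReal.summable_toReal h1
  simpa only [ENNReal.toReal_mul, ENNReal.toReal_ofReal (Real.exp_pos _).le, Measure.real]
    using h2

theorem not_summable_tilted_mul_exp (hφ0 : φ ≠ 0) (hφt : φ ≠ ∞) (h0 : Z w φ ≠ 0)
    (h1 : Z w φ ≠ ∞) {θ : ℝ} (h : tailExponent w φ < ENNReal.ofReal θ) :
    ¬ Summable fun k : ℕ => (tilted w φ).real {k} * Real.exp (θ * k) := by
  intro hs
  have := isProbabilityMeasure_tilted_weight h0 h1
  have h2 := hs.tsum_ofReal_ne_top
  simp_rw [ENNReal.ofReal_mul measureReal_nonneg, Measure.real,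
    ENNReal.ofReal_toReal (measure_ne_top _ _)] at h2
  rw [tsum_tilted_mul_exp] at h2
  refine h2 ?_
  rw [ENNReal.div_eq_top]
  refine Or.inr ⟨?_, h1⟩
  by_contra hne
  exact absurd (le_criticalFugacity hne) (not_le.2 (criticalFugacity_lt_mul_exp hφ0 hφt h))

/-- Otherwise the masses would eventually lie below exp(-θm), and a geometric series would make the
exponential moment converge at some exponent still above the decay rate. -/
theorem frequently_exp_le_tilted (hφ0 : φ ≠ 0) (hφt : φ ≠ ∞) (h0 : Z w φ ≠ 0)
    (h1 : Z w φ ≠ ∞) {θ : ℝ} (h : tailExponent w φ < ENNReal.ofReal θ) :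
    ∃ᶠ m : ℕ in atTop, Real.exp (-(θ * m)) ≤ (tilted w φ).real {m} := by
  obtain ⟨y, hy, hyθ⟩ := exists_between h
  have hyt : y ≠ ∞ := ne_top_of_lt hyθ
  rw [← ENNReal.ofReal_toReal hyt] at hy hyθ
  have hlt : y.toReal < θ := (ENNReal.ofReal_lt_ofReal_iff'.1 hyθ).1
  by_contra hnot
  rw [not_frequently] at hnot
  refine not_summable_tilted_mul_exp hφ0 hφt h0 h1 hy ?_
  have hgeo : Summable fun m : ℕ => Real.exp (m * (y.toReal - θ)) :=
    Real.summable_exp_nat_mul_iff.2 (by linarith)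
  refine hgeo.of_norm_bounded_eventually_nat ?_
  filter_upwards [hnot] with m hm
  rw [not_le] at hm
  rw [Real.norm_of_nonneg (mul_nonneg measureReal_nonneg (Real.exp_pos _).le)]
  calc (tilted w φ).real {m} * Real.exp (y.toReal * m)
      ≤ Real.exp (-(θ * m)) * Real.exp (y.toReal * m) := by gcongr
    _ = Real.exp (m * (y.toReal - θ)) := by rw [← Real.exp_add]; ring_nf

end Tail

/-- The equilibrium fugacity at a density strictly between two points charged by the weight. -/
theorem fugacity_properties {w : ℕ → ℝ≥0} (hw : ∃ φ : ℝ≥0∞, 0 < φ ∧ Z w φ < ∞) {ρ : ℝ≥0} {j k : ℕ}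
    (hj : w j ≠ 0) (hjρ : (j : ℝ≥0) < ρ) (hk : w k ≠ 0) (hρk : ρ < (k : ℝ≥0)) :
    fugacity w ρ ≠ 0 ∧ fugacity w ρ ≠ ∞ ∧ Z w (fugacity w ρ) ≠ ∞ ∧
      firstMoment (tilted w (fugacity w ρ)) ≤ ρ ∧
      tailExponent w (fugacity w ρ) * ((ρ : ℝ≥0∞) - firstMoment (tilted w (fugacity w ρ))) = 0 ∧
      ∀ c, rate w ρ c = rateOf (tilted w (fugacity w ρ)) (tailExponent w (fugacity w ρ)) ρ c := by
  have hjρ' : (j : ℝ≥0∞) < ρ := by exact_mod_cast hjρ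
  have hρk' : (ρ : ℝ≥0∞) < k := by exact_mod_cast hρk
  have hjk : j < k := by exact_mod_cast hjρ.trans hρk
  have hk0 : k ≠ 0 := by omega
  have hρ0 : (ρ : ℝ≥0∞) ≠ 0 := (zero_le.trans_lt hjρ').ne'
  have hc0 := (criticalFugacity_pos hw).ne'
  have hcrit : fugacity w (criticalDensity w) = criticalFugacity w :=
    fugacity_eq_criticalFugacity hj hk hjk le_rfl (criticalDensity_ne_zero hw hk hk0)
  -- At or above ρ_c the fugacity is φ_c, so the decay rate is zero and any missing mass is free.
  rcases le_or_gt (criticalDensity w) ρ with hle | hgt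
  · have hρ : fugacity w ρ = criticalFugacity w :=
      fugacity_eq_criticalFugacity hj hk hjk hle hρ0
    have hct := criticalFugacity_ne_top hk hρk' hle
    have hZt := Z_criticalFugacity_ne_top hk hρk' hc0 hle
    have hlam : tailExponent w (criticalFugacity w) = 0 := by
      rw [tailExponent, EReal.sub_self, EReal.toENNReal_zero]
      · rwa [Ne, ENNReal.log_eq_top_iff]
      · rwa [Ne, ENNReal.log_eq_bot_iff]
    rw [hρ]
    refine ⟨hc0, hct, hZt, ?_, by rw [hlam, zero_mul], fun c => ?_⟩
    · exact (firstMoment_tilted_le_iff ENNReal.coe_ne_top (Z_ne_zero hj hc0) hZt).2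
        (excess_criticalFugacity_le hj hc0 hle)
    · rw [rate, rateOf, min_eq_right hle, equilibrium, hcrit, hρ, tailExponent]
  -- Below ρ_c the mean of ω^{Φ(ρ)} is exactly ρ, so the product with the deficit vanishes even for
  -- an infinite decay rate.
  · have hex := exists_isFugacity hj hjρ' hgt
    have hfug : IsFugacity w ρ (fugacity w ρ) := by
      unfold fugacity
      rw [dif_pos hex]
      exact hex.choose_spec
    obtain ⟨hZ0, hZt, hM⟩ := hfug
    refine ⟨?_, ?_, hZt, hM.le, by rw [hM, tsub_self, mul_zero], fun c => ?_⟩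
    · intro h
      rw [h, firstMoment_tilted_zero] at hM
      exact hρ0 hM.symm
    · intro h
      rw [h] at hZt
      refine hZt (ENNReal.tsum_eq_top_of_eq_top ⟨k, ?_⟩)
      rw [ENNReal.top_pow hk0, ENNReal.top_mul (by exact_mod_cast hk)]
    · rw [rate, rateOf, min_eq_left hgt.le, equilibrium, hcrit, tailExponent]

theorem exponentiallyTight_of_compactSpace {X : Type*} [TopologicalSpace X] [CompactSpace X]
    [MeasurableSpace X] (P : ℕ → Measure X) {a : ℕ → ℕ} (ha : ∀ n, 0 < a n) :
    ExponentiallyTight P a := by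
  refine fun M => ⟨Set.univ, isCompact_univ, ?_⟩
  refine limsup_le_of_le (h := Eventually.of_forall fun n => ?_)
  rw [log_div_le_iff (ha n), Set.compl_univ, measure_empty]
  exact zero_le

theorem equicoercive_of_compactSpace {X : Type*} [TopologicalSpace X] [CompactSpace X]
    (F : ℕ → X → ℝ≥0∞) : Equicoercive F :=
  fun _ => ⟨Set.univ, isCompact_univ, fun _ => Set.subset_univ _⟩

end CanonicalEnsemble

end

/-! ### The theorem -/

open CanonicalEnsemble in
theorem theorem1p1
    -- the weight: not more than exponentially growing; probability measures are a special case
    (w : ℕ → ℝ≥0) (hw : ∃ φ : ℝ≥0∞, 0 < φ ∧ Z w φ < ∞)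
    -- the density lies strictly inside the convex hull of the support of the weight
    (ρ : ℝ≥0) (hlow : ∃ j : ℕ, w j ≠ 0 ∧ (j : ℝ≥0) < ρ) (hhigh : ∃ k : ℕ, w k ≠ 0 ∧ ρ < (k : ℝ≥0))
    -- the thermodynamic limit, along which the canonical measures exist
    (N L : ℕ → ℕ) (hLpos : ∀ n, 0 < L n) (hL : Tendsto L atTop atTop)
    (hNL : Tendsto (fun n => (N n : ℝ≥0) / (L n : ℝ≥0)) atTop (𝓝 ρ))
    (hZ : ∀ n, normalization w (N n) (L n) ≠ 0)
    (ρbar : ℝ≥0) (hρbar : ∀ n, (N n : ℝ≥0) / (L n : ℝ≥0) ≤ ρbar) :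
    -- equicoercivity of the entropies, also after rescaling
    Equicoercive (fun n (C : ProbabilityMeasure (MomentLE ρbar)) =>
      klDiv (C : Measure (MomentLE ρbar)) (canonicalLaw w (hLpos n) (hρbar n))) ∧
    Equicoercive (fun n (C : ProbabilityMeasure (MomentLE ρbar)) =>
      (L n : ℝ≥0∞)⁻¹ * klDiv (C : Measure (MomentLE ρbar))
        (canonicalLaw w (hLpos n) (hρbar n))) ∧
    -- Γ-convergence of the rescaled entropies
    GammaTendsto
      (fun n (C : ProbabilityMeasure (MomentLE ρbar)) =>
        (L n : ℝ≥0∞)⁻¹ * klDiv (C : Measure (MomentLE ρbar))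
          (canonicalLaw w (hLpos n) (hρbar n)))
      (fun C => ∫⁻ c, rate w ρ c.toMeasure ∂(C : Measure (MomentLE ρbar))) ∧
    -- exponential tightness and large deviation principle
    ExponentiallyTight (fun n => canonicalLaw w (hLpos n) (hρbar n)) L ∧
    LargeDeviationPrinciple (fun n => canonicalLaw w (hLpos n) (hρbar n)) L
      (fun c : MomentLE ρbar => rate w ρ c.toMeasure) := by
  obtain ⟨j, hj, hjρ⟩ := hlow
  obtain ⟨k, hk, hρk⟩ := hhigh
  obtain ⟨hφ0, hφt, hZt, hM, hlam, hrate⟩ := fugacity_properties hw hj hjρ hk hρk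
  generalize fugacity w ρ = φ at *
  have hZ0 : Z w φ ≠ 0 := Z_ne_zero hj hφ0
  have := isProbabilityMeasure_tilted_weight hZ0 hZt
  lift φ to ℝ≥0 using hφt
  -- The tilted probability weights differ from w only by an exponential factor, so they define the
  -- same canonical laws.
  set q : ℕ → ℝ≥0 := fun m => (tilted w φ {m}).toNNReal with hq
  have hqw : ∀ m, q m = (Z w φ).toNNReal⁻¹ * φ ^ m * w m := by
    intro m
    rw [hq]
    simp only
    rw [tilted_singleton, ENNReal.toNNReal_div, ENNReal.toNNReal_mul, ENNReal.toNNReal_pow,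
      ENNReal.toNNReal_coe, ENNReal.toNNReal_coe, div_eq_inv_mul, mul_assoc]
  have hφ0' : φ ≠ 0 := by exact_mod_cast hφ0
  have hb0 : (Z w φ).toNNReal⁻¹ ≠ 0 := by
    rw [Ne, inv_eq_zero, ENNReal.toNNReal_eq_zero_iff, not_or]
    exact ⟨hZ0, hZt⟩
  have hlaw : ∀ n, canonicalLaw q (hLpos n) (hρbar n) = canonicalLaw w (hLpos n) (hρbar n) :=
    fun n => canonicalLaw_of_eq_mul (hLpos n) (hρbar n) hb0 hφ0' hqw
  have hνpos : ∀ m, w m ≠ 0 → tilted w φ {m} ≠ 0 := by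
    intro m hm
    rw [tilted_singleton]
    exact (ENNReal.div_pos (mul_ne_zero (pow_ne_zero _ hφ0) (by exact_mod_cast hm)) hZt).ne'
  have hqZ : ∀ n, normalization q (N n) (L n) ≠ 0 := by
    intro n
    rw [normalization_of_eq_mul hqw]
    exact mul_ne_zero (by exact_mod_cast mul_ne_zero (pow_ne_zero _ hb0) (pow_ne_zero _ hφ0'))
      (hZ n)
  have hbounds := exponentialBounds_canonicalLaw (tilted w φ) hLpos hρbar hL hNL hqZ
    (hνpos j hj) (hνpos k hk) (by exact_mod_cast hjρ) (by exact_mod_cast hρk)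
    (fun θ _ h => summable_tilted_mul_exp hZ0 h)
    (fun θ h => frequently_exp_le_tilted hφ0 ENNReal.coe_ne_top hZ0 hZt h) hM hlam
  simp only [← hq, hlaw, ← hrate] at hbounds
  have : ∀ n, IsProbabilityMeasure (canonicalLaw w (hLpos n) (hρbar n)) := fun n =>
    isProbabilityMeasure_canonicalLaw (hLpos n) (hρbar n) w (hZ n)
  exact ⟨equicoercive_of_compactSpace _, equicoercive_of_compactSpace _, hbounds.gammaTendsto,
    exponentiallyTight_of_compactSpace _ hLpos, hbounds.largeDeviationPrinciple⟩
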